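/- **Conventions.** For each $n$ let $\lambda=\lambda(n)=\mathrm{poly}(n)$ be the security parameter and let $0\le m=m(n)\le n$, where $1^n\mapsto 1^{\lambda(n)}$ and $1^n\mapsto 1^{m(n)}$ are computable in polynomial time. A QPT algorithm is a family of quantum circuits over the gate set $\{X,H,T,T^{-1},\mathrm{CNOT},\mathrm{Toffoli}\}$ (with ancillas in $|0\rangle$, and with discarded wires) whose $n$-th circuit is generated from $1^n$ by a classical algorithm in time polynomial in $n$; an oracle algorithm may in addition contain gates that query its oracle. $\mathrm{negl}$ denotes a function that is eventually smaller than every inverse polynomial. Let $\{U_k\}_{k\in\{0,1\}^{\lambda}}$ be pseudorandom unitaries (PRU) on $n$ qubits: (i) some QPT algorithm maps $k$ and $|\psi\rangle$ to $U_k|\psi\rangle$; (ii) for every QPT oracle algorithm $\mathcal A$, $$\Big|\Pr_{k\leftarrow\{0,1\}^\lambda}[\mathcal A^{U_k}=1]-\Pr_{U\leftarrow\text{Haar}}[\mathcal A^{U}=1]\Big|\le\mathrm{negl}(\lambda).$$ Let $\sigma_m=I/2^m$ be the maximally mixed state of $m$ qubits and put $$\rho_{k,m}=U_k\big((|0\rangle\langle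 0|)^{\otimes (n-m)}\otimes\sigma_m\big)U_k^\dagger ,\qquad \mathcal V(\rho,k,m)=\mathrm{tr}\big((|0\rangle\langle 0|)^{\otimes (n-m)}\,\mathrm{tr}_m(U_k^\dagger\rho\, U_k)\big),$$ where $\mathrm{tr}_m$ traces out the last $m$ qubits. **Theorem.** Assume $n-m=\omega(\log n)$ (for example, $m<n-\log^{c} n$ for all large $n$, with some constant $c>1$). Then: 1. There are QPT algorithms KeyGen, StateGen and Ver such that KeyGen outputs a uniformly random $k\in\{0,1\}^\lambda$, StateGen maps $k$ to exactly $\rho_{k,m}$, and Ver accepts $(k,\rho)$ with probability exactly $\mathcal V(\rho,k,m)$ for every state $\rho$; and they form a one-way state generator, that is: - *Correctness:* $\Pr[\top\leftarrow\mathrm{Ver}(k,\rho_{k,m})]\ge 1-\mathrm{negl}(\lambda)$ for $k\leftarrow\mathrm{KeyGen}$. - *Security:* for every polynomially bounded $t=t(n)$ such that $1^n\mapsto 1^{t(n)}$ is computable in polynomial time (for example, every polynomial) and every QPT adversary $\mathcal A$, $$\Pr\big[\top\leftarrow\mathrm{Ver}(k',\rho_{k,m}) : k\leftarrow\mathrm{KeyGen},\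 k'\leftarrow\mathcal A(\rho_{k,m}^{\otimes t})\big]\le\mathrm{negl}(\lambda).$$ 2. The purity is $\mathrm{tr}(\rho_{k,m}^2)=2^{-m}$ for all $n$ and $k$. 3. If moreover $m=\omega(\log n)$, then for all $t$ as in 1 and every QPT algorithm $\mathcal D$ with a one-bit output, $$\Big|\Pr_{k\leftarrow\{0,1\}^\lambda}[\mathcal D(\rho_{k,m}^{\otimes t})=1]-\Pr[\mathcal D((I/2^n)^{\otimes t})=1]\Big|\le\mathrm{negl}(\lambda).$$ -/

import Mathlib

open Matrix MeasureTheory Filter Asymptotics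
open scoped BigOperators ComplexOrder

namespace VPRDM

/-! ### Classical polynomial time

A small deterministic machine model with an explicit running time: WHILE programs on binary trees.
Every elementary operation is charged the size of the data it handles, so polynomial time in this
model is the usual class of polynomial-time computable functions. -/

/-- Binary trees, the data of the programs. -/
inductive Data : Type
  | leaf : Data
  | node : Data → Data → Data

namespace Data

/-- The number of nodes and leaves. -/
def size : Data → ℕ
  | leaf => 1
  | node a b => a.size + b.size + 1

/-- The left subtree (a leaf has itself as subtrees). -/
def left : Data → Data
  | leaf => leaf
  | node a _ => a

/-- The right subtree. -/
def right : Data → Data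
  | leaf => leaf
  | node _ b => b

/-- The number `n` written in unary. -/
def ofNat : ℕ → Data
  | 0 => leaf
  | n + 1 => node leaf (ofNat n)

/-- A finite list of trees. -/
def ofList : List Data → Data
  | [] => leaf
  | a :: l => node a (ofList l)

end Data

/-- Programs. `comp f g` runs `g`, then `f`; `ite c f g` runs `f` if `c` returns a node and `g` if
it returns a leaf; `loop c b` repeats `b` as long as `c` returns a node. -/
inductive Prog : Type
  | id : Prog
  | leaf : Prog
  | left : Prog
  | right : Prog
  | pair : Prog → Prog → Prog
  | comp : Prog → Prog → Prog
  | ite : Prog → Prog → Prog → Prog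
  | loop : Prog → Prog → Prog

/-- `Runs p x y s`: the program `p` halts on input `x` with output `y` after `s` time steps. -/
inductive Runs : Prog → Data → Data → ℕ → Prop
  | id (x : Data) : Runs Prog.id x x (x.size + 1)
  | leaf (x : Data) : Runs Prog.leaf x Data.leaf 1
  | left (x : Data) : Runs Prog.left x x.left (x.size + 1)
  | right (x : Data) : Runs Prog.right x x.right (x.size + 1)
  | pair {f g : Prog} {x y z : Data} {a b : ℕ} (hf : Runs f x y a) (hg : Runs g x z b) :
      Runs (Prog.pair f g) x (Data.node y z) (x.size + a + b + 1)
  | comp {f g : Prog} {x y z : Data} {a b : ℕ} (hg : Runs g x y a) (hf : Runs f y z b) :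
      Runs (Prog.comp f g) x z (a + b + 1)
  | ite_node {c f g : Prog} {x u v y : Data} {a b : ℕ} (hc : Runs c x (Data.node u v) a)
      (hf : Runs f x y b) : Runs (Prog.ite c f g) x y (x.size + a + b + 1)
  | ite_leaf {c f g : Prog} {x y : Data} {a b : ℕ} (hc : Runs c x Data.leaf a)
      (hg : Runs g x y b) : Runs (Prog.ite c f g) x y (x.size + a + b + 1)
  | loop_leaf {c b : Prog} {x : Data} {a : ℕ} (hc : Runs c x Data.leaf a) :
      Runs (Prog.loop c b) x x (x.size + a + 1)
  | loop_node {c b : Prog} {x u v y z : Data} {a d e : ℕ} (hc : Runs c x (Data.node u v) a)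
      (hb : Runs b x y d) (hl : Runs (Prog.loop c b) y z e) :
      Runs (Prog.loop c b) x z (x.size + a + d + e + 1)

/-- The sequence of data `f n` is produced from `1ⁿ` by one program in time polynomial in `n`. -/
def PolyTimeGenerated (f : ℕ → Data) : Prop :=
  ∃ (p : Prog) (q : Polynomial ℕ), ∀ n, ∃ s, s ≤ q.eval n ∧ Runs p (Data.ofNat n) (f n) s

/-- `1ⁿ ↦ 1^(f n)` is computable in polynomial time (in particular `f` is polynomially bounded). -/
def UnaryPolyTime (f : ℕ → ℕ) : Prop :=
  PolyTimeGenerated fun n => Data.ofNat (f n)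

/-! ### Negligible functions -/

/-- A positive function that is eventually below every inverse polynomial. -/
def Negligible (μ : ℕ → ℝ) : Prop :=
  (∀ n, 0 < μ n) ∧ ∀ c : ℕ, ∃ n₀ : ℕ, ∀ n, n₀ < n → μ n < ((n : ℝ) ^ c)⁻¹

/-- `f ≤ negl(λ)`, where the security parameter `λ = lam n` depends on `n`. -/
def LeNegl (lam : ℕ → ℕ) (f : ℕ → ℝ) : Prop :=
  ∃ μ, Negligible μ ∧ ∀ n, f n ≤ μ (lam n)

/-! ### States and operators of several qubits -/

/-- Classical values of `n` bits; these label the computational basis of `n` qubits. -/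
abbrev Reg (n : ℕ) : Type := Fin n → Bool

/-- Operators on `n` qubits. -/
abbrev Op (n : ℕ) : Type := Matrix (Reg n) (Reg n) ℂ

/-- Unitary operators on `n` qubits. -/
abbrev Uni (n : ℕ) : Type := ↥(Matrix.unitaryGroup (Reg n) ℂ)

/-- The basis state `|k⟩⟨k|`. -/
noncomputable def basisState {a : ℕ} (k : Reg a) : Op a := Matrix.single k k 1

/-- `|ψ⟩⟨ψ|`. -/
noncomputable def pureState {a : ℕ} (ψ : Reg a → ℂ) : Op a := Matrix.vecMulVec ψ (star ψ)

/-- `A ⊗ B`, the wires of `A` coming first. -/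
noncomputable def tensor {a b : ℕ} (A : Op a) (B : Op b) : Op (a + b) :=
  Matrix.of fun x y =>
    A (x ∘ Fin.castAdd b) (y ∘ Fin.castAdd b) * B (x ∘ Fin.natAdd a) (y ∘ Fin.natAdd a)

/-- `A ^ ⊗ t`, where copy `j` lives on the wires `j * n, …, j * n + n - 1`. -/
noncomputable def tensorPow {n : ℕ} (A : Op n) (t : ℕ) : Op (t * n) :=
  Matrix.of fun x y =>
    ∏ j : Fin t, A (fun i => x (finProdFinEquiv (j, i))) (fun i => y (finProdFinEquiv (j, i)))

/-- The maximally mixed state `I / 2ⁿ`. -/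
noncomputable def maxMixed (n : ℕ) : Op n := ((2 : ℂ) ^ n)⁻¹ • (1 : Op n)

/-- `ρ ⊗ |0⟩⟨0|`: the first `i` of `w` wires carry `ρ`, all other wires are zero. -/
noncomputable def padZero {i w : ℕ} (h : i ≤ w) (ρ : Op i) : Op w :=
  Matrix.of fun x y =>
    if ∀ j : Fin w, i ≤ j.val → x j = false ∧ y j = false then
      ρ (x ∘ Fin.castLE h) (y ∘ Fin.castLE h) else 0

/-- The partial trace over all wires but the first `o`. -/
noncomputable def keepFirst {o w : ℕ} (h : o ≤ w) (σ : Op w) : Op o :=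
  Matrix.of fun a b =>
    ∑ x : Reg w, ∑ y : Reg w,
      if x ∘ Fin.castLE h = a ∧ y ∘ Fin.castLE h = b ∧ ∀ j : Fin w, o ≤ j.val → x j = y j then
        σ x y else 0

/-- The operator on `w` wires that acts as `A` on the wires `q 0, …, q (a - 1)` and as the identity
on the others. -/
noncomputable def onWires {a w : ℕ} (q : Fin a ↪ Fin w) (A : Op a) : Op w :=
  Matrix.of fun x y =>
    if ∀ j : Fin w, j ∉ Set.range q → x j = y j then A (x ∘ q) (y ∘ q) else 0

/-! ### Quantum circuits -/

/-- A finite universal gate set. -/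
inductive GateKind : Type
  | X | H | T | Tinv | CNOT | CCNOT

namespace GateKind

/-- The number of wires a gate acts on. -/
@[reducible] def arity : GateKind → ℕ
  | X => 1
  | H => 1
  | T => 1
  | Tinv => 1
  | CNOT => 2
  | CCNOT => 3

/-- A number naming the gate. -/
def code : GateKind → ℕ
  | X => 0
  | H => 1
  | T => 2
  | Tinv => 3
  | CNOT => 4
  | CCNOT => 5

/-- The bit flip. -/
noncomputable def matX : Op 1 := Matrix.of fun x y => if x 0 = !y 0 then 1 else 0

/-- The Hadamard gate. -/
noncomputable def matH : Op 1 :=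
  Matrix.of fun x y => ((Real.sqrt 2 : ℝ) : ℂ)⁻¹ * (if x 0 && y 0 then -1 else 1)

/-- The phase gate `diag (1, exp (i s))`. -/
noncomputable def matPhase (s : ℝ) : Op 1 :=
  Matrix.diagonal fun x => if x 0 then Complex.exp (s * Complex.I) else 1

/-- The controlled bit flip, controlled on the first wire. -/
noncomputable def matCNOT : Op 2 :=
  Matrix.of fun x y => if x 0 = y 0 ∧ x 1 = xor (y 1) (y 0) then 1 else 0

/-- The Toffoli gate, controlled on the first two wires. -/
noncomputable def matCCNOT : Op 3 :=
  Matrix.of fun x y => if x 0 = y 0 ∧ x 1 = y 1 ∧ x 2 = xor (y 2) (y 0 && y 1) then 1 else 0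

/-- The unitary matrix of a gate; `T` is `diag (1, exp (i π / 4))`. -/
noncomputable def mat : (g : GateKind) → Op g.arity
  | X => matX
  | H => matH
  | T => matPhase (Real.pi / 4)
  | Tinv => matPhase (-(Real.pi / 4))
  | CNOT => matCNOT
  | CCNOT => matCCNOT

end GateKind

/-- A gate placed on distinct wires of a `w`-wire circuit. -/
structure Gate (w : ℕ) where
  kind : GateKind
  wires : Fin kind.arity ↪ Fin w

/-- A gate of a circuit with an oracle for an `n`-qubit unitary: an ordinary gate, or a query. -/
inductive OracleGate (n w : ℕ) : Type
  | basic : Gate w → OracleGate n w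
  | query : (Fin n ↪ Fin w) → OracleGate n w

/-- A circuit with gates from `G`, `i` input qubits and `o` output qubits. It has `w` wires; the
input is placed on the first `i`, all others start in `|0⟩`, the gates are applied in the order of
the list, and the first `o` wires are the output (the others are discarded). -/
structure Circuit (G : ℕ → Type) (i o : ℕ) where
  w : ℕ
  input_le : i ≤ w
  output_le : o ≤ w
  gates : List (G w)

/-- The operator of a gate. -/
noncomputable def Gate.op {w : ℕ} (g : Gate w) : Op w := onWires g.wires g.kind.mat

/-- The operator of a gate of an oracle circuit, with `U` as the oracle. -/
noncomputable def OracleGate.op {n w : ℕ} (U : Op n) : OracleGate n w → Op w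
  | basic g => g.op
  | query q => onWires q U

/-- The product of the gates, the first gate of the list acting first. -/
noncomputable def totalOp {w : ℕ} {α : Type} (op : α → Op w) (l : List α) : Op w :=
  l.foldl (fun M g => op g * M) 1

/-- The quantum channel from `i` to `o` qubits that a circuit implements. -/
noncomputable def Circuit.run {i o : ℕ} (C : Circuit Gate i o) (ρ : Op i) : Op o :=
  keepFirst C.output_le
    (totalOp Gate.op C.gates * padZero C.input_le ρ * (totalOp Gate.op C.gates)ᴴ)

/-- The quantum channel that an oracle circuit implements when its oracle is `U`. -/
noncomputable def Circuit.runWith {n i o : ℕ} (C : Circuit (OracleGate n) i o) (U : Op n)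
    (ρ : Op i) : Op o :=
  keepFirst C.output_le
    (totalOp (OracleGate.op U) C.gates * padZero C.input_le ρ *
      (totalOp (OracleGate.op U) C.gates)ᴴ)

/-- The probability of the outcome `z` when a state is measured in the computational basis. -/
noncomputable def outcomeProb {a : ℕ} (σ : Op a) (z : Reg a) : ℝ := (σ z z).re

/-- The one-bit string `1`, read as "accept". -/
def accept : Reg 1 := fun _ => true

/-! ### Quantum polynomial time -/

/-- The list of wires as data. -/
def wiresData {a w : ℕ} (q : Fin a ↪ Fin w) : Data :=
  Data.ofList (List.ofFn fun j => Data.ofNat (q j).val)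

/-- A gate as data. -/
def Gate.data {w : ℕ} (g : Gate w) : Data :=
  Data.node (Data.ofNat g.kind.code) (wiresData g.wires)

/-- A gate of an oracle circuit as data. -/
def OracleGate.data {n w : ℕ} : OracleGate n w → Data
  | basic g => g.data
  | query q => Data.node (Data.ofNat 6) (wiresData q)

/-- The description of a circuit: its number of wires and the list of its gates. -/
def Circuit.data {G : ℕ → Type} {i o : ℕ} (gateData : ∀ w, G w → Data) (C : Circuit G i o) :
    Data :=
  Data.node (Data.ofNat C.w) (Data.ofList (C.gates.map (gateData C.w)))

/-- A QPT algorithm: a uniform family of polynomial-size circuits, that is, the description of the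
`n`-th circuit is computed from `1ⁿ` in time polynomial in `n`. -/
def IsQPT {i o : ℕ → ℕ} (C : ∀ n, Circuit Gate (i n) (o n)) : Prop :=
  PolyTimeGenerated fun n => (C n).data fun _ => Gate.data

/-- A QPT algorithm with an oracle for an `n`-qubit unitary. -/
def IsOracleQPT {i o : ℕ → ℕ} (C : ∀ n, Circuit (OracleGate n) (i n) (o n)) : Prop :=
  PolyTimeGenerated fun n => (C n).data fun _ => OracleGate.data

/-! ### Haar measure and pseudorandom unitaries -/

noncomputable instance (n : ℕ) : MeasurableSpace (Uni n) := borel (Uni n)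

instance (n : ℕ) : BorelSpace (Uni n) := ⟨rfl⟩

instance (n : ℕ) : CompactSpace (Uni n) := by
  have hclosed : IsClosed {A : Op n | Aᴴ * A = 1 ∧ A * Aᴴ = 1} := by
    refine IsClosed.inter (isClosed_eq ?_ continuous_const) (isClosed_eq ?_ continuous_const)
    · exact (continuous_id.matrix_conjTranspose).matrix_mul continuous_id
    · exact continuous_id.matrix_mul continuous_id.matrix_conjTranspose
  have hset : ((Matrix.unitaryGroup (Reg n) ℂ : Submonoid (Op n)) : Set (Op n)) =
      {A : Op n | Aᴴ * A = 1 ∧ A * Aᴴ = 1} := by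
    ext A
    exact Unitary.mem_iff
  rw [← hset] at hclosed
  have hK : IsCompact (Set.univ.pi fun _ : Reg n =>
      Set.univ.pi fun _ : Reg n => Metric.closedBall (0 : ℂ) 1) :=
    isCompact_univ_pi fun _ => isCompact_univ_pi fun _ => isCompact_closedBall 0 1
  refine isCompact_iff_compactSpace.mp (IsCompact.of_isClosed_subset hK hclosed ?_)
  intro A hA x _ y _
  simpa using entry_norm_bound_of_unitary hA x y

/-- The Haar probability measure on the unitary group of `n` qubits. -/
noncomputable def haar (n : ℕ) : Measure (Uni n) := Measure.haarMeasure ⊤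

/-- The average over a uniformly random key. -/
noncomputable def keyAvg {a : ℕ} (f : Reg a → ℝ) : ℝ := (∑ k, f k) / 2 ^ a

/-- Pseudorandom unitaries: `U n k` is an `n`-qubit unitary for a key `k` of `lam n` bits. -/
structure IsPRU (lam : ℕ → ℕ) (U : ∀ n, Reg (lam n) → Uni n) : Prop where
  /-- A QPT algorithm maps `k` and `|ψ⟩` to `U_k |ψ⟩`. -/
  efficient : ∃ G : ∀ n, Circuit Gate (lam n + n) n, IsQPT G ∧
    ∀ (n : ℕ) (k : Reg (lam n)) (ψ : Reg n → ℂ), star ψ ⬝ᵥ ψ = 1 →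
      (G n).run (tensor (basisState k) (pureState ψ)) = pureState ((U n k : Op n) *ᵥ ψ)
  /-- No QPT algorithm distinguishes the oracle `U_k`, for a random key `k`, from a Haar random
  unitary. -/
  pseudorandom : ∀ A : ∀ n, Circuit (OracleGate n) 0 1, IsOracleQPT A →
    LeNegl lam fun n =>
      |keyAvg (fun k => outcomeProb ((A n).runWith (U n k : Op n) 1) accept)
        - ∫ V : Uni n, outcomeProb ((A n).runWith (V : Op n) 1) accept ∂(haar n)|

/-! ### One-way state generators -/

/-- The algorithms of a state generator with keys of `κ n` bits and states of `n` qubits. -/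
structure StateGenerator (κ : ℕ → ℕ) where
  keyGen : ∀ n, Circuit Gate 0 (κ n)
  stateGen : ∀ n, Circuit Gate (κ n) n
  ver : ∀ n, Circuit Gate (κ n + n) 1

namespace StateGenerator

variable {κ : ℕ → ℕ}

/-- The probability that the key generator outputs `k`. -/
noncomputable def keyProb (S : StateGenerator κ) (n : ℕ) (k : Reg (κ n)) : ℝ :=
  outcomeProb ((S.keyGen n).run 1) k

/-- The state `φ_k`. -/
noncomputable def state (S : StateGenerator κ) (n : ℕ) (k : Reg (κ n)) : Op n :=
  (S.stateGen n).run (basisState k)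

/-- The probability that the verifier accepts the key `k` and the state `ρ`. -/
noncomputable def verProb (S : StateGenerator κ) (n : ℕ) (k : Reg (κ n)) (ρ : Op n) : ℝ :=
  outcomeProb ((S.ver n).run (tensor (basisState k) ρ)) accept

/-- One-way state generators, with security parameter `lam n`. -/
structure IsOWSG (S : StateGenerator κ) (lam : ℕ → ℕ) : Prop where
  keyGen_qpt : IsQPT S.keyGen
  stateGen_qpt : IsQPT S.stateGen
  ver_qpt : IsQPT S.ver
  /-- The verifier accepts `k` and `φ_k` with probability at least `1 - negl(λ)`. -/
  correct : LeNegl lam fun n => 1 - ∑ k, S.keyProb n k * S.verProb n k (S.state n k)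
  /-- A QPT adversary that is given `t` copies of `φ_k` outputs, with at most negligible
  probability, a key `k'` that the verifier accepts for `φ_k`. -/
  secure : ∀ t : ℕ → ℕ, UnaryPolyTime t →
    ∀ A : ∀ n, Circuit Gate (t n * n) (κ n), IsQPT A →
      LeNegl lam fun n => ∑ k, S.keyProb n k *
        ∑ k', outcomeProb ((A n).run (tensorPow (S.state n k) (t n))) k' *
          S.verProb n k' (S.state n k)

end StateGenerator

/-! ### The construction -/

/-- `(|0⟩⟨0|)^⊗(n - m) ⊗ σ_m`, with `σ_m` the maximally mixed state of the last `m` qubits. -/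
noncomputable def taggedMixed (n m : ℕ) : Op n :=
  Matrix.diagonal fun x => if ∀ i : Fin n, i.val < n - m → x i = false then ((2 : ℂ) ^ m)⁻¹ else 0

/-- `ρ_{k,m} = U_k ((|0⟩⟨0|)^⊗(n - m) ⊗ σ_m) U_k†`, for `U_k = V`. -/
noncomputable def vprdm {n : ℕ} (V : Uni n) (m : ℕ) : Op n :=
  (V : Op n) * taggedMixed n m * (V : Op n)ᴴ

/-- `tr ((|0⟩⟨0|)^⊗(n - m) tr_m (U_k† ρ U_k))`, where `U_k = V` and `tr_m` traces out the last `m`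
qubits: the probability with which the key-based verifier accepts `ρ`. -/
noncomputable def vprdmVerify {n : ℕ} (V : Uni n) (m : ℕ) (ρ : Op n) : ℝ :=
  (basisState (fun _ => false) *
    keepFirst (Nat.sub_le n m) ((V : Op n)ᴴ * ρ * (V : Op n))).trace.re

/-- Polynomially many copies of `ρ n k`, for a random key `k`, are computationally
indistinguishable from as many copies of the maximally mixed state. -/
def IndistFromMaxMixed (lam : ℕ → ℕ) (ρ : ∀ n, Reg (lam n) → Op n) : Prop :=
  ∀ t : ℕ → ℕ, UnaryPolyTime t →
    ∀ D : ∀ n, Circuit Gate (t n * n) 1, IsQPT D →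
      LeNegl lam fun n =>
        |keyAvg (fun k => outcomeProb ((D n).run (tensorPow (ρ n k) (t n))) accept)
          - outcomeProb ((D n).run (tensorPow (maxMixed n) (t n))) accept|

end VPRDM

/-! All estimates concern tuples of columns of a unitary. Expanding the maximally mixed qubits,
`tensorPow_vprdm` writes `t` copies of the state as the uniform average of pure states, each a
tensor product of `t` columns chosen among the `2 ^ m` columns whose index starts with `n - m`
zeros. On such a pure state every outcome probability of a circuit is a sum of squared moduli of
linear functionals (`outcomeProb_run_pureState`).

From pseudorandom to Haar: the copies can be prepared by oracle queries (`oracleCircuit_runWith`),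
so in a one-bit QPT test on copies the pseudorandom unitary may be replaced by a Haar random one at
negligible cost (`IsPRU.leNegl_tensorPow`). For one-wayness the test is the whole game on `t + 1`
copies: the adversary gets `t` of them, its answer is copied out, and the verifier examines the last
copy with the guessed key (`attackCircuit_run`). The guessed unitary enters only through the
verifier's own circuit and is unaffected by the replacement.

One-wayness for Haar unitaries: `integral_guess_le` bounds the game by `(t + 1) * 2 ^ m / 2 ^ n`.
The point is that the mean of `|P|² |q|²` is at most `(t + 1) / 2 ^ n` times the mean of `|P|²`,
where `P` is an amplitude on `t` columns and `q` the overlap of one column with a fixed unit vector.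
By right invariance, `V` may be replaced by `V * diag z * H`, with `H` the Hadamard gate on every
qubit and `z` a tuple of roots of unity of order `t + 2`. In `z`, `P` is a polynomial of degree at
most `t`, and `q` is a linear form whose coefficients have squared norm `2 ^ (-n)`, because the
entries of `H` are flat. Parseval turns means over `z` into sums of squared coefficients.
Multiplication by a linear form increases such a sum by at most the factor `t + 1` times the squared
norm of the form, because a monomial of degree at most `t + 1` contains at most `t + 1` variables
(`coeffNormSq_mul_linear_le`).

Indistinguishability: permuting the columns is right multiplication too, so the Haar mean of an
outcome probability is the same for all injective tuples of columns. At most a fraction `t ^ 2 / 2 ^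
m` of the tuples is not injective, and the maximally mixed state is the case `m = n`
(`abs_integral_tensorPow_sub_maxMixed_le`).

Exactness of the algorithms: a circuit for `U_k` may leave garbage on its discarded wires, but since
its output is always pure, the garbage is a vector independent of the input (`exists_fixed_vector`,
`exists_garbage`). The verifier manufactures this garbage by running the circuit on a zero state,
exchanges the output for the state under test, and runs the circuit backwards
(`uncomputeBlock_evolve`). The circuits are uniform because their descriptions are produced by
nested loops over unary counters. -/

namespace VPRDM

/-! ### Closure properties of classical polynomial time -/

/-- `x` if the tree `c` is a node, and `y` if it is a leaf. -/
def Data.cond (c x y : Data) : Data :=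
  match c with
  | Data.leaf => y
  | Data.node _ _ => x

theorem Data.size_pos (x : Data) : 0 < x.size := by cases x <;> simp [Data.size]

theorem Data.size_left_le (x : Data) : x.left.size ≤ x.size := by
  cases x <;> simp [Data.size, Data.left]; omega

theorem Data.size_right_le (x : Data) : x.right.size ≤ x.size := by
  cases x <;> simp [Data.size, Data.right]; omega

@[simp] theorem Data.size_ofNat (n : ℕ) : (Data.ofNat n).size = 2 * n + 1 := by
  induction n with
  | zero => rfl
  | succ n ih => simp only [Data.ofNat, Data.size, ih]; omega

theorem Data.size_ofList_append (l l' : List Data) :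
    (Data.ofList (l ++ l')).size + 1 = (Data.ofList l).size + (Data.ofList l').size := by
  induction l with
  | nil => simp [Data.ofList, Data.size]; omega
  | cons a l ih => simp only [List.cons_append, Data.ofList, Data.size]; omega

theorem Data.length_le_size (l : List Data) : l.length ≤ (Data.ofList l).size := by
  induction l with
  | nil => simp
  | cons a l ih => simp only [Data.ofList, Data.size, List.length_cons]; omega

/-- Every rule charges at least for the data it returns. This is what lets polynomial time compose:
the second program runs on an input of polynomial size. -/
theorem Runs.size_le {p : Prog} {x y : Data} {s : ℕ} (h : Runs p x y s) : y.size ≤ s := by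
  induction h with
  | id x => omega
  | leaf x => simp [Data.size]
  | left x => have := x.size_left_le; omega
  | right x => have := x.size_right_le; omega
  | pair hf hg ihf ihg => simp only [Data.size]; omega
  | comp => omega
  | ite_node => omega
  | ite_leaf => omega
  | loop_leaf => omega
  | loop_node => omega

theorem eval_le_eval (q : Polynomial ℕ) {a b : ℕ} (h : a ≤ b) : q.eval a ≤ q.eval b := by
  rw [Polynomial.eval_eq_sum_range, Polynomial.eval_eq_sum_range]
  exact Finset.sum_le_sum fun i _ => Nat.mul_le_mul_left _ (Nat.pow_le_pow_left h i)

/-- `f a` is computed from `enc a` by one program in time polynomial in the size of `enc a`. -/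
def PolyTime {α : Type*} (enc : α → Data) (f : α → Data) : Prop :=
  ∃ (p : Prog) (q : Polynomial ℕ), ∀ a, ∃ s, s ≤ q.eval (enc a).size ∧ Runs p (enc a) (f a) s

/-- The natural number `N a` is bounded by a polynomial in the size of `enc a`. -/
def PolyBounded {α : Type*} (enc : α → Data) (N : α → ℕ) : Prop :=
  ∃ B : Polynomial ℕ, ∀ a, N a ≤ B.eval (enc a).size

section PolyBounded

variable {α : Type*} {enc : α → Data} {M N : α → ℕ}

theorem PolyBounded.mono (h : PolyBounded enc N) (hM : ∀ a, M a ≤ N a) : PolyBounded enc M := by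
  obtain ⟨B, hB⟩ := h
  exact ⟨B, fun a => (hM a).trans (hB a)⟩

theorem PolyBounded.const (c : ℕ) : PolyBounded enc fun _ => c :=
  ⟨Polynomial.C c, fun _ => by simp⟩

theorem PolyBounded.size : PolyBounded enc fun a => (enc a).size :=
  ⟨Polynomial.X, fun a => by simp⟩

theorem PolyBounded.add (h : PolyBounded enc M) (h' : PolyBounded enc N) :
    PolyBounded enc fun a => M a + N a := by
  obtain ⟨B, hB⟩ := h
  obtain ⟨C, hC⟩ := h'
  exact ⟨B + C, fun a => by simpa using add_le_add (hB a) (hC a)⟩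

theorem PolyBounded.mul (h : PolyBounded enc M) (h' : PolyBounded enc N) :
    PolyBounded enc fun a => M a * N a := by
  obtain ⟨B, hB⟩ := h
  obtain ⟨C, hC⟩ := h'
  exact ⟨B * C, fun a => by simpa using Nat.mul_le_mul (hB a) (hC a)⟩

theorem PolyBounded.eval (q : Polynomial ℕ) (h : PolyBounded enc M) :
    PolyBounded enc fun a => q.eval (M a) := by
  obtain ⟨B, hB⟩ := h
  exact ⟨q.comp B, fun a => by simpa using eval_le_eval q (hB a)⟩

end PolyBounded

namespace PolyTime

variable {α β : Type*} {enc : α → Data} {encβ : β → Data} {f g : α → Data}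

theorem size (h : PolyTime enc f) : PolyBounded enc fun a => (f a).size := by
  obtain ⟨p, q, h⟩ := h
  refine ⟨q, fun a => ?_⟩
  obtain ⟨s, hs, hr⟩ := h a
  exact hr.size_le.trans hs

theorem of_bound {p : Prog} {N : α → ℕ} (hN : PolyBounded enc N)
    (h : ∀ a, ∃ s, s ≤ N a ∧ Runs p (enc a) (f a) s) : PolyTime enc f := by
  obtain ⟨B, hB⟩ := hN
  refine ⟨p, B, fun a => ?_⟩
  obtain ⟨s, hs, hr⟩ := h a
  exact ⟨s, hs.trans (hB a), hr⟩

theorem exists_time (h : PolyTime enc f) : ∃ (p : Prog) (N : α → ℕ), PolyBounded enc N ∧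
    ∀ a, ∃ s, s ≤ N a ∧ Runs p (enc a) (f a) s := by
  obtain ⟨p, q, h⟩ := h
  exact ⟨p, _, PolyBounded.eval q PolyBounded.size, h⟩

theorem id : PolyTime enc enc :=
  of_bound (PolyBounded.size.add (PolyBounded.const 1)) fun _ => ⟨_, le_rfl, Runs.id _⟩

theorem leaf : PolyTime enc fun _ => Data.leaf :=
  of_bound (PolyBounded.const 1) fun _ => ⟨_, le_rfl, Runs.leaf _⟩

/-- The intermediate value may carry any encoding `encβ`. With the identity encoding this is
composition with a function on trees. -/
theorem comp {F : β → Data} (hF : PolyTime encβ F) {h : α → β}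
    (hh : PolyTime enc fun a => encβ (h a)) : PolyTime enc fun a => F (h a) := by
  obtain ⟨p, q, hp⟩ := hF
  obtain ⟨p', N, hN, hp'⟩ := hh.exists_time
  refine of_bound (p := Prog.comp p p')
    ((hN.add (PolyBounded.eval q hh.size)).add (PolyBounded.const 1)) fun a => ?_
  obtain ⟨s, hs, hr⟩ := hp (h a)
  obtain ⟨s', hs', hr'⟩ := hp' a
  exact ⟨_, by omega, Runs.comp hr' hr⟩

theorem pair (hf : PolyTime enc f) (hg : PolyTime enc g) :
    PolyTime enc fun a => Data.node (f a) (g a) := by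
  obtain ⟨p, M, hM, hp⟩ := hf.exists_time
  obtain ⟨p', N, hN, hp'⟩ := hg.exists_time
  refine of_bound (p := Prog.pair p p')
    (((PolyBounded.size.add hM).add hN).add (PolyBounded.const 1)) fun a => ?_
  obtain ⟨s, hs, hr⟩ := hp a
  obtain ⟨s', hs', hr'⟩ := hp' a
  exact ⟨_, by omega, Runs.pair hr hr'⟩

theorem left (hf : PolyTime enc f) : PolyTime enc fun a => (f a).left :=
  comp (encβ := _root_.id) (F := Data.left) (of_bound (p := Prog.left)
    (PolyBounded.size.add (PolyBounded.const 1)) fun _ => ⟨_, le_rfl, Runs.left _⟩) hf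

theorem right (hf : PolyTime enc f) : PolyTime enc fun a => (f a).right :=
  comp (encβ := _root_.id) (F := Data.right) (of_bound (p := Prog.right)
    (PolyBounded.size.add (PolyBounded.const 1)) fun _ => ⟨_, le_rfl, Runs.right _⟩) hf

theorem const (d : Data) : PolyTime enc fun _ => d := by
  induction d with
  | leaf => exact leaf
  | node a b iha ihb => exact pair iha ihb

theorem cond {c : α → Data} (hc : PolyTime enc c) (hf : PolyTime enc f) (hg : PolyTime enc g) :
    PolyTime enc fun a => (c a).cond (f a) (g a) := by
  obtain ⟨p, M, hM, hp⟩ := hf.exists_time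
  obtain ⟨p', N, hN, hp'⟩ := hg.exists_time
  obtain ⟨pc, C, hC, hpc⟩ := hc.exists_time
  refine of_bound (p := Prog.ite pc p p')
    ((((PolyBounded.size.add hM).add hN).add hC).add (PolyBounded.const 1)) fun a => ?_
  obtain ⟨s, hs, hr⟩ := hp a
  obtain ⟨s', hs', hr'⟩ := hp' a
  obtain ⟨sc, hsc, hrc⟩ := hpc a
  cases h : c a with
  | leaf =>
    rw [h] at hrc
    exact ⟨_, by omega, Runs.ite_leaf hrc hr'⟩
  | node u v =>
    rw [h] at hrc
    exact ⟨_, by omega, Runs.ite_node hrc hr⟩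

theorem congr (h : PolyTime enc f) (hfg : ∀ a, f a = g a) : PolyTime enc g := by
  rwa [show g = f from funext fun a => (hfg a).symm]

/-- The left component of the state serves as the loop test. The step need only be computed on the
states that occur before the last one, hence the subtype. The bound on all intermediate sizes cannot
be dropped, since iterating a polynomial-time step may otherwise blow up exponentially. -/
theorem loop {st : α → ℕ → Data} {N : α → ℕ} (h0 : PolyTime enc fun a => st a 0)
    (hstep : PolyTime (fun p : {p : α × ℕ // p.2 < N p.1} => st p.1.1 p.1.2)
      fun p => st p.1.1 (p.1.2 + 1))
    (hnode : ∀ a i, i < N a → ∃ u v, (st a i).left = Data.node u v)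
    (hleaf : ∀ a, (st a (N a)).left = Data.leaf)
    (hsize : ∃ B : α → ℕ, PolyBounded enc B ∧ ∀ a i, i ≤ N a → (st a i).size ≤ B a)
    (hN : PolyBounded enc N) : PolyTime enc fun a => st a (N a) := by
  obtain ⟨p0, M0, hM0, hp0⟩ := h0.exists_time
  obtain ⟨pb, q, hpb⟩ := hstep
  obtain ⟨B, hB, hsize⟩ := hsize
  -- Induction on the number `j` of iterations still to be done, because `Runs.loop_node` adds an
  -- iteration at the front.
  have key : ∀ a j, j ≤ N a → ∃ s, s ≤ (j + 1) * (B a + (B a + 1) + q.eval (B a) + 1) ∧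
      Runs (Prog.loop Prog.left pb) (st a (N a - j)) (st a (N a)) s := by
    intro a j
    induction j with
    | zero =>
      intro _
      have h1 := Runs.left (st a (N a))
      rw [hleaf] at h1
      have := hsize a (N a) le_rfl
      exact ⟨_, by simp only [zero_add, one_mul, Nat.sub_zero]; omega, Runs.loop_leaf (b := pb) h1⟩
    | succ j ih =>
      intro hj
      obtain ⟨s, hs, hr⟩ := ih (by omega)
      obtain ⟨u, v, huv⟩ := hnode a (N a - (j + 1)) (by omega)
      have h1 := Runs.left (st a (N a - (j + 1)))
      rw [huv] at h1
      obtain ⟨s', hs', hr'⟩ := hpb ⟨(a, N a - (j + 1)), by simp only; omega⟩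
      have e : N a - (j + 1) + 1 = N a - j := by omega
      simp only [e] at hr'
      have hz := hsize a (N a - (j + 1)) (by omega)
      have hq := hs'.trans (eval_le_eval q hz)
      refine ⟨_, ?_, Runs.loop_node h1 hr' hr⟩
      rw [Nat.add_mul (j + 1) 1, one_mul]
      omega
  refine of_bound (p := Prog.comp (Prog.loop Prog.left pb) p0)
    ((hM0.add ((hN.add (PolyBounded.const 1)).mul
      (((hB.add (hB.add (PolyBounded.const 1))).add (PolyBounded.eval q hB)).add
        (PolyBounded.const 1)))).add (PolyBounded.const 1)) fun a => ?_
  obtain ⟨s, hs, hr⟩ := key a (N a) le_rfl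
  rw [Nat.sub_self] at hr
  obtain ⟨s', hs', hr'⟩ := hp0 a
  exact ⟨_, by omega, Runs.comp hr' hr⟩

/-- The loop state is the unread part of the list together with the accumulator. A nonempty list is
encoded by a node, so the unread part is itself the loop test. -/
theorem foldl {l : α → List Data} {step : Data → Data} {init : α → Data}
    (hl : PolyTime enc fun a => Data.ofList (l a)) (hi : PolyTime enc init)
    (hstep : PolyTime _root_.id step)
    (hsize : ∃ B : α → ℕ, PolyBounded enc B ∧ ∀ a i,
      (((l a).take i).foldl (fun acc d => step (Data.node d acc)) (init a)).size ≤ B a) :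
    PolyTime enc fun a => (l a).foldl (fun acc d => step (Data.node d acc)) (init a) := by
  obtain ⟨B, hB, hsize⟩ := hsize
  have hdrop : ∀ (l : List Data) i, (Data.ofList (l.drop i)).size ≤ (Data.ofList l).size := by
    intro l i
    conv_rhs => rw [← List.take_append_drop i l]
    have h1 := Data.size_ofList_append (l.take i) (l.drop i)
    have h2 := (Data.ofList (l.take i)).size_pos
    omega
  have := loop (enc := enc) (N := fun a => (l a).length)
    (st := fun a i => Data.node (Data.ofList ((l a).drop i))
      (((l a).take i).foldl (fun acc d => step (Data.node d acc)) (init a)))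
    (by simpa using hl.pair hi) ?_ ?_ ?_ ?_ ?_
  · simpa [Data.right] using this.right
  · have hgen : ∀ {γ : Type _} {e : γ → Data}, PolyTime e fun p => Data.node (e p).left.right
        (step (Data.node (e p).left.left (e p).right)) := fun {γ e} =>
      id.left.right.pair (comp (encβ := _root_.id) hstep (id.left.left.pair id.right))
    refine hgen.congr fun p => ?_
    obtain ⟨⟨a, i⟩, hi⟩ := p
    simp only [Data.left, Data.right]
    simp only at hi
    rw [List.drop_eq_getElem_cons hi, ← List.take_concat_get' _ _ hi, List.foldl_append]
    simp only [Data.ofList, List.foldl_cons, List.foldl_nil]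
  · intro a i hi
    simp only [Data.left]
    rw [List.drop_eq_getElem_cons hi]
    exact ⟨_, _, rfl⟩
  · intro a
    simp [Data.left, Data.ofList]
  · refine ⟨_, (hl.size.add hB).add (PolyBounded.const 1), fun a i _ => ?_⟩
    have := hdrop (l a) i
    have := hsize a i
    simp only [Data.size]
    omega
  · exact hl.size.mono fun a => Data.length_le_size _

/-- `node d acc` already encodes the accumulator with `d` in front, so folding with the identity
step reverses a list onto another one. Two such reversals give `append`. -/
theorem revAppend {l l' : α → List Data} (hl : PolyTime enc fun a => Data.ofList (l a))
    (hl' : PolyTime enc fun a => Data.ofList (l' a)) :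
    PolyTime enc fun a => Data.ofList ((l a).reverse ++ l' a) := by
  have key : ∀ k k' : List Data,
      k.foldl (fun acc d => _root_.id (Data.node d acc)) (Data.ofList k') =
        Data.ofList (k.reverse ++ k') := by
    intro k
    induction k with
    | nil => intro k'; rfl
    | cons a k ih => intro k'; simpa [Data.ofList] using ih (a :: k')
  have := foldl (step := _root_.id) hl hl' id
    ⟨_, hl.size.add hl'.size, fun a i => ?_⟩
  · exact this.congr fun a => key _ _
  · rw [key]
    have h1 := Data.size_ofList_append ((l a).take i).reverse (l' a)
    have h2 : ∀ k : List Data, (Data.ofList k.reverse).size = (Data.ofList k).size := by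
      intro k
      induction k with
      | nil => rfl
      | cons b k ih =>
        have := Data.size_ofList_append k.reverse [b]
        simp only [List.reverse_cons]
        simp only [Data.ofList, Data.size] at this ⊢
        omega
    have h3 := Data.size_ofList_append ((l a).take i) ((l a).drop i)
    have h4 := (Data.ofList ((l a).drop i)).size_pos
    rw [List.take_append_drop] at h3
    rw [h2] at h1
    omega

theorem append {l l' : α → List Data} (hl : PolyTime enc fun a => Data.ofList (l a))
    (hl' : PolyTime enc fun a => Data.ofList (l' a)) :
    PolyTime enc fun a => Data.ofList (l a ++ l' a) := by
  have h1 := revAppend (l' := fun _ => []) hl leaf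
  have h2 := revAppend h1 hl'
  simpa using h2

theorem nil : PolyTime enc fun _ => Data.ofList [] := leaf

theorem cons {d : α → Data} {l : α → List Data} (hd : PolyTime enc d)
    (hl : PolyTime enc fun a => Data.ofList (l a)) :
    PolyTime enc fun a => Data.ofList (d a :: l a) := hd.pair hl

/-- The encoding of an instance together with a counter. -/
def encIdx (enc : α → Data) (p : α × ℕ) : Data := Data.node (enc p.1) (Data.ofNat p.2)

theorem weaken (hf : PolyTime enc f) : PolyTime (encIdx enc) fun p => f p.1 :=
  comp (h := Prod.fst) hf (id (enc := encIdx enc)).left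

theorem idx : PolyTime (encIdx enc) fun p => Data.ofNat p.2 := (id (enc := encIdx enc)).right

theorem ofNat_succ {N : α → ℕ} (hN : PolyTime enc fun a => Data.ofNat (N a)) :
    PolyTime enc fun a => Data.ofNat (N a + 1) := leaf.pair hN

theorem ofNat_bounded {N : α → ℕ} (hN : PolyTime enc fun a => Data.ofNat (N a)) :
    PolyBounded enc N := hN.size.mono fun a => by rw [Data.size_ofNat]; omega

/-- The unary counter runs downwards and each new piece is put in front, so after `i` rounds the
accumulator holds the pieces of the last `i` indices in the right order. The instance is carried
along because `L` reads it in every round. -/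
theorem flatMap {N : α → ℕ} {L : α → ℕ → List Data}
    (hN : PolyTime enc fun a => Data.ofNat (N a))
    (hL : PolyTime (encIdx enc) fun p => Data.ofList (L p.1 p.2)) :
    PolyTime enc fun a => Data.ofList ((List.range (N a)).flatMap (L a)) := by
  have hrange : ∀ N i : ℕ, i < N →
      List.range' (N - (i + 1)) (i + 1) = (N - (i + 1)) :: List.range' (N - i) i := by
    intro N i hi
    rw [List.range'_succ]
    congr 2
    omega
  obtain ⟨q, hq⟩ := hL.size
  have hidx : PolyBounded enc fun a => (enc a).size + (2 * N a + 1) + 1 :=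
    ((PolyBounded.size.add (((PolyBounded.const 2).mul hN.ofNat_bounded).add
      (PolyBounded.const 1))).add (PolyBounded.const 1))
  have hsz : ∀ a i, i ≤ N a → (Data.ofList ((List.range' (N a - i) i).flatMap (L a))).size ≤
      i * q.eval ((enc a).size + (2 * N a + 1) + 1) + 1 := by
    intro a i
    induction i with
    | zero => intro _; simp [Data.ofList, Data.size]
    | succ i ih =>
      intro hi
      rw [hrange _ _ hi, List.flatMap_cons, Nat.add_mul, one_mul]
      have h1 := Data.size_ofList_append (L a (N a - (i + 1)))
        ((List.range' (N a - i) i).flatMap (L a))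
      have h2 := ih (by omega)
      have h3 := hq (a, N a - (i + 1))
      have h4 := eval_le_eval q (show (encIdx enc (a, N a - (i + 1))).size ≤
        (enc a).size + (2 * N a + 1) + 1 by simp [encIdx, Data.size])
      simp only at h3
      omega
  have := loop (enc := enc) (N := N)
    (st := fun a i => Data.node (Data.ofNat (N a - i)) (Data.node (enc a)
      (Data.ofList ((List.range' (N a - i) i).flatMap (L a)))))
    (by simpa [Data.ofList] using hN.pair (id.pair leaf)) ?_ ?_ ?_ ?_ hN.ofNat_bounded
  · simpa [Data.right, List.range_eq_range'] using this.right.right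
  · have hst := id (enc := fun p : {p : α × ℕ // p.2 < N p.1} =>
      Data.node (Data.ofNat (N p.1.1 - p.1.2)) (Data.node (enc p.1.1)
      (Data.ofList ((List.range' (N p.1.1 - p.1.2) p.1.2).flatMap (L p.1.1)))))
    have hcnt : ∀ N i : ℕ, i < N → Data.ofNat (N - i) = Data.node Data.leaf
        (Data.ofNat (N - (i + 1))) := by
      intro N i hi
      rw [show N - i = (N - (i + 1)) + 1 by omega]
      rfl
    have hnew := comp (h := fun p : {p : α × ℕ // p.2 < N p.1} => (p.1.1, N p.1.1 - (p.1.2 + 1))) hL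
      (enc := fun p : {p : α × ℕ // p.2 < N p.1} =>
      Data.node (Data.ofNat (N p.1.1 - p.1.2)) (Data.node (enc p.1.1)
      (Data.ofList ((List.range' (N p.1.1 - p.1.2) p.1.2).flatMap (L p.1.1)))))
      ((hst.right.left.pair hst.left.right).congr fun p => by
        simp [encIdx, Data.left, Data.right, hcnt _ _ p.2])
    refine (hst.left.right.pair (hst.right.left.pair
      (append hnew (hst.right.right)))).congr fun p => ?_
    simp only [Data.left, Data.right, hcnt _ _ p.2, hrange _ _ p.2, List.flatMap_cons]
  · intro a i hi
    rw [show N a - i = (N a - (i + 1)) + 1 by omega]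
    exact ⟨_, _, rfl⟩
  · intro a
    simp [Data.left, Data.ofNat]
  · refine ⟨_, ((((PolyBounded.const 2).mul hN.ofNat_bounded).add (PolyBounded.size)).add
      (hN.ofNat_bounded.mul (PolyBounded.eval q hidx))).add (PolyBounded.const 4),
      fun a i hi => ?_⟩
    have h1 := hsz a i hi
    have h2 := Nat.mul_le_mul_right (q.eval ((enc a).size + (2 * N a + 1) + 1)) hi
    simp only [Data.size, Data.size_ofNat]
    omega

theorem map {N : α → ℕ} {L : α → ℕ → Data}
    (hN : PolyTime enc fun a => Data.ofNat (N a))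
    (hL : PolyTime (encIdx enc) fun p => L p.1 p.2) :
    PolyTime enc fun a => Data.ofList ((List.range (N a)).map (L a)) := by
  have := flatMap (L := fun a i => [L a i]) hN (hL.pair leaf)
  refine this.congr fun a => ?_
  simp [List.map_eq_flatMap]

end PolyTime

/-- Unary arithmetic becomes list processing: sums are `append`, products `flatMap`, and truncated
differences a fold that removes one leaf per entry. -/
theorem Data.ofNat_eq_ofList (n : ℕ) : Data.ofNat n = Data.ofList (List.replicate n Data.leaf) := by
  induction n with
  | zero => rfl
  | succ n ih => simp [Data.ofNat, ih, List.replicate_succ, Data.ofList]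

namespace PolyTime

variable {α : Type*} {enc : α → Data} {M N : α → ℕ}

theorem add (hM : PolyTime enc fun a => Data.ofNat (M a))
    (hN : PolyTime enc fun a => Data.ofNat (N a)) :
    PolyTime enc fun a => Data.ofNat (M a + N a) := by
  simp only [Data.ofNat_eq_ofList] at *
  simpa only [List.replicate_append_replicate] using append hM hN

theorem mul (hM : PolyTime enc fun a => Data.ofNat (M a))
    (hN : PolyTime enc fun a => Data.ofNat (N a)) :
    PolyTime enc fun a => Data.ofNat (M a * N a) := by
  have hN' := hN.weaken
  simp only [Data.ofNat_eq_ofList (N _)] at hN'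
  refine (flatMap (L := fun a _ => List.replicate (N a) Data.leaf) hM hN').congr fun a => ?_
  rw [Data.ofNat_eq_ofList]
  congr 1
  simp [List.eq_replicate_iff, List.length_flatMap]

theorem sub (hM : PolyTime enc fun a => Data.ofNat (M a))
    (hN : PolyTime enc fun a => Data.ofNat (N a)) :
    PolyTime enc fun a => Data.ofNat (M a - N a) := by
  have key : ∀ (l : List Data) k, l.foldl (fun acc d => (Data.node d acc).right.right)
      (Data.ofNat k) = Data.ofNat (k - l.length) := by
    intro l
    induction l with
    | nil => intro k; rfl
    | cons a l ih =>
      intro k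
      cases k with
      | zero => simpa [Data.ofNat, Data.right] using ih 0
      | succ k => simpa [Data.ofNat, Data.right] using ih k
  simp only [Data.ofNat_eq_ofList (N _)] at hN
  refine (foldl (step := fun d => d.right.right) hN hM id.right.right
    ⟨_, hM.size, fun a i => ?_⟩).congr fun a => ?_
  · rw [key]
    simp only [Data.size_ofNat]
    omega
  · rw [key, List.length_replicate]

theorem ofNat_const (c : ℕ) : PolyTime enc fun _ => Data.ofNat c := const _

end PolyTime

/-- The two notions measure time in `n` and in the size `2 * n + 1` of its unary encoding
respectively. -/
theorem polyTimeGenerated_iff {f : ℕ → Data} :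
    PolyTimeGenerated f ↔ PolyTime Data.ofNat f := by
  constructor
  · rintro ⟨p, q, h⟩
    refine ⟨p, q, fun n => ?_⟩
    obtain ⟨s, hs, hr⟩ := h n
    exact ⟨s, hs.trans (eval_le_eval q (by rw [Data.size_ofNat]; omega)), hr⟩
  · rintro ⟨p, q, h⟩
    refine ⟨p, q.comp (Polynomial.C 2 * Polynomial.X + Polynomial.C 1), fun n => ?_⟩
    obtain ⟨s, hs, hr⟩ := h n
    exact ⟨s, by simpa using hs, hr⟩

/-! ### Registers -/

/-- Bit `j` of a register; bits beyond the register are `false`. -/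
def bit {w : ℕ} (x : Reg w) (j : ℕ) : Bool := if h : j < w then x ⟨j, h⟩ else false

theorem bit_of_lt {w : ℕ} (x : Reg w) {j : ℕ} (h : j < w) : bit x j = x ⟨j, h⟩ := dif_pos h

theorem bit_of_le {w : ℕ} (x : Reg w) {j : ℕ} (h : w ≤ j) : bit x j = false :=
  dif_neg (by omega)

@[simp] theorem bit_fin {w : ℕ} (x : Reg w) (j : Fin w) : bit x j = x j := bit_of_lt x j.2

/-- Identities between registers of different lengths are reduced to bits indexed by natural
numbers, where only linear arithmetic of positions remains. -/
theorem bit_ext {w : ℕ} {x y : Reg w} (h : ∀ j < w, bit x j = bit y j) : x = y := by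
  funext j
  simpa using h j j.2

/-- The `c` bits of a register starting at bit `a`. -/
def blk {w : ℕ} (x : Reg w) (a c : ℕ) : Reg c := fun i => bit x (a + i)

theorem bit_blk {w : ℕ} (x : Reg w) (a c j : ℕ) :
    bit (blk x a c) j = if j < c then bit x (a + j) else false := by
  by_cases h : j < c
  · rw [bit_of_lt _ h, if_pos h, blk]
  · rw [bit_of_le _ (not_lt.mp h), if_neg h]

/-- The register with bits `a` followed by bits `e`. -/
def glue {o r : ℕ} (w : ℕ) (a : Reg o) (e : Reg r) : Reg w := fun j =>
  if (j : ℕ) < o then bit a j else bit e (j - o)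

theorem bit_glue {o r w : ℕ} (a : Reg o) (e : Reg r) (j : ℕ) :
    bit (glue w a e) j = if j < w then (if j < o then bit a j else bit e (j - o)) else false := by
  by_cases h : j < w
  · rw [bit_of_lt _ h, if_pos h, glue]
  · rw [bit_of_le _ (not_lt.mp h), if_neg h]

/-- A register splits into its first `o` bits and the others. -/
def splitReg {o r w : ℕ} (h : o + r = w) : Reg o × Reg r ≃ Reg w where
  toFun p := glue w p.1 p.2
  invFun x := (blk x 0 o, blk x o r)
  left_inv p := by
    refine Prod.ext (bit_ext fun j hj => ?_) (bit_ext fun j hj => ?_)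
    · simp [bit_blk, bit_glue, hj, show j < w by omega]
    · simp [bit_blk, bit_glue, hj, show o + j < w by omega]
  right_inv x := bit_ext fun j hj => by
    simp only [bit_blk, bit_glue, hj, if_true]
    split_ifs with h1
    · simp
    · rw [show o + (j - o) = j by omega]
    · omega

theorem sum_splitReg {M : Type*} [AddCommMonoid M] {o r w : ℕ} (h : o + r = w) (f : Reg w → M) :
    ∑ x, f x = ∑ a : Reg o, ∑ e : Reg r, f (glue w a e) := by
  rw [← (splitReg h).sum_comp, Fintype.sum_prod_type]
  rfl

theorem blk_glue_fst {o r w : ℕ} (h : o + r = w) (a : Reg o) (e : Reg r) :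
    blk (glue w a e) 0 o = a := congrArg Prod.fst ((splitReg h).left_inv (a, e))

theorem blk_glue_snd {o r w : ℕ} (h : o + r = w) (a : Reg o) (e : Reg r) :
    blk (glue w a e) o r = e := congrArg Prod.snd ((splitReg h).left_inv (a, e))

theorem sum_blk {M : Type*} [AddCommMonoid M] {o r w : ℕ} (h : o + r = w)
    (f : Reg o → Reg r → M) :
    ∑ x : Reg w, f (blk x 0 o) (blk x o r) = ∑ a, ∑ e, f a e := by
  rw [sum_splitReg h]
  simp only [blk_glue_fst h, blk_glue_snd h]

theorem comp_castLE {i w : ℕ} (h : i ≤ w) (x : Reg w) : x ∘ Fin.castLE h = blk x 0 i := by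
  funext j
  simp [blk, bit_of_lt x (show (j : ℕ) < w by omega), Fin.castLE]

theorem tensor_apply {a b : ℕ} (A : Op a) (B : Op b) (x y : Reg (a + b)) :
    tensor A B x y = A (blk x 0 a) (blk y 0 a) * B (blk x a b) (blk y a b) := by
  have h1 : ∀ x : Reg (a + b), x ∘ Fin.castAdd b = blk x 0 a := fun x => comp_castLE (by omega) x
  have h2 : ∀ x : Reg (a + b), x ∘ Fin.natAdd a = blk x a b := fun x => by
    funext j
    simp [blk, bit_of_lt x (show a + (j : ℕ) < a + b by omega), Fin.natAdd]
  simp only [tensor, Matrix.of_apply, h1, h2]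

theorem padZero_apply {i w : ℕ} (h : i ≤ w) (ρ : Op i) (x y : Reg w) :
    padZero h ρ x y = if ∀ j < w, i ≤ j → bit x j = false ∧ bit y j = false then
      ρ (blk x 0 i) (blk y 0 i) else 0 := by
  simp only [padZero, Matrix.of_apply, comp_castLE]
  refine if_congr ⟨fun H j hw hj => ?_,
    fun H j hj => by simpa using H j j.2 hj⟩ rfl rfl
  simpa [bit_of_lt _ hw] using H ⟨j, hw⟩ hj

/-- The conditions in the double sum force row and column to start with `a` and `b` and to share one
environment `e`. -/
theorem keepFirst_apply {o w : ℕ} (h : o ≤ w) (σ : Op w) (a b : Reg o) :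
    keepFirst h σ a b = ∑ e : Reg (w - o), σ (glue w a e) (glue w b e) := by
  simp only [keepFirst, Matrix.of_apply, comp_castLE]
  have h' : o + (w - o) = w := by omega
  rw [sum_splitReg h', Finset.sum_eq_single a]
  · refine Finset.sum_congr rfl fun e _ => ?_
    rw [Finset.sum_eq_single (glue w b e)]
    · rw [if_pos]
      refine ⟨blk_glue_fst h' _ _, blk_glue_fst h' _ _, fun j hj => ?_⟩
      simp [glue, show ¬ (j : ℕ) < o by omega]
    · intro y _ hy
      rw [if_neg]
      rintro ⟨-, h2, h3⟩
      refine hy (bit_ext fun j hj => ?_)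
      rw [bit_glue, if_pos hj]
      split_ifs with hjo
      · rw [← h2, bit_blk, if_pos hjo, zero_add]
      · rw [bit_of_lt y hj, ← h3 ⟨j, hj⟩ (by simpa using hjo), glue, if_neg hjo]
    · simp
  · intro c _ hc
    refine Finset.sum_eq_zero fun e _ => Finset.sum_eq_zero fun y _ => if_neg ?_
    rintro ⟨h1, -⟩
    exact hc (by rwa [blk_glue_fst h'] at h1)
  · simp

/-! ### Operators on some of the wires -/

section OnWires

variable {a w : ℕ} (q : Fin a ↪ Fin w)

theorem extend_comp (u : Reg a) (x : Reg w) : Function.extend q u x ∘ q = u :=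
  Function.extend_comp q.injective u x

theorem extend_off (u : Reg a) (x : Reg w) {j : Fin w} (hj : j ∉ Set.range q) :
    Function.extend q u x j = x j := Function.extend_apply' _ _ _ hj

theorem extend_self_of_off {x y : Reg w} (h : ∀ j : Fin w, j ∉ Set.range q → x j = y j) :
    Function.extend q (y ∘ q) x = y := by
  funext j
  by_cases hj : j ∈ Set.range q
  · obtain ⟨i, rfl⟩ := hj
    rw [q.injective.extend_apply]
    rfl
  · rw [extend_off q _ _ hj, h j hj]

/-- In row `x` only the columns that agree with `x` off the chosen wires survive, and these are
parametrized by the values `u` on the wires. -/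
theorem sum_onWires (A : Op a) (f : Reg w → ℂ) (x : Reg w) :
    ∑ y, onWires q A x y * f y = ∑ u, A (x ∘ q) u * f (Function.extend q u x) := by
  simp only [onWires, Matrix.of_apply, ite_mul, zero_mul]
  rw [← Finset.sum_filter]
  symm
  refine Finset.sum_bij (fun u _ => Function.extend q u x) ?_ ?_ ?_ ?_
  · intro u _
    simp only [Finset.mem_filter, Finset.mem_univ, true_and]
    exact fun j hj => (extend_off q u x hj).symm
  · intro u _ v _ h
    rw [← extend_comp q u x, h, extend_comp]
  · intro y hy
    simp only [Finset.mem_filter, Finset.mem_univ, true_and] at hy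
    exact ⟨y ∘ q, Finset.mem_univ _, extend_self_of_off q hy⟩
  · intro u _
    rw [extend_comp]

theorem onWires_mul (A B : Op a) : onWires q A * onWires q B = onWires q (A * B) := by
  ext x y
  rw [Matrix.mul_apply, sum_onWires]
  simp only [onWires, Matrix.of_apply, extend_comp]
  by_cases h : ∀ j : Fin w, j ∉ Set.range q → x j = y j
  · rw [if_pos h, Matrix.mul_apply]
    refine Finset.sum_congr rfl fun u _ => ?_
    rw [if_pos fun j hj => (extend_off q u x hj).trans (h j hj)]
  · rw [if_neg h]
    refine Finset.sum_eq_zero fun u _ => ?_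
    rw [if_neg fun H => h fun j hj => (extend_off q u x hj).symm.trans (H j hj), mul_zero]

theorem onWires_one : onWires q (1 : Op a) = 1 := by
  ext x y
  simp only [onWires, Matrix.of_apply, Matrix.one_apply]
  by_cases hxy : x = y
  · subst hxy; simp
  · rw [if_neg hxy]
    split_ifs with h1 h2
    · refine absurd ?_ hxy
      rw [← extend_self_of_off q h1, ← h2]
      exact (extend_self_of_off q fun _ _ => rfl).symm
    · rfl
    · rfl

theorem onWires_conjTranspose (A : Op a) : (onWires q A)ᴴ = onWires q Aᴴ := by
  ext x y
  simp only [onWires, Matrix.of_apply, Matrix.conjTranspose_apply]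
  simp only [eq_comm (a := y _)]
  split_ifs <;> simp

theorem onWires_unitary {A : Op a} (hA : A ∈ Matrix.unitaryGroup (Reg a) ℂ) :
    onWires q A ∈ Matrix.unitaryGroup (Reg w) ℂ := by
  rw [Matrix.mem_unitaryGroup_iff] at *
  rw [Matrix.star_eq_conjTranspose] at *
  rw [onWires_conjTranspose, onWires_mul, hA, onWires_one]

theorem onWires_trans {v : ℕ} (ι : Fin w ↪ Fin v) (A : Op a) :
    onWires (q.trans ι) A = onWires ι (onWires q A) := by
  ext x y
  simp only [onWires, Matrix.of_apply]
  have : (∀ j : Fin v, j ∉ Set.range (q.trans ι) → x j = y j) ↔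
      (∀ j : Fin v, j ∉ Set.range ι → x j = y j) ∧
      (∀ j : Fin w, j ∉ Set.range q → (x ∘ ι) j = (y ∘ ι) j) := by
    constructor
    · refine fun h => ⟨fun j hj => h j ?_, fun j hj => h (ι j) ?_⟩
      · rintro ⟨i, rfl⟩; exact hj ⟨q i, rfl⟩
      · rintro ⟨i, hi⟩; exact hj ⟨i, ι.injective hi⟩
    · rintro ⟨h1, h2⟩ j hj
      by_cases hr : j ∈ Set.range ι
      · obtain ⟨i, rfl⟩ := hr
        refine h2 i ?_
        rintro ⟨i', rfl⟩
        exact hj ⟨i', rfl⟩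
      · exact h1 j hr
  rw [if_congr this rfl rfl, ite_and]
  rfl

/-- Conjugation by an operator on some of the wires acts on the slices of a state that are obtained
by fixing all other wires. -/
theorem onWires_conj_apply (A : Op a) (σ : Op w) (x y : Reg w) :
    (onWires q A * σ * (onWires q A)ᴴ) x y =
      (A * Matrix.of (fun u v => σ (Function.extend q u x) (Function.extend q v y)) * Aᴴ)
        (x ∘ q) (y ∘ q) := by
  rw [Matrix.mul_apply, Matrix.mul_apply]
  have h1 : ∀ z, (onWires q A * σ) x z = ∑ u, A (x ∘ q) u * σ (Function.extend q u x) z := by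
    intro z
    rw [Matrix.mul_apply, sum_onWires]
  have h2 : ∀ g : Reg w → ℂ, ∑ z, g z * (onWires q A)ᴴ z y =
      ∑ v, g (Function.extend q v y) * Aᴴ v (y ∘ q) := by
    intro g
    -- Summing against the adjoint on the right is the complex conjugate of the row formula.
    have := congrArg star (sum_onWires q A (fun z => star (g z)) y)
    simp only [star_sum, star_mul, star_star] at this
    simpa [Matrix.conjTranspose_apply] using this
  rw [h2]
  refine Finset.sum_congr rfl fun v _ => ?_
  rw [h1, Matrix.mul_apply]
  rfl

end OnWires

/-! ### Lists of gates -/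

section TotalOp

variable {w : ℕ} {α : Type} (op : α → Op w)

theorem totalOp_nil : totalOp op [] = 1 := rfl

theorem foldl_totalOp (l : List α) (M : Op w) :
    l.foldl (fun M g => op g * M) M = totalOp op l * M := by
  induction l generalizing M with
  | nil => simp [totalOp]
  | cons g l ih =>
    rw [totalOp, List.foldl_cons, List.foldl_cons, ih, ih (op g * 1), mul_one, Matrix.mul_assoc]

theorem totalOp_append (l l' : List α) :
    totalOp op (l ++ l') = totalOp op l' * totalOp op l := by
  rw [← foldl_totalOp, totalOp, List.foldl_append]
  rfl

theorem totalOp_singleton (g : α) : totalOp op [g] = op g := mul_one _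

theorem totalOp_cons (g : α) (l : List α) : totalOp op (g :: l) = totalOp op l * op g := by
  rw [← totalOp_singleton op g, ← totalOp_append]
  rfl

theorem totalOp_map {β : Type} (f : β → α) (l : List β) :
    totalOp op (l.map f) = totalOp (fun b => op (f b)) l := by
  simp [totalOp, List.foldl_map]

theorem totalOp_unitary (h : ∀ g, op g ∈ Matrix.unitaryGroup (Reg w) ℂ) (l : List α) :
    totalOp op l ∈ Matrix.unitaryGroup (Reg w) ℂ := by
  induction l with
  | nil => exact one_mem _
  | cons g l ih => rw [totalOp_cons]; exact mul_mem ih (h g)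

/-- The effect of a list of gates on a state. -/
noncomputable def evolve (l : List α) (σ : Op w) : Op w :=
  totalOp op l * σ * (totalOp op l)ᴴ

theorem evolve_nil (σ : Op w) : evolve op [] σ = σ := by simp [evolve, totalOp_nil]

theorem evolve_append (l l' : List α) (σ : Op w) :
    evolve op (l ++ l') σ = evolve op l' (evolve op l σ) := by
  simp only [evolve, totalOp_append, Matrix.conjTranspose_mul, Matrix.mul_assoc]

end TotalOp

/-- The list of gates permutes the computational basis; `F` is the inverse permutation. -/
def Permutes {w : ℕ} (l : List (Gate w)) (F : Equiv.Perm (Reg w)) : Prop :=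
  ∀ σ, evolve Gate.op l σ = σ.submatrix F F

theorem Permutes.nil {w : ℕ} : Permutes ([] : List (Gate w)) 1 := fun σ => by
  rw [evolve_nil]; rfl

theorem Permutes.append {w : ℕ} {l l' : List (Gate w)} {F F' : Equiv.Perm (Reg w)}
    (h : Permutes l F) (h' : Permutes l' F') : Permutes (l ++ l') (F * F') := fun σ => by
  rw [evolve_append, h, h']
  rfl

/-- Flipping wire `t` if `f` holds, where `f` ignores wire `t`. -/
def flipPerm {w : ℕ} (t : Fin w) (f : Reg w → Bool)
    (hf : ∀ x v, f (Function.update x t v) = f x) : Equiv.Perm (Reg w) :=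
  Function.Involutive.toPerm (fun x => Function.update x t (xor (x t) (f x))) fun x => by
    funext j
    by_cases hj : j = t
    · subst hj; simp [hf]
    · simp [hj]

/-- A flip is its own inverse, so its matrix gives the same permutation whether read by rows or by
columns. -/
theorem permutes_flip {w : ℕ} (g : Gate w) (t : Fin w) (f : Reg w → Bool)
    (hf : ∀ x v, f (Function.update x t v) = f x)
    (hg : ∀ x y, g.op x y = if x = Function.update y t (xor (y t) (f y)) then 1 else 0) :
    Permutes [g] (flipPerm t f hf) := by
  intro σ
  have hF : ∀ x, flipPerm t f hf (flipPerm t f hf x) = x := (flipPerm t f hf).left_inv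
  have hg' : ∀ x y, g.op x y = if y = flipPerm t f hf x then 1 else 0 := by
    intro x y
    rw [hg]
    refine if_congr ⟨fun h => ?_, fun h => ?_⟩ rfl rfl
    · rw [show x = flipPerm t f hf y from h, hF]
    · rw [h]; exact (hF x).symm
  ext x y
  rw [evolve, totalOp_singleton, Matrix.mul_apply]
  simp [Matrix.mul_apply, hg', Matrix.conjTranspose_apply, apply_ite star]

/-! ### The gates are unitary -/

theorem reg_one_eq (x y : Reg 1) : x = y ↔ x 0 = y 0 := by
  constructor
  · rintro rfl; rfl
  · intro h; funext i; rwa [Subsingleton.elim i 0]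

theorem sum_reg_one {M : Type*} [AddCommMonoid M] (f : Reg 1 → M) :
    ∑ u, f u = f (fun _ => false) + f fun _ => true := by
  rw [← (Equiv.funUnique (Fin 1) Bool).symm.sum_comp, Fintype.sum_bool, add_comm]
  rfl

namespace GateKind

theorem matX_conjTranspose : matXᴴ = matX := by
  ext x y
  simp only [matX, Matrix.conjTranspose_apply, Matrix.of_apply]
  cases x 0 <;> cases y 0 <;> simp

theorem matH_conjTranspose : matHᴴ = matH := by
  ext x y
  simp only [matH, Matrix.conjTranspose_apply, Matrix.of_apply]
  cases x 0 <;> cases y 0 <;> simp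

theorem matCNOT_conjTranspose : matCNOTᴴ = matCNOT := by
  ext x y
  simp only [matCNOT, Matrix.conjTranspose_apply, Matrix.of_apply]
  cases x 0 <;> cases y 0 <;> cases x 1 <;> cases y 1 <;> simp

theorem matCCNOT_conjTranspose : matCCNOTᴴ = matCCNOT := by
  ext x y
  simp only [matCCNOT, Matrix.conjTranspose_apply, Matrix.of_apply]
  cases x 0 <;> cases y 0 <;> cases x 1 <;> cases y 1 <;> cases x 2 <;> cases y 2 <;> simp

theorem matPhase_conjTranspose (s : ℝ) : (matPhase s)ᴴ = matPhase (-s) := by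
  rw [matPhase, matPhase, Matrix.diagonal_conjTranspose]
  congr 1
  funext x
  simp only [Pi.star_apply, apply_ite star, star_one]
  split_ifs
  · rw [Complex.star_def, ← Complex.exp_conj]
    simp
  · rfl

theorem inv_sqrt_two_sq : ((Real.sqrt 2 : ℝ) : ℂ)⁻¹ * ((Real.sqrt 2 : ℝ) : ℂ)⁻¹ = 2⁻¹ := by
  rw [← mul_inv, ← Complex.ofReal_mul, Real.mul_self_sqrt (by norm_num)]
  norm_num

theorem mat_unitary (g : GateKind) : g.mat ∈ Matrix.unitaryGroup (Reg g.arity) ℂ := by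
  rw [Matrix.mem_unitaryGroup_iff, Matrix.star_eq_conjTranspose]
  cases g
  · simp only [mat, matX_conjTranspose]
    ext x y
    simp only [matX, Matrix.mul_apply, Matrix.of_apply, Matrix.one_apply]
    rw [sum_reg_one, if_congr (reg_one_eq x y) rfl rfl]
    cases x 0 <;> cases y 0 <;> simp
  · simp only [mat, matH_conjTranspose]
    ext x y
    simp only [matH, Matrix.mul_apply, Matrix.of_apply, Matrix.one_apply]
    rw [sum_reg_one, if_congr (reg_one_eq x y) rfl rfl]
    have h := inv_sqrt_two_sq
    cases x 0 <;> cases y 0 <;> simp <;> linear_combination 2 * h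
  · simp only [mat, matPhase_conjTranspose]
    rw [matPhase, matPhase, Matrix.diagonal_mul_diagonal, ← Matrix.diagonal_one]
    congr 1
    funext x
    split_ifs
    · rw [← Complex.exp_add]; simp
    · simp
  · simp only [mat, matPhase_conjTranspose]
    rw [matPhase, matPhase, Matrix.diagonal_mul_diagonal, ← Matrix.diagonal_one]
    congr 1
    funext x
    split_ifs
    · rw [← Complex.exp_add]; simp
    · simp
  · simp only [mat, matCNOT_conjTranspose]
    ext x y
    simp only [matCNOT, Matrix.mul_apply, Matrix.of_apply, Matrix.one_apply]
    rw [Finset.sum_eq_single ![x 0, xor (x 1) (x 0)]]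
    · have : x = y ↔ x 0 = y 0 ∧ x 1 = y 1 := by rw [funext_iff, Fin.forall_fin_two]
      rw [if_congr this rfl rfl]
      simp only [Matrix.cons_val_zero, Matrix.cons_val_one]
      cases x 0 <;> cases y 0 <;> cases x 1 <;> cases y 1 <;> simp
    · intro z _ hz
      rw [if_neg, zero_mul]
      rintro ⟨h1, h2⟩
      refine hz ?_
      funext i
      fin_cases i <;> simp [h1, h2]
    · simp
  · simp only [mat, matCCNOT_conjTranspose]
    ext x y
    simp only [matCCNOT, Matrix.mul_apply, Matrix.of_apply, Matrix.one_apply]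
    rw [Finset.sum_eq_single ![x 0, x 1, xor (x 2) (x 0 && x 1)]]
    · have : x = y ↔ x 0 = y 0 ∧ x 1 = y 1 ∧ x 2 = y 2 := by
        rw [funext_iff]
        constructor
        · exact fun h => ⟨h 0, h 1, h 2⟩
        · rintro ⟨h0, h1, h2⟩ i
          fin_cases i <;> assumption
      rw [if_congr this rfl rfl]
      simp only [Matrix.cons_val_zero, Matrix.cons_val_one, Matrix.cons_val]
      cases x 0 <;> cases y 0 <;> cases x 1 <;> cases y 1 <;> cases x 2 <;> cases y 2 <;> simp
    · intro z _ hz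
      rw [if_neg, zero_mul]
      rintro ⟨h1, h2, h3⟩
      refine hz ?_
      funext i
      fin_cases i <;> simp [h1, h2, h3]
    · simp

end GateKind

theorem Gate.op_unitary {w : ℕ} (g : Gate w) : g.op ∈ Matrix.unitaryGroup (Reg w) ℂ :=
  onWires_unitary _ g.kind.mat_unitary

/-- The inverse gate. -/
def Gate.inv {w : ℕ} : Gate w → Gate w
  | ⟨GateKind.T, q⟩ => ⟨GateKind.Tinv, q⟩
  | ⟨GateKind.Tinv, q⟩ => ⟨GateKind.T, q⟩
  | ⟨GateKind.X, q⟩ => ⟨GateKind.X, q⟩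
  | ⟨GateKind.H, q⟩ => ⟨GateKind.H, q⟩
  | ⟨GateKind.CNOT, q⟩ => ⟨GateKind.CNOT, q⟩
  | ⟨GateKind.CCNOT, q⟩ => ⟨GateKind.CCNOT, q⟩

theorem Gate.op_inv {w : ℕ} (g : Gate w) : g.inv.op = g.opᴴ := by
  obtain ⟨k, q⟩ := g
  cases k <;> simp only [Gate.inv, Gate.op, onWires_conjTranspose, GateKind.mat,
    GateKind.matX_conjTranspose, GateKind.matH_conjTranspose, GateKind.matCNOT_conjTranspose,
    GateKind.matCCNOT_conjTranspose, GateKind.matPhase_conjTranspose, neg_neg]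

theorem totalOp_inv {w : ℕ} (l : List (Gate w)) :
    totalOp Gate.op (l.reverse.map Gate.inv) = (totalOp Gate.op l)ᴴ := by
  induction l with
  | nil => simp [totalOp_nil]
  | cons g l ih =>
    rw [List.reverse_cons, List.map_append, totalOp_append, ih, totalOp_cons,
      Matrix.conjTranspose_mul, List.map_singleton, totalOp_singleton, Gate.op_inv]

theorem evolve_inv {w : ℕ} (l : List (Gate w)) (σ : Op w) :
    evolve Gate.op (l.reverse.map Gate.inv) (evolve Gate.op l σ) = σ := by
  have h := totalOp_unitary Gate.op Gate.op_unitary l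
  rw [Matrix.mem_unitaryGroup_iff', Matrix.star_eq_conjTranspose] at h
  rw [evolve, evolve, totalOp_inv, Matrix.conjTranspose_conjTranspose]
  calc _ = ((totalOp Gate.op l)ᴴ * totalOp Gate.op l) * σ *
        ((totalOp Gate.op l)ᴴ * totalOp Gate.op l) := by simp only [Matrix.mul_assoc]
    _ = σ := by rw [h, one_mul, mul_one]

/-! ### Circuits on a prefix of the wires -/

/-- The same gate in a circuit with more wires. -/
def Gate.lift {w v : ℕ} (h : w ≤ v) (g : Gate w) : Gate v :=
  ⟨g.kind, g.wires.trans (Fin.castLEEmb h)⟩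

theorem Gate.data_lift_map {w v : ℕ} (h : w ≤ v) (l : List (Gate w)) :
    (l.map (Gate.lift h)).map Gate.data = l.map Gate.data := by
  rw [List.map_map]
  rfl

theorem totalOp_lift {w v : ℕ} (h : w ≤ v) (l : List (Gate w)) :
    totalOp Gate.op (l.map (Gate.lift h)) = onWires (Fin.castLEEmb h) (totalOp Gate.op l) := by
  induction l with
  | nil => simp [totalOp_nil, onWires_one]
  | cons g l ih =>
    rw [List.map_cons, totalOp_cons, totalOp_cons, ih, ← onWires_mul]
    congr 1
    exact onWires_trans _ _ _

/-- The register `x` with its first bits replaced by `u`. -/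
def overwrite {w v : ℕ} (u : Reg w) (x : Reg v) : Reg v := fun j => if (j : ℕ) < w then bit u j else x j

theorem bit_overwrite {w v : ℕ} (h : w ≤ v) (u : Reg w) (x : Reg v) (j : ℕ) :
    bit (overwrite u x) j = if j < w then bit u j else bit x j := by
  by_cases hj : j < v
  · rw [bit_of_lt _ hj, bit_of_lt x hj, overwrite]
  · rw [bit_of_le _ (by omega), if_neg (by omega), bit_of_le _ (by omega)]

theorem extend_castLE {w v : ℕ} (h : w ≤ v) (u : Reg w) (x : Reg v) :
    Function.extend (Fin.castLEEmb h) u x = overwrite u x := by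
  have := extend_self_of_off (Fin.castLEEmb h) (x := x) (y := overwrite u x) fun j hj => by
    rw [overwrite, if_neg]
    exact fun hlt => hj ⟨⟨j, hlt⟩, Fin.ext rfl⟩
  rw [← this]
  congr 1
  funext i
  simp [overwrite, Fin.castLEEmb]

/-- Gates on a prefix act separately on each slice obtained by fixing the remaining bits of the row
and of the column. Subcircuits are analysed through this: each slice is recognised as a multiple of
a valid input of the smaller circuit. -/
theorem evolve_lift {w v : ℕ} (h : w ≤ v) (l : List (Gate w)) (σ : Op v) (x y : Reg v) :
    evolve Gate.op (l.map (Gate.lift h)) σ x y =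
      evolve Gate.op l (Matrix.of fun u u' => σ (overwrite u x) (overwrite u' y))
        (blk x 0 w) (blk y 0 w) := by
  rw [evolve, totalOp_lift, onWires_conj_apply]
  simp only [extend_castLE]
  rw [evolve, ← comp_castLE h, ← comp_castLE h]
  rfl

/-! ### Classical gates -/

/-- The list of gates permutes the computational basis; on the bits of a register, `f` is the
inverse permutation and `f'` the permutation itself. -/
def ActsAs {w : ℕ} (l : List (Gate w)) (f f' : (ℕ → Bool) → ℕ → Bool) : Prop :=
  ∃ F : Equiv.Perm (Reg w), Permutes l F ∧ (∀ x, bit (F x) = f (bit x)) ∧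
    ∀ x, bit (F.symm x) = f' (bit x)

theorem ActsAs.nil {w : ℕ} : ActsAs ([] : List (Gate w)) id id :=
  ⟨1, Permutes.nil, fun _ => rfl, fun _ => rfl⟩

/-- Matrix entries are pulled back along the inverse permutations, so the later list acts on the
index first. The forward maps compose in the order of execution. -/
theorem ActsAs.append {w : ℕ} {l₁ l₂ : List (Gate w)} {f₁ f₁' f₂ f₂' : (ℕ → Bool) → ℕ → Bool}
    (h₁ : ActsAs l₁ f₁ f₁') (h₂ : ActsAs l₂ f₂ f₂') :
    ActsAs (l₁ ++ l₂) (f₁ ∘ f₂) (f₂' ∘ f₁') := by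
  obtain ⟨F, hF, hf, hf'⟩ := h₁
  obtain ⟨G, hG, hg, hg'⟩ := h₂
  refine ⟨F * G, hF.append hG, fun x => ?_, fun x => ?_⟩
  · rw [Function.comp_apply, ← hg, ← hf]; rfl
  · rw [Function.comp_apply, ← hf', ← hg']; rfl

theorem ActsAs.flip {w : ℕ} (g : Gate w) (t : Fin w) (φ : (ℕ → Bool) → Bool)
    (hφ : ∀ (x : Reg w) v, φ (bit (Function.update x t v)) = φ (bit x))
    (hg : ∀ x y, g.op x y = if x = Function.update y t (xor (y t) (φ (bit y))) then 1 else 0) :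
    ActsAs [g] (fun β j => if j = t then xor (β t) (φ β) else β j)
      (fun β j => if j = t then xor (β t) (φ β) else β j) := by
  have key : ∀ x : Reg w, bit (Function.update x t (xor (x t) (φ (bit x)))) =
      fun j : ℕ => if j = t then xor (bit x t) (φ (bit x)) else bit x j := by
    intro x
    funext j
    by_cases hj : j < w
    · rw [bit_of_lt _ hj, bit_of_lt _ hj, Function.update_apply]
      simp [Fin.ext_iff]
    · rw [bit_of_le _ (by omega), if_neg (by omega), bit_of_le _ (by omega)]
  exact ⟨flipPerm t (fun x => φ (bit x)) hφ, permutes_flip g t _ hφ hg, key, key⟩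

theorem eq_update_iff {w : ℕ} {t : Fin w} {x y : Reg w} {v : Bool} :
    x = Function.update y t v ↔ x t = v ∧ ∀ j, j ≠ t → x j = y j := by
  constructor
  · rintro rfl
    exact ⟨by simp, fun j hj => by simp [hj]⟩
  · rintro ⟨h1, h2⟩
    funext j
    by_cases hj : j = t
    · subst hj; simp [h1]
    · simp [hj, h2 j hj]

/-- A bit flip on wire `t`. -/
def xL (w t : ℕ) : List (Gate w) :=
  if h : t < w then [⟨GateKind.X, ⟨![⟨t, h⟩], Function.injective_of_subsingleton _⟩⟩] else []

/-- A Hadamard gate on wire `t`. -/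
def hL (w t : ℕ) : List (Gate w) :=
  if h : t < w then [⟨GateKind.H, ⟨![⟨t, h⟩], Function.injective_of_subsingleton _⟩⟩] else []

/-- A bit flip on wire `t`, controlled on wire `c`. -/
def cnotL (w c t : ℕ) : List (Gate w) :=
  if h : c < w ∧ t < w ∧ c ≠ t then
    [⟨GateKind.CNOT, ⟨![⟨c, h.1⟩, ⟨t, h.2.1⟩], by
      intro i j hij
      fin_cases i <;> fin_cases j <;> simp_all [Fin.ext_iff, eq_comm]⟩⟩]
  else []

/-- A bit flip on wire `t`, controlled on the wires `c` and `d`. -/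
def ccnotL (w c d t : ℕ) : List (Gate w) :=
  if h : c < w ∧ d < w ∧ t < w ∧ c ≠ d ∧ c ≠ t ∧ d ≠ t then
    [⟨GateKind.CCNOT, ⟨![⟨c, h.1⟩, ⟨d, h.2.1⟩, ⟨t, h.2.2.1⟩], by
      intro i j hij
      fin_cases i <;> fin_cases j <;> simp_all [Fin.ext_iff, eq_comm]⟩⟩]
  else []

theorem onWires_matCNOT {w : ℕ} (q : Fin 2 ↪ Fin w) (x y : Reg w) :
    onWires q GateKind.matCNOT x y =
      if x = Function.update y (q 1) (xor (y (q 1)) (y (q 0))) then 1 else 0 := by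
  rw [if_congr eq_update_iff rfl rfl]
  simp only [onWires, Matrix.of_apply, GateKind.matCNOT]
  rw [← ite_and]
  refine if_congr ?_ rfl rfl
  simp only [Set.mem_range, not_exists, Fin.forall_fin_two, Function.comp_apply]
  constructor
  · rintro ⟨h1, h2, h3⟩
    refine ⟨h3, fun j hj => ?_⟩
    by_cases hjc : q 0 = j
    · rw [← hjc, h2]
    · exact h1 j ⟨hjc, hj.symm⟩
  · rintro ⟨h1, h2⟩
    exact ⟨fun j hj => h2 j (Ne.symm hj.2), h2 _ (q.injective.ne (by decide)), h1⟩

theorem onWires_matCCNOT {w : ℕ} (q : Fin 3 ↪ Fin w) (x y : Reg w) :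
    onWires q GateKind.matCCNOT x y =
      if x = Function.update y (q 2) (xor (y (q 2)) (y (q 0) && y (q 1))) then 1 else 0 := by
  rw [if_congr eq_update_iff rfl rfl]
  simp only [onWires, Matrix.of_apply, GateKind.matCCNOT]
  rw [← ite_and]
  refine if_congr ?_ rfl rfl
  have hall : ∀ P : Fin 3 → Prop, (∀ i, P i) ↔ P 0 ∧ P 1 ∧ P 2 := by
    intro P
    refine ⟨fun h => ⟨h 0, h 1, h 2⟩, ?_⟩
    rintro ⟨h0, h1, h2⟩ i
    fin_cases i <;> assumption
  simp only [Set.mem_range, not_exists, hall, Function.comp_apply]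
  constructor
  · rintro ⟨h1, h2, h3, h4⟩
    refine ⟨h4, fun j hj => ?_⟩
    by_cases hjc : q 0 = j
    · rw [← hjc, h2]
    by_cases hjd : q 1 = j
    · rw [← hjd, h3]
    exact h1 j ⟨hjc, hjd, hj.symm⟩
  · rintro ⟨h1, h2⟩
    exact ⟨fun j hj => h2 j (Ne.symm hj.2.2), h2 _ (q.injective.ne (by decide)),
      h2 _ (q.injective.ne (by decide)), h1⟩

/-- The gate lists fall back to the empty list when wires are out of range or coincide, so their
definitions carry no side conditions. These appear only in statements about their action. -/
theorem xL_actsAs {w t : ℕ} (ht : t < w) :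
    ActsAs (xL w t) (fun β j => if j = t then !β t else β j)
      (fun β j => if j = t then !β t else β j) := by
  have := ActsAs.flip (w := w) ⟨GateKind.X, ⟨![⟨t, ht⟩], Function.injective_of_subsingleton _⟩⟩
    ⟨t, ht⟩ (fun _ => true) (fun _ _ => rfl) (fun x y => by
      rw [if_congr eq_update_iff rfl rfl]
      simp only [Gate.op, onWires, Matrix.of_apply, GateKind.mat, GateKind.matX,
        Function.Embedding.coeFn_mk]
      rw [← ite_and]
      refine if_congr ?_ rfl rfl
      simp [and_comm])
  simpa [xL, ht] using this

theorem cnotL_actsAs {w c t : ℕ} (hc : c < w) (ht : t < w) (hct : c ≠ t) :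
    ActsAs (cnotL w c t) (fun β j => if j = t then xor (β t) (β c) else β j)
      (fun β j => if j = t then xor (β t) (β c) else β j) := by
  rw [cnotL, dif_pos ⟨hc, ht, hct⟩]
  refine ActsAs.flip (w := w) _ ⟨t, ht⟩ (fun β => β c) (fun x v => ?_) (fun x y => ?_)
  · simp only [bit_of_lt _ hc]
    rw [Function.update_of_ne]
    simpa [Fin.ext_iff] using hct
  · refine (onWires_matCNOT _ x y).trans ?_
    simp only [bit_of_lt _ hc]
    rfl

theorem ccnotL_actsAs {w c d t : ℕ} (hc : c < w) (hd : d < w) (ht : t < w) (hcd : c ≠ d)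
    (hct : c ≠ t) (hdt : d ≠ t) :
    ActsAs (ccnotL w c d t) (fun β j => if j = t then xor (β t) (β c && β d) else β j)
      (fun β j => if j = t then xor (β t) (β c && β d) else β j) := by
  rw [ccnotL, dif_pos ⟨hc, hd, ht, hcd, hct, hdt⟩]
  refine ActsAs.flip (w := w) _ ⟨t, ht⟩ (fun β => β c && β d) (fun x v => ?_) (fun x y => ?_)
  · simp only [bit_of_lt _ hc, bit_of_lt _ hd]
    rw [Function.update_of_ne, Function.update_of_ne]
    · simpa [Fin.ext_iff] using hdt
    · simpa [Fin.ext_iff] using hct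
  · refine (onWires_matCCNOT _ x y).trans ?_
    simp only [bit_of_lt _ hc, bit_of_lt _ hd]
    rfl

/-- Exchanging the wires `a` and `b`. -/
def swapL (w a b : ℕ) : List (Gate w) := cnotL w a b ++ cnotL w b a ++ cnotL w a b

theorem ActsAs.congr {w : ℕ} {l : List (Gate w)} {f f' g g' : (ℕ → Bool) → ℕ → Bool}
    (h : ActsAs l f f') (hf : f = g) (hf' : f' = g') : ActsAs l g g' := hf ▸ hf' ▸ h

theorem swapL_actsAs {w a b : ℕ} (ha : a < w) (hb : b < w) (hab : a ≠ b) :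
    ActsAs (swapL w a b) (fun β j => β (if j = a then b else if j = b then a else j))
      (fun β j => β (if j = a then b else if j = b then a else j)) := by
  refine ActsAs.congr (((cnotL_actsAs ha hb hab).append (cnotL_actsAs hb ha hab.symm)).append
    (cnotL_actsAs ha hb hab)) ?_ ?_ <;>
  · funext β j
    simp only [Function.comp_apply]
    by_cases hja : j = a
    · subst hja
      simp only [hab, hab.symm, if_true, if_false]
      cases β j <;> cases β b <;> rfl
    · by_cases hjb : j = b
      · subst hjb
        simp [hab, hab.symm]
      · simp [hja, hjb]

/-- Controlled bit flips from the wires `a, …, a + c - 1` to the wires `b, …, b + c - 1`. -/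
def cnotBlock (w a b c : ℕ) : List (Gate w) :=
  (List.range c).flatMap fun i => cnotL w (a + i) (b + i)

/-- Exchanging the wires `a, …, a + c - 1` and `b, …, b + c - 1`. -/
def swapBlock (w a b c : ℕ) : List (Gate w) :=
  (List.range c).flatMap fun i => swapL w (a + i) (b + i)

/-- No target wire is also a source, so the flips do not interact and the block is an involution. -/
theorem cnotBlock_actsAs {w a b c : ℕ} (ha : a + c ≤ w) (hb : b + c ≤ w)
    (hab : a + c ≤ b ∨ b + c ≤ a) :
    ActsAs (cnotBlock w a b c)
      (fun β j => if b ≤ j ∧ j < b + c then xor (β j) (β (a + (j - b))) else β j)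
      (fun β j => if b ≤ j ∧ j < b + c then xor (β j) (β (a + (j - b))) else β j) := by
  induction c with
  | zero =>
    refine ActsAs.congr ActsAs.nil ?_ ?_ <;>
    · funext β j
      rw [if_neg (by omega)]
      rfl
  | succ c ih =>
    rw [cnotBlock, List.range_succ, List.flatMap_append]
    simp only [List.flatMap_cons, List.flatMap_nil, List.append_nil]
    refine ActsAs.congr ((ih (by omega) (by omega) (by omega)).append
      (cnotL_actsAs (by omega) (by omega) (by omega))) ?_ ?_
    · funext β j
      simp only [Function.comp_apply]
      by_cases h1 : j = b + c
      · subst h1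
        simp
      · by_cases h2 : b ≤ j ∧ j < b + c
        · rw [if_pos h2, if_neg h1, if_neg (by omega), if_pos (by omega)]
        · rw [if_neg h2, if_neg h1, if_neg (by omega)]
    · funext β j
      simp only [Function.comp_apply]
      by_cases h1 : j = b + c
      · subst h1
        rw [if_pos rfl, if_neg (by omega), if_neg (by omega), if_pos (by omega)]
        simp
      · by_cases h2 : b ≤ j ∧ j < b + c
        · rw [if_neg h1, if_pos h2, if_pos (by omega)]
        · rw [if_neg h1, if_neg h2, if_neg (by omega)]

theorem swapBlock_actsAs {w a b c : ℕ} (hb : b + c ≤ w) (hab : a + c ≤ b) :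
    ActsAs (swapBlock w a b c)
      (fun β j => β (if a ≤ j ∧ j < a + c then b + (j - a) else
        if b ≤ j ∧ j < b + c then a + (j - b) else j))
      (fun β j => β (if a ≤ j ∧ j < a + c then b + (j - a) else
        if b ≤ j ∧ j < b + c then a + (j - b) else j)) := by
  induction c with
  | zero =>
    refine ActsAs.congr ActsAs.nil ?_ ?_ <;>
    · funext β j
      rw [if_neg (by omega), if_neg (by omega)]
      rfl
  | succ c ih =>
    rw [swapBlock, List.range_succ, List.flatMap_append]
    simp only [List.flatMap_cons, List.flatMap_nil, List.append_nil]
    refine ActsAs.congr ((ih (by omega) (by omega)).append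
      (swapL_actsAs (by omega) (by omega) (by omega))) ?_ ?_ <;>
    · funext β j
      simp only [Function.comp_apply]
      congr 1
      split_ifs <;> omega

/-! ### Blocks of Hadamard gates -/

/-- The register with the bits `a, …, a + c - 1` set to `false`. -/
def clr {w : ℕ} (a c : ℕ) (x : Reg w) : Reg w := fun j =>
  if a ≤ (j : ℕ) ∧ (j : ℕ) < a + c then false else x j

theorem bit_clr {w : ℕ} (a c : ℕ) (x : Reg w) (j : ℕ) :
    bit (clr a c x) j = if a ≤ j ∧ j < a + c then false else bit x j := by
  by_cases hj : j < w
  · rw [bit_of_lt _ hj, bit_of_lt x hj, clr]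
  · rw [bit_of_le _ (by omega), bit_of_le x (by omega), ite_self]

/-- Hadamard gates on the wires `a, …, a + c - 1`. -/
def hBlock (w a c : ℕ) : List (Gate w) := (List.range c).flatMap fun i => hL w (a + i)

/-- On a wire in `|0⟩` the gate produces `|+⟩⟨+|`, whose four entries are all `1 / 2`. The
hypothesis expresses that the wire is in `|0⟩`, the only case in which Hadamard gates are applied
here. -/
theorem evolve_hL {w a : ℕ} (ha : a < w) (σ : Op w)
    (hσ : ∀ x y, bit x a = true ∨ bit y a = true → σ x y = 0) (x y : Reg w) :
    evolve Gate.op (hL w a) σ x y = 2⁻¹ * σ (clr a 1 x) (clr a 1 y) := by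
  have hclr : ∀ x : Reg w, Function.extend (![(⟨a, ha⟩ : Fin w)]) (fun _ => false) x =
      clr a 1 x := by
    intro x
    have := extend_self_of_off ⟨![(⟨a, ha⟩ : Fin w)], Function.injective_of_subsingleton _⟩
      (x := x) (y := clr a 1 x) (fun j hj => by
        rw [clr, if_neg]
        intro h
        exact hj ⟨0, Fin.ext (by simp; omega)⟩)
    rw [← this]
    congr 1
    funext i
    simp [clr]
  have htrue : ∀ x : Reg w, bit (Function.extend (![(⟨a, ha⟩ : Fin w)]) (fun _ => true) x) a =
      true := by
    intro x
    rw [bit_of_lt _ ha]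
    exact (Function.injective_of_subsingleton (![(⟨a, ha⟩ : Fin w)])).extend_apply
      (fun _ : Fin 1 => true) x 0
  rw [hL, dif_pos ha, evolve, totalOp_singleton, Gate.op, onWires_conj_apply]
  simp only [Matrix.mul_apply, GateKind.mat]
  rw [sum_reg_one, sum_reg_one, sum_reg_one]
  simp only [Matrix.of_apply, Function.Embedding.coeFn_mk]
  rw [hσ _ _ (Or.inl (htrue x)), hσ _ _ (Or.inr (htrue y)), hσ _ _ (Or.inl (htrue x)), hclr, hclr]
  simp only [GateKind.matH, Matrix.conjTranspose_apply, Matrix.of_apply]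
  simp
  linear_combination σ (clr a 1 x) (clr a 1 y) * GateKind.inv_sqrt_two_sq

theorem evolve_hBlock {w a c : ℕ} (ha : a + c ≤ w) (σ : Op w)
    (hσ : ∀ x y j, a ≤ j → j < a + c → bit x j = true ∨ bit y j = true → σ x y = 0)
    (x y : Reg w) :
    evolve Gate.op (hBlock w a c) σ x y = (2 ^ c)⁻¹ * σ (clr a c x) (clr a c y) := by
  induction c generalizing x y with
  | zero =>
    have : ∀ x : Reg w, clr a 0 x = x := fun x => bit_ext fun j _ => by
      rw [bit_clr, if_neg (by omega)]
    simp [hBlock, evolve_nil, this]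
  | succ c ih =>
    have ih' := ih (by omega) fun x y j h1 h2 => hσ x y j h1 (by omega)
    have hcc : ∀ x : Reg w, clr a c (clr (a + c) 1 x) = clr a (c + 1) x := fun x =>
      bit_ext fun j _ => by
        simp only [bit_clr]
        split_ifs <;> first | rfl | omega
    rw [hBlock, List.range_succ, List.flatMap_append, evolve_append]
    simp only [List.flatMap_cons, List.flatMap_nil, List.append_nil]
    rw [evolve_hL (by omega), ← hBlock, ih', hcc, hcc, pow_succ, mul_inv]
    · ring
    · intro x y hxy
      rw [← hBlock, ih', hσ _ _ (a + c) (by omega) (by omega), mul_zero]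
      rw [bit_clr, bit_clr, if_neg (by omega), if_neg (by omega)]
      exact hxy

/-! ### Indicators and sums over registers -/

open Classical in
/-- The indicator of a proposition. -/
noncomputable def ind (p : Prop) : ℂ := if p then 1 else 0

theorem ind_pos {p : Prop} (h : p) : ind p = 1 := if_pos h

theorem ind_neg {p : Prop} (h : ¬p) : ind p = 0 := if_neg h

theorem ind_and (p q : Prop) : ind (p ∧ q) = ind p * ind q := by
  by_cases hp : p <;> by_cases hq : q <;> simp [ind, hp, hq]

theorem ind_congr {p q : Prop} (h : p ↔ q) : ind p = ind q := by rw [propext h]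

theorem ite_eq_ind (p : Prop) [Decidable p] (z : ℂ) : (if p then z else 0) = ind p * z := by
  by_cases h : p <;> simp [ind, h]

theorem star_ind (p : Prop) : star (ind p) = ind p := by
  by_cases h : p <;> simp [ind, h]

/-- Used to pass from sums over all wires to sums over a parametrization of the support, such as the
registers with a given key and clean ancillas. -/
theorem sum_ind_mul {ι α : Type*} [Fintype ι] [Fintype α] (φ : ι → α) (hφ : Function.Injective φ)
    {S : α → Prop} (hS : ∀ x, S x ↔ ∃ i, φ i = x) (f : α → ℂ) :
    ∑ x, ind (S x) * f x = ∑ i, f (φ i) := by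
  classical
  rw [← Finset.sum_image (s := Finset.univ) (g := φ) (f := f) (fun i _ j _ h => hφ h)]
  rw [← Finset.sum_subset (Finset.subset_univ (Finset.univ.image φ))]
  · refine Finset.sum_congr rfl fun x hx => ?_
    rw [ind_pos ((hS x).2 (by simpa using hx)), one_mul]
  · intro x _ hx
    rw [ind_neg (fun h => hx (by simpa using (hS x).1 h)), zero_mul]

theorem sum_ind_eq {α : Type*} [Fintype α] (a : α) (f : α → ℂ) :
    ∑ x, ind (x = a) * f x = f a := by
  rw [Finset.sum_eq_single a]
  · rw [ind_pos rfl, one_mul]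
  · intro b _ hb
    rw [ind_neg hb, zero_mul]
  · simp

theorem basisState_apply {a : ℕ} (k x y : Reg a) :
    basisState k x y = ind (x = k) * ind (y = k) := by
  rw [basisState, Matrix.single_apply, ite_eq_ind, mul_one, ← ind_and]
  exact ind_congr (by simp only [eq_comm])

theorem eq_blk_iff {w a c : ℕ} (x : Reg w) (k : Reg c) :
    blk x a c = k ↔ ∀ j < c, bit x (a + j) = bit k j := by
  constructor
  · rintro rfl j hj
    rw [bit_blk, if_pos hj]
  · exact fun h => bit_ext fun j hj => by rw [bit_blk, if_pos hj, h j hj]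

/-- The register starts with `k` and is zero from bit `c` on. -/
def KeyPad {κ w : ℕ} (k : Reg κ) (c : ℕ) (x : Reg w) : Prop :=
  (∀ j < κ, bit x j = bit k j) ∧ ∀ j < w, c ≤ j → bit x j = false

theorem padZero_eq {i w : ℕ} (h : i ≤ w) (ρ : Op i) (x y : Reg w) :
    padZero h ρ x y = ind (∀ j < w, i ≤ j → bit x j = false) *
      ind (∀ j < w, i ≤ j → bit y j = false) * ρ (blk x 0 i) (blk y 0 i) := by
  rw [padZero_apply, ite_eq_ind, ← ind_and]
  congr 1
  exact ind_congr ⟨fun H => ⟨fun j hj hi => (H j hj hi).1, fun j hj hi => (H j hj hi).2⟩,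
    fun H j hj hi => ⟨H.1 j hj hi, H.2 j hj hi⟩⟩

theorem blk_blk {w : ℕ} (x : Reg w) {a c a' c' : ℕ} (h : a' + c' ≤ c) :
    blk (blk x a c) a' c' = blk x (a + a') c' := bit_ext fun j hj => by
  simp only [bit_blk, hj, if_true, if_pos (show a' + j < c by omega), add_assoc]

theorem padZero_tensor_basisState {κ n w : ℕ} (h : κ + n ≤ w) (k : Reg κ) (N : Op n)
    (x y : Reg w) :
    padZero h (tensor (basisState k) N) x y = ind (KeyPad k (κ + n) x) *
      ind (KeyPad k (κ + n) y) * N (blk x κ n) (blk y κ n) := by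
  have hk : ∀ x : Reg w, ind (KeyPad k (κ + n) x) = ind (blk x 0 κ = k) *
      ind (∀ j < w, κ + n ≤ j → bit x j = false) := by
    intro x
    rw [← ind_and]
    refine ind_congr ?_
    rw [eq_blk_iff]
    simp only [zero_add]
    rfl
  rw [padZero_eq, tensor_apply, basisState_apply, blk_blk _ (by omega), blk_blk _ (by omega),
    blk_blk _ (by omega), blk_blk _ (by omega), hk, hk]
  simp only [zero_add]
  ring

theorem padZero_basisState {κ w : ℕ} (h : κ ≤ w) (k : Reg κ) (x y : Reg w) :
    padZero h (basisState k) x y = ind (KeyPad k κ x) * ind (KeyPad k κ y) := by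
  have hk : ∀ x : Reg w, ind (KeyPad k κ x) = ind (blk x 0 κ = k) *
      ind (∀ j < w, κ ≤ j → bit x j = false) := by
    intro x
    rw [← ind_and]
    refine ind_congr ?_
    rw [eq_blk_iff]
    simp only [zero_add]
    rfl
  rw [padZero_eq, basisState_apply, hk, hk]
  ring

theorem evolve_smul {w : ℕ} {α : Type} (op : α → Op w) (l : List α) (c : ℂ) (σ : Op w) :
    evolve op l (c • σ) = c • evolve op l σ := by
  simp [evolve]

/-! ### A circuit that implements a unitary leaves fixed garbage -/

theorem eq_zero_of_sum_mul_star {ι : Type*} [Fintype ι] {f : ι → ℂ}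
    (h : ∑ i, f i * star (f i) = 0) (i : ι) : f i = 0 := by
  have h' : ∑ i, Complex.normSq (f i) = 0 := by
    have : ∀ i, f i * star (f i) = (Complex.normSq (f i) : ℂ) := fun i => Complex.mul_conj _
    simp only [this] at h
    exact_mod_cast h
  rw [Finset.sum_eq_zero_iff_of_nonneg fun i _ => Complex.normSq_nonneg _] at h'
  exact Complex.normSq_eq_zero.mp (h' i (Finset.mem_univ i))

/-- An isometry whose reduced state is always the input appends a fixed vector. -/
theorem exists_fixed_vector {ι ε : Type*} [Fintype ι] [DecidableEq ι] [Fintype ε] [Nonempty ι]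
    (S : ι → ε → ι → ℂ)
    (h : ∀ φ : ι → ℂ, star φ ⬝ᵥ φ = 1 → ∀ a b,
      ∑ e, (∑ c, S a e c * φ c) * star (∑ c, S b e c * φ c) = φ a * star (φ b)) :
    ∃ g : ε → ℂ, ∑ e, g e * star (g e) = 1 ∧ ∀ a e c, S a e c = if a = c then g e else 0 := by
  have h1 : ∀ a b c, ∑ e, S a e c * star (S b e c) = (if a = c then 1 else 0) *
      (if b = c then 1 else 0) := by
    intro a b c
    have := h (Pi.single c 1) (by simp) a b
    simp only [Pi.single_apply, mul_ite, mul_one, mul_zero, Finset.sum_ite_eq', Finset.mem_univ,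
      if_true] at this
    rw [this]
    split_ifs <;> simp
  have h2 : ∀ a c, a ≠ c → ∀ e, S a e c = 0 := by
    intro a c hac e
    refine eq_zero_of_sum_mul_star (f := fun e => S a e c) ?_ e
    rw [h1, if_neg hac, zero_mul]
  -- The environment vectors attached to two basis states are compared by feeding in the
  -- superposition `(c + d) / √2` and reading off its off-diagonal entry.
  have h3 : ∀ c d, c ≠ d → ∑ e, S c e c * star (S d e d) = 1 := by
    intro c d hcd
    have hs := GateKind.inv_sqrt_two_sq
    set s : ℂ := ((Real.sqrt 2 : ℝ) : ℂ)⁻¹ with hsdef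
    have hstar : star s = s := by rw [hsdef]; simp
    have hφ : ∀ F : ι → ℂ, ∑ x, F x * (Pi.single c s + Pi.single d s : ι → ℂ) x =
        F c * s + F d * s := by
      intro F
      simp [mul_add, Finset.sum_add_distrib, Pi.single_apply]
    have := h (Pi.single c s + Pi.single d s) (by
      rw [dotProduct, hφ]
      simp only [Pi.star_apply, Pi.add_apply, Pi.single_eq_same, Pi.single_eq_of_ne hcd,
        Pi.single_eq_of_ne hcd.symm, add_zero, zero_add, hstar]
      linear_combination 2 * hs) c d
    simp only [hφ] at this
    simp only [h2 c d hcd, h2 d c hcd.symm, Pi.add_apply, Pi.single_eq_same,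
      Pi.single_eq_of_ne hcd, Pi.single_eq_of_ne hcd.symm, zero_mul, add_zero, zero_add,
      star_mul', hstar, hs] at this
    have h4 : ∀ e, S c e c * s * (star (S d e d) * s) = 2⁻¹ * (S c e c * star (S d e d)) := by
      intro e
      linear_combination S c e c * star (S d e d) * hs
    simp only [h4, ← Finset.mul_sum] at this
    linear_combination 2 * this
  -- Two unit vectors with inner product one coincide: the squared norm of their difference is `1 -
  -- 1 - 1 + 1`.
  have h4 : ∀ c d e, S c e c = S d e d := by
    intro c d e
    by_cases hcd : c = d
    · rw [hcd]
    refine sub_eq_zero.mp (eq_zero_of_sum_mul_star (f := fun e => S c e c - S d e d) ?_ e)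
    have e1 := h1 c c c
    have e2 := h1 d d d
    have e3 := h3 c d hcd
    have e4 := h3 d c (Ne.symm hcd)
    simp only [if_true, mul_one] at e1 e2
    simp only [star_sub, sub_mul, mul_sub, Finset.sum_sub_distrib, e1, e2, e3, e4]
    ring
  obtain ⟨c₀⟩ := ‹Nonempty ι›
  refine ⟨fun e => S c₀ e c₀, by simpa using h1 c₀ c₀ c₀, fun a e c => ?_⟩
  split_ifs with hac
  · rw [hac, h4]
  · exact h2 a c hac e

theorem conj_pureState {a b : ℕ} (B : Matrix (Reg a) (Reg b) ℂ) (ψ : Reg b → ℂ) :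
    B * pureState ψ * Bᴴ = pureState (B *ᵥ ψ) := by
  rw [pureState, Matrix.mul_vecMulVec, Matrix.vecMulVec_mul, pureState, Matrix.star_mulVec]

/-- The hypothesis controls only the kept wires, but a pure reduced state forces a product with the
environment. Let `B` collect the columns of the circuit at inputs with key `k` and clean ancillas.
Then `B * Uᴴ` reduces to the identity channel, so by `exists_fixed_vector` it appends a fixed
vector. Linearity then gives the full output for every operator `N`; the vector may depend on `k`.
-/
theorem exists_garbage {κ n : ℕ} (C : Circuit Gate (κ + n) n) (U : Uni n) (k : Reg κ)
    (h : ∀ ψ : Reg n → ℂ, star ψ ⬝ᵥ ψ = 1 →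
      C.run (tensor (basisState k) (pureState ψ)) = pureState ((U : Op n) *ᵥ ψ)) :
    ∃ g : Reg (C.w - n) → ℂ, ∑ e, g e * star (g e) = 1 ∧ ∀ (N : Op n) (x y : Reg C.w),
      evolve Gate.op C.gates (padZero C.input_le (tensor (basisState k) N)) x y =
        ((U : Op n) * N * (U : Op n)ᴴ) (blk x 0 n) (blk y 0 n) *
          (g (blk x n (C.w - n)) * star (g (blk y n (C.w - n)))) := by
  have hw := C.input_le
  have ho : n + (C.w - n) = C.w := by omega
  set V := totalOp Gate.op C.gates with hV
  -- the columns of the circuit at the valid inputs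
  let E : Reg n → Reg C.w := fun c => glue C.w k c
  let B : Matrix (Reg C.w) (Reg n) ℂ := Matrix.of fun x c => V x (E c)
  have hEbit : ∀ c j, bit (E c) j = if j < C.w then (if j < κ then bit k j else bit c (j - κ))
      else false := fun c j => bit_glue k c j
  have hEinj : Function.Injective E := by
    intro c d hcd
    refine bit_ext fun j hj => ?_
    have := congrArg (fun x => bit x (κ + j)) hcd
    simpa [hEbit, show κ + j < C.w by omega] using this
  have hES : ∀ x : Reg C.w, KeyPad k (κ + n) x ↔ ∃ c, E c = x := by
    intro x
    constructor
    · rintro ⟨h1, h2⟩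
      refine ⟨blk x κ n, bit_ext fun j hj => ?_⟩
      rw [hEbit, if_pos hj, bit_blk]
      split_ifs with h3 h4
      · rw [h1 j h3]
      · congr 1; omega
      · rw [h2 j hj (by omega)]
    · rintro ⟨c, rfl⟩
      refine ⟨fun j hj => ?_, fun j hj hc => ?_⟩
      · rw [hEbit, if_pos (by omega), if_pos hj]
      · rw [hEbit, if_pos hj, if_neg (by omega), bit_of_le _ (by omega)]
  have hEblk : ∀ c, blk (E c) κ n = c := fun c => bit_ext fun j hj => by
    rw [bit_blk, if_pos hj, hEbit, if_pos (by omega), if_neg (by omega)]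
    congr 1; omega
  have hev : ∀ N : Op n, evolve Gate.op C.gates (padZero C.input_le (tensor (basisState k) N)) =
      B * N * Bᴴ := by
    intro N
    ext x y
    rw [evolve, ← hV, Matrix.mul_apply, Matrix.mul_apply]
    have e1 : ∀ z, (V * padZero C.input_le (tensor (basisState k) N)) x z * Vᴴ z y =
        ind (KeyPad k (κ + n) z) * (∑ u, ind (KeyPad k (κ + n) u) *
          (V x u * N (blk u κ n) (blk z κ n) * Vᴴ z y)) := by
      intro z
      rw [Matrix.mul_apply, Finset.sum_mul, Finset.mul_sum]
      refine Finset.sum_congr rfl fun u _ => ?_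
      rw [padZero_tensor_basisState]
      ring
    rw [Finset.sum_congr rfl fun z _ => e1 z, sum_ind_mul E hEinj hES]
    refine Finset.sum_congr rfl fun d _ => ?_
    rw [sum_ind_mul E hEinj hES, Matrix.mul_apply, Finset.sum_mul]
    refine Finset.sum_congr rfl fun c _ => ?_
    rw [hEblk, hEblk]
    rfl
  have hUU : (U : Op n)ᴴ * (U : Op n) = 1 := Matrix.mem_unitaryGroup_iff'.mp U.2
  have hUU' : (U : Op n) * (U : Op n)ᴴ = 1 := Matrix.mem_unitaryGroup_iff.mp U.2
  obtain ⟨g, hg1, hg⟩ := exists_fixed_vector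
    (fun a (e : Reg (C.w - n)) c => (B * (U : Op n)ᴴ) (glue C.w a e) c) (by
      intro φ hφ a b
      have hψ : star ((U : Op n)ᴴ *ᵥ φ) ⬝ᵥ ((U : Op n)ᴴ *ᵥ φ) = 1 := by
        rw [Matrix.star_mulVec, Matrix.dotProduct_mulVec, Matrix.vecMul_vecMul,
          Matrix.conjTranspose_conjTranspose, hUU', Matrix.vecMul_one, hφ]
      have := congrFun (congrFun (h _ hψ) a) b
      rw [Matrix.mulVec_mulVec, hUU', Matrix.one_mulVec] at this
      change keepFirst C.output_le (evolve Gate.op C.gates _) a b = _ at this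
      rw [hev, keepFirst_apply, conj_pureState, Matrix.mulVec_mulVec] at this
      exact this)
  refine ⟨g, hg1, fun N x y => ?_⟩
  have hS : ∀ x c, (B * (U : Op n)ᴴ) x c = if blk x 0 n = c then g (blk x n (C.w - n)) else 0 := by
    intro x c
    rw [← hg]
    exact congrArg (fun z => (B * (U : Op n)ᴴ) z c) ((splitReg ho).right_inv x).symm
  have hBN : B * N * Bᴴ = (B * (U : Op n)ᴴ) * ((U : Op n) * N * (U : Op n)ᴴ) *
      (B * (U : Op n)ᴴ)ᴴ := by
    rw [Matrix.conjTranspose_mul, Matrix.conjTranspose_conjTranspose]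
    calc B * N * Bᴴ = B * ((U : Op n)ᴴ * (U : Op n)) * N * ((U : Op n)ᴴ * (U : Op n)) * Bᴴ := by
          rw [hUU, Matrix.mul_one, Matrix.mul_one]
      _ = _ := by simp only [Matrix.mul_assoc]
  rw [hev, hBN, Matrix.mul_apply]
  simp only [Matrix.mul_apply (M := B * (U : Op n)ᴴ), Matrix.conjTranspose_apply (B * (U : Op n)ᴴ),
    hS, apply_ite star, star_zero, ite_mul, mul_ite, mul_zero, zero_mul, Finset.sum_ite_eq,
    Finset.mem_univ, if_true]
  ring

/-! ### The key generator -/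

theorem Circuit.run_mk_apply {i o w : ℕ} (hi : i ≤ w) (ho : o ≤ w) (l : List (Gate w)) (ρ : Op i)
    (a b : Reg o) : (⟨w, hi, ho, l⟩ : Circuit Gate i o).run ρ a b =
      ∑ e : Reg (w - o), evolve Gate.op l (padZero hi ρ) (glue w a e) (glue w b e) :=
  keepFirst_apply _ _ a b

/-- Hadamard gates on `κ` wires. -/
def keyGenCircuit (κ : ℕ) : Circuit Gate 0 κ where
  w := κ
  input_le := Nat.zero_le κ
  output_le := le_rfl
  gates := hBlock κ 0 κ

theorem keyGenCircuit_outcomeProb (κ : ℕ) (k : Reg κ) :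
    outcomeProb ((keyGenCircuit κ).run 1) k = ((2 : ℝ) ^ κ)⁻¹ := by
  have hκ : κ + (κ - κ) = κ := by omega
  have h1 : ∀ x y : Reg κ, evolve Gate.op (hBlock κ 0 κ) (padZero (Nat.zero_le κ) (1 : Op 0)) x y =
      ((2 : ℂ) ^ κ)⁻¹ := by
    intro x y
    rw [evolve_hBlock (by omega), padZero_eq, ind_pos, ind_pos, Matrix.one_apply,
      if_pos (Subsingleton.elim _ _)]
    · simp
    · intro j hj _
      rw [bit_clr, if_pos (by omega)]
    · intro j hj _
      rw [bit_clr, if_pos (by omega)]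
    · intro x y j _ hj h
      rw [padZero_eq]
      rcases h with h | h
      · rw [ind_neg (fun H => by simp [H j (by omega) (by omega)] at h)]
        ring
      · rw [ind_neg (p := ∀ j < κ, 0 ≤ j → bit y j = false)
          (fun H => by simp [H j (by omega) (by omega)] at h)]
        ring
  rw [outcomeProb, keyGenCircuit, Circuit.run_mk_apply, Finset.sum_congr rfl fun e _ => h1 _ _,
    Finset.sum_const, Finset.card_univ, show Fintype.card (Reg (κ - κ)) = 1 by simp, one_smul,
    show ((2 : ℂ) ^ κ)⁻¹ = (((2 : ℝ) ^ κ)⁻¹ : ℝ) by push_cast; rfl, Complex.ofReal_re]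

/-! ### The state generator -/

/-- `n - m` zeros followed by the `m` bits `ε`. -/
def tail {m : ℕ} (n : ℕ) (ε : Reg m) : Reg n := glue n (fun _ : Fin (n - m) => false) ε

theorem bit_tail {n m : ℕ} (hm : m ≤ n) (ε : Reg m) (j : ℕ) :
    bit (tail n ε) j = if j < n - m then false else bit ε (j - (n - m)) := by
  rw [tail, bit_glue]
  by_cases h1 : j < n
  · rw [if_pos h1]
    split_ifs with h2
    · rw [bit_of_lt _ h2]
    · rfl
  · rw [if_neg h1, if_neg (by omega), bit_of_le _ (by omega)]

theorem tail_injective {n m : ℕ} (hm : m ≤ n) : Function.Injective (tail (m := m) n) := by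
  intro ε ε' h
  refine bit_ext fun j hj => ?_
  have := congrArg (fun x => bit x (n - m + j)) h
  simpa [bit_tail hm] using this

theorem eq_tail_iff {n m : ℕ} (hm : m ≤ n) (x : Reg n) :
    (∀ i : Fin n, i.val < n - m → x i = false) ↔ ∃ ε : Reg m, tail n ε = x := by
  constructor
  · intro h
    refine ⟨blk x (n - m) m, bit_ext fun j hj => ?_⟩
    rw [bit_tail hm]
    split_ifs with h1
    · rw [bit_of_lt _ hj, h ⟨j, hj⟩ h1]
    · rw [bit_blk, if_pos (by omega), show n - m + (j - (n - m)) = j by omega]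
  · rintro ⟨ε, rfl⟩ i hi
    rw [← bit_fin (tail n ε) i, bit_tail hm, if_pos hi]

theorem taggedMixed_apply {n m : ℕ} (hm : m ≤ n) (x y : Reg n) :
    taggedMixed n m x y = ((2 : ℂ) ^ m)⁻¹ * ∑ ε : Reg m, basisState (tail n ε) x y := by
  have hS := eq_tail_iff hm
  have h1 : ∀ ε : Reg m, basisState (tail n ε) x y = ind (x = y) * ind (ε = ε ∧ x = tail n ε) := by
    intro ε
    rw [basisState_apply, ← ind_and, ← ind_and]
    refine ind_congr ⟨?_, ?_⟩
    · rintro ⟨rfl, rfl⟩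
      exact ⟨rfl, rfl, rfl⟩
    · rintro ⟨rfl, -, rfl⟩
      exact ⟨rfl, rfl⟩
  rw [Finset.sum_congr rfl fun ε _ => h1 ε, ← Finset.mul_sum]
  have h2 : ∑ ε : Reg m, ind (ε = ε ∧ x = tail n ε) =
      ind (∀ i : Fin n, i.val < n - m → x i = false) := by
    by_cases hx : ∃ ε : Reg m, tail n ε = x
    · obtain ⟨ε, rfl⟩ := hx
      rw [ind_pos ((hS _).2 ⟨ε, rfl⟩), Finset.sum_eq_single ε]
      · exact ind_pos ⟨rfl, rfl⟩
      · exact fun ε' _ hne => ind_neg fun h => hne (tail_injective hm h.2).symm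
      · simp
    · rw [ind_neg (fun h => hx ((hS _).1 h)), Finset.sum_eq_zero]
      exact fun ε _ => ind_neg fun h => hx ⟨ε, h.2.symm⟩
  rw [h2, taggedMixed, Matrix.diagonal_apply]
  by_cases hxy : x = y
  · rw [if_pos hxy, ite_eq_ind, ind_pos hxy]
    ring
  · rw [if_neg hxy, ind_neg hxy]
    ring

theorem vprdm_eq {n m : ℕ} (hm : m ≤ n) (V : Uni n) :
    vprdm V m = ((2 : ℂ) ^ m)⁻¹ •
      ∑ ε : Reg m, (V : Op n) * basisState (tail n ε) * (V : Op n)ᴴ := by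
  have : taggedMixed n m = ((2 : ℂ) ^ m)⁻¹ • ∑ ε : Reg m, basisState (tail n ε) := by
    ext x y
    rw [taggedMixed_apply hm, Matrix.smul_apply, Matrix.sum_apply, smul_eq_mul]
  rw [vprdm, this, Matrix.mul_smul, Matrix.smul_mul, Matrix.mul_sum, Matrix.sum_mul]

theorem evolve_ext {w : ℕ} {l : List (Gate w)} {σ τ : Op w} (h : ∀ x y, σ x y = τ x y) :
    evolve Gate.op l σ = evolve Gate.op l τ := by
  rw [show σ = τ from Matrix.ext h]

/-- Prepare a maximally mixed state on the last `m` of the `n` state wires and apply `G`. -/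
def stateGenCircuit (κ n m : ℕ) (G : Circuit Gate (κ + n) n) : Circuit Gate κ n where
  w := G.w + m
  input_le := by have := G.input_le; omega
  output_le := by have := G.output_le; omega
  gates := hBlock (G.w + m) G.w m ++ cnotBlock (G.w + m) G.w (κ + (n - m)) m ++
    G.gates.map (Gate.lift (Nat.le_add_right G.w m))

/-- Copying uniform bits onto the last `m` state wires and discarding the originals leaves a
maximally mixed state. For each value `ε` of the discarded bits, `G` acts on the basis state `tail n
ε`, and the trace averages over `ε`. The garbage of `G` is a unit vector and contributes the factor
one. -/
theorem stateGenCircuit_run {κ n m : ℕ} (hm : m ≤ n) (G : Circuit Gate (κ + n) n) (U : Uni n)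
    (k : Reg κ) (h : ∀ ψ : Reg n → ℂ, star ψ ⬝ᵥ ψ = 1 →
      G.run (tensor (basisState k) (pureState ψ)) = pureState ((U : Op n) *ᵥ ψ)) :
    (stateGenCircuit κ n m G).run (basisState k) = vprdm U m := by
  obtain ⟨g, hg1, hg⟩ := exists_garbage G U k h
  have hw := G.input_le
  ext a b
  rw [stateGenCircuit, Circuit.run_mk_apply, vprdm_eq hm]
  have key : ∀ (hi : κ ≤ G.w + m) (e : Reg (G.w + m - n)),
      evolve Gate.op (hBlock (G.w + m) G.w m ++ cnotBlock (G.w + m) G.w (κ + (n - m)) m ++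
        G.gates.map (Gate.lift (Nat.le_add_right G.w m)))
      (padZero hi (basisState k)) (glue (G.w + m) a e) (glue (G.w + m) b e) =
      ((2 : ℂ) ^ m)⁻¹ * (((U : Op n) * basisState (tail n (blk e (G.w - n) m)) *
        (U : Op n)ᴴ) a b * (g (blk e 0 (G.w - n)) * star (g (blk e 0 (G.w - n))))) := by
    intro hi e
    have hpre : ∀ a : Reg n, blk (blk (glue (G.w + m) a e) 0 G.w) 0 n = a := fun a => by
      rw [blk_blk _ (by omega)]
      exact blk_glue_fst (by omega) a e
    have hrest : ∀ a : Reg n, blk (blk (glue (G.w + m) a e) 0 G.w) n (G.w - n) = blk e 0 (G.w - n) :=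
      fun a => by
        rw [blk_blk _ (by omega)]
        refine bit_ext fun j hj => ?_
        rw [bit_blk, bit_blk, if_pos hj, if_pos hj, bit_glue, if_pos (by omega), if_neg (by omega)]
        congr 1
        omega
    have henv : ∀ a : Reg n, blk (glue (G.w + m) a e) G.w m = blk e (G.w - n) m := fun a => by
      refine bit_ext fun j hj => ?_
      rw [bit_blk, bit_blk, if_pos hj, if_pos hj, bit_glue, if_pos (by omega), if_neg (by omega)]
      congr 1
      omega
    obtain ⟨F, hF, hf, -⟩ := cnotBlock_actsAs (w := G.w + m) (a := G.w) (b := κ + (n - m)) (c := m)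
      (by omega) (by omega) (by omega)
    rw [evolve_append, evolve_append, evolve_lift, hF]
    -- Pulled back through the copying, the all-zero condition on the state wires says that they
    -- hold zeros followed by the bits of the environment.
    have hKP : ∀ (a : Reg n) (u : Reg G.w),
        KeyPad k κ (clr G.w m (F (overwrite u (glue (G.w + m) a e)))) ↔
        KeyPad k (κ + n) u ∧ blk u κ n = tail n (blk e (G.w - n) m) := by
      intro a u
      have hb : ∀ j, bit (clr G.w m (F (overwrite u (glue (G.w + m) a e)))) j =
          if G.w ≤ j ∧ j < G.w + m then false else
          if κ + (n - m) ≤ j ∧ j < κ + (n - m) + m then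
            xor (bit u j) (bit (blk e (G.w - n) m) (j - (κ + (n - m))))
          else bit u j := by
        intro j
        rw [bit_clr, hf]
        simp only [bit_overwrite (Nat.le_add_right G.w m)]
        split_ifs with h1 h2 h3 h4 h5 <;> first | rfl | omega | skip
        · rw [← henv a, bit_blk, if_pos (by omega)]
        · rw [bit_of_le u (by omega), bit_of_le _ (by omega)]
      rw [KeyPad, KeyPad, eq_blk_iff]
      simp only [hb, bit_tail hm]
      constructor
      · rintro ⟨h1, h2⟩
        refine ⟨⟨fun j hj => ?_, fun j hj hc => ?_⟩, fun j hj => ?_⟩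
        · have := h1 j hj
          rwa [if_neg (by omega), if_neg (by omega)] at this
        · have := h2 j (by omega) (by omega)
          rwa [if_neg (by omega), if_neg (by omega)] at this
        · have := h2 (κ + j) (by omega) (by omega)
          rw [if_neg (by omega)] at this
          split_ifs with h3
          · rwa [if_neg (by omega)] at this
          · rw [if_pos (by omega), show κ + j - (κ + (n - m)) = j - (n - m) by omega] at this
            simpa using this
      · rintro ⟨⟨h1, h2⟩, h3⟩
        refine ⟨fun j hj => ?_, fun j hj hc => ?_⟩
        · rw [if_neg (by omega), if_neg (by omega), h1 j hj]
        · split_ifs with h4 h5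
          · rfl
          · have := h3 (j - κ) (by omega)
            rw [if_neg (by omega), show κ + (j - κ) = j by omega] at this
            rw [this, show j - κ - (n - m) = j - (κ + (n - m)) by omega]
            simp
          · by_cases h6 : j < κ + n
            · have := h3 (j - κ) (by omega)
              rwa [if_pos (by omega), show κ + (j - κ) = j by omega] at this
            · exact h2 j (by omega) (by omega)
    rw [evolve_ext (τ := ((2 : ℂ) ^ m)⁻¹ • padZero G.input_le (tensor (basisState k)
      (basisState (tail n (blk e (G.w - n) m)))))]
    · rw [evolve_smul, Matrix.smul_apply, hg, hpre, hpre, hrest, hrest, smul_eq_mul]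
    · intro u v
      rw [Matrix.of_apply, Matrix.submatrix_apply, evolve_hBlock (by omega), padZero_basisState,
        Matrix.smul_apply, padZero_tensor_basisState, basisState_apply, ind_congr (hKP a u),
        ind_congr (hKP b v), ind_and, ind_and, smul_eq_mul]
      · ring
      · intro x y j h1 h2 hxy
        rw [padZero_basisState]
        rcases hxy with hx | hy
        · rw [ind_neg, zero_mul]
          intro H
          rw [H.2 j (by omega) (by omega)] at hx
          exact Bool.noConfusion hx
        · rw [ind_neg (p := KeyPad k κ y), mul_zero]
          intro H
          rw [H.2 j (by omega) (by omega)] at hy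
          exact Bool.noConfusion hy
  rw [Finset.sum_congr rfl fun e _ => key _ e, ← Finset.mul_sum]
  rw [sum_blk (show (G.w - n) + m = G.w + m - n by omega) (fun r ε =>
    ((U : Op n) * basisState (tail n ε) * (U : Op n)ᴴ) a b * (g r * star (g r)))]
  rw [Finset.sum_comm]
  simp only [← Finset.mul_sum, hg1, mul_one, Matrix.smul_apply, Matrix.sum_apply, smul_eq_mul]

/-! ### The verifier -/

theorem trace_basisState_mul {a : ℕ} (k : Reg a) (A : Op a) : (basisState k * A).trace = A k k := by
  rw [basisState, Matrix.trace_single_mul, one_smul]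

/-- The partial trace runs over registers of `n - (n - m)` bits, a length that is not definitionally
`m`. Both sums are compared with the sum over all registers whose first `n - m` bits vanish. -/
theorem vprdmVerify_eq {n m : ℕ} (hm : m ≤ n) (V : Uni n) (ρ : Op n) :
    vprdmVerify V m ρ =
      (∑ ε : Reg m, ((V : Op n)ᴴ * ρ * (V : Op n)) (tail n ε) (tail n ε)).re := by
  rw [vprdmVerify, trace_basisState_mul, keepFirst_apply]
  congr 1
  set σ := (V : Op n)ᴴ * ρ * (V : Op n)
  rw [← sum_ind_mul (fun ε : Reg m => tail n ε) (tail_injective hm)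
    (S := fun x : Reg n => ∀ i : Fin n, i.val < n - m → x i = false)
    (fun x => eq_tail_iff hm x) (fun x => σ x x)]
  symm
  refine sum_ind_mul (fun e : Reg (n - (n - m)) => glue n (fun _ : Fin (n - m) => false) e) ?_
    (fun x => ?_) (fun x => σ x x)
  · intro e e' h
    dsimp only at h
    rw [← blk_glue_snd (w := n) (by omega) (fun _ : Fin (n - m) => false) e, h, blk_glue_snd]
    omega
  · constructor
    · intro h
      refine ⟨blk x (n - m) (n - (n - m)), ?_⟩
      have : (fun _ : Fin (n - m) => false) = blk x 0 (n - m) := by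
        funext i
        rw [blk, zero_add, bit_of_lt _ (by omega), h _ (by simp)]
      rw [this]
      exact (splitReg (show (n - m) + (n - (n - m)) = n by omega)).right_inv x
    · rintro ⟨e, rfl⟩ i hi
      rw [← bit_fin (glue n _ e) i, bit_glue, if_pos i.2, if_pos hi, bit_of_lt _ hi]

/-- Write to wire `b + c` whether the wires `a, …, a + c - 1` are zero. -/
def chainBlock (W a b c : ℕ) : List (Gate W) :=
  (List.range c).flatMap fun i => xL W (a + i) ++ ccnotL W (a + i) (b + i) (b + i + 1)

/-- Wire `b + i` accumulates the conjunction of the first `i` tests, starting from a one on wire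
`b`: each wire under test is negated and a Toffoli gate adds it to the conjunction. The last two
clauses keep the induction going, as the next test wire and the next target must be untouched. -/
theorem chainBlock_actsAs {W a b c : ℕ} (hab : a + c ≤ b) (hb : b + c < W) :
    ∃ f f', ActsAs (chainBlock W a b c) f f' ∧ ∀ β : ℕ → Bool, β b = true →
      (∀ i, 1 ≤ i → i ≤ c → β (b + i) = false) →
      (f' β (b + c) = true ↔ ∀ i < c, β (a + i) = false) ∧
      (∀ j, a + c ≤ j → j < b → f' β j = β j) ∧ ∀ j, b + c < j → f' β j = β j := by
  induction c with
  | zero => exact ⟨_, _, ActsAs.nil, fun β h _ => by simp [h]⟩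
  | succ c ih =>
    obtain ⟨f, f', hf, H⟩ := ih (by omega) (by omega)
    have hc : chainBlock W a b (c + 1) = chainBlock W a b c ++
        (xL W (a + c) ++ ccnotL W (a + c) (b + c) (b + c + 1)) := by
      simp [chainBlock, List.range_succ, List.flatMap_append]
    refine ⟨_, _, hc ▸ hf.append ((xL_actsAs (by omega)).append (ccnotL_actsAs (by omega)
      (by omega) (by omega) (by omega) (by omega) (by omega))), ?_⟩
    · intro β h1 h2
      obtain ⟨H1, H2, H3⟩ := H β h1 fun i hi hi' => h2 i hi (by omega)
      refine ⟨?_, fun j hj hj' => ?_, fun j hj => ?_⟩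
      · simp only [Function.comp_apply]
        rw [if_pos (by omega), if_neg (by omega), if_pos trivial, if_neg (by omega),
          H3 _ (by omega), H2 (a + c) le_rfl (by omega), show b + c + 1 = b + (c + 1) by omega,
          h2 (c + 1) (by omega) le_rfl]
        simp only [Bool.false_xor, Bool.and_eq_true, Bool.not_eq_true', H1]
        constructor
        · rintro ⟨h3, h4⟩ i hi
          rcases Nat.lt_succ_iff_lt_or_eq.mp hi with h5 | h5
          · exact h4 i h5
          · rw [h5, h3]
        · exact fun h => ⟨h c (by omega), fun i hi => h i (by omega)⟩
      · simp only [Function.comp_apply]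
        rw [if_neg (by omega), if_neg (by omega), H2 j (by omega) hj']
      · simp only [Function.comp_apply]
        rw [if_neg (by omega), if_neg (by omega), H3 j (by omega)]

/-- Write to wire `0` whether the wires `a, …, a + c - 1` are zero. -/
def checkBlock (W a b c : ℕ) : List (Gate W) :=
  xL W b ++ chainBlock W a b c ++ swapL W 0 (b + c)

/-- The answer is exchanged with wire `0`, the output wire; the former content of that wire is
discarded along with the scratch wires. -/
theorem checkBlock_permutes {W a b c : ℕ} (hab : a + c ≤ b) (hb0 : 0 < b) (hb : b + c < W) :
    ∃ F, Permutes (checkBlock W a b c) F ∧ ∀ x : Reg W, (∀ j < W, b ≤ j → bit x j = false) →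
      (bit (F.symm x) 0 = true ↔ ∀ i < c, bit x (a + i) = false) := by
  obtain ⟨f, f', hf, H⟩ := chainBlock_actsAs hab hb
  obtain ⟨F, hF, -, hF'⟩ := ((xL_actsAs (t := b) (by omega)).append hf).append
    (swapL_actsAs (w := W) (a := 0) (b := b + c) (by omega) (by omega) (by omega))
  refine ⟨F, hF, fun x hx => ?_⟩
  rw [hF']
  simp only [Function.comp_apply, if_true]
  rw [(H _ (by simp [hx b (by omega) le_rfl]) fun i hi hi' => by
    rw [if_neg (by omega), hx _ (by omega) (by omega)]).1]
  refine forall_congr' fun i => forall_congr' fun hi => ?_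
  rw [if_neg (by omega)]

/-- Apply the inverse of the unitary that `G` implements to the state wires. -/
def uncomputeBlock {κ n : ℕ} (G : Circuit Gate (κ + n) n) (W : ℕ) (h : G.w ≤ W) : List (Gate W) :=
  swapBlock W κ G.w n ++ G.gates.map (Gate.lift h) ++ swapBlock W 0 G.w n ++
    (G.gates.reverse.map Gate.inv).map (Gate.lift h)

/-- Running `G` backwards on `ρ` requires the garbage vector of `G`. So `ρ` is first parked behind
the wires of `G`, and `G` runs on a zero state, leaving `U|0⟩` together with the garbage. Exchanging
`U|0⟩` for `ρ` gives exactly the image under `G` of `Uᴴ * ρ * U`, so the inverse gates return that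
operator with key and ancillas restored. The factor on the wires from `G.w` on is the parked `U|0⟩`.
-/
theorem uncomputeBlock_evolve {κ n W : ℕ} (G : Circuit Gate (κ + n) n) (hW : G.w + n ≤ W)
    (h : G.w ≤ W) (hi : κ + n ≤ W) (U : Uni n) (k : Reg κ)
    (hG : ∀ ψ : Reg n → ℂ, star ψ ⬝ᵥ ψ = 1 →
      G.run (tensor (basisState k) (pureState ψ)) = pureState ((U : Op n) *ᵥ ψ))
    (ρ : Op n) (x y : Reg W) :
    evolve Gate.op (uncomputeBlock G W h) (padZero hi (tensor (basisState k) ρ)) x y =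
      ind (∀ j < W, G.w + n ≤ j → bit x j = false) * ind (∀ j < W, G.w + n ≤ j → bit y j = false) *
      ((U : Op n) * basisState (fun _ : Fin n => false) * (U : Op n)ᴴ) (blk x G.w n) (blk y G.w n) *
      (ind (KeyPad k (κ + n) (blk x 0 G.w)) * ind (KeyPad k (κ + n) (blk y 0 G.w)) *
        ((U : Op n)ᴴ * ρ * (U : Op n)) (blk x κ n) (blk y κ n)) := by
  obtain ⟨g, hg1, hg⟩ := exists_garbage G U k hG
  have hw := G.input_le
  have hUU' : (U : Op n) * (U : Op n)ᴴ = 1 := Matrix.mem_unitaryGroup_iff.mp U.2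
  obtain ⟨F₁, hF₁, hf₁, -⟩ := swapBlock_actsAs (w := W) (a := κ) (b := G.w) (c := n)
    (by omega) (by omega)
  obtain ⟨F₂, hF₂, hf₂, -⟩ := swapBlock_actsAs (w := W) (a := 0) (b := G.w) (c := n)
    (by omega) (by omega)
  have hblk0 : ∀ x : Reg W, blk (blk x 0 G.w) 0 n = blk x 0 n := fun x => by
    rw [blk_blk _ (by omega)]
  have hblkn : ∀ x : Reg W, blk (blk x 0 G.w) n (G.w - n) = blk x n (G.w - n) := fun x => by
    rw [blk_blk _ (by omega), zero_add]
  have hblkκ : ∀ x : Reg W, blk (blk x 0 G.w) κ n = blk x κ n := fun x => by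
    rw [blk_blk _ (by omega), zero_add]
  let R : Reg W → Prop := fun x => ∀ j < W, G.w + n ≤ j → bit x j = false
  let ω : Op n := (U : Op n) * basisState (fun _ : Fin n => false) * (U : Op n)ᴴ
  -- after the forward computation on a fresh state
  have h2 : ∀ x y : Reg W, evolve Gate.op (swapBlock W κ G.w n ++ G.gates.map (Gate.lift h))
      (padZero hi (tensor (basisState k) ρ)) x y =
      (ind (R x) * ind (R y) * ρ (blk x G.w n) (blk y G.w n)) * (ω (blk x 0 n) (blk y 0 n) *
        (g (blk x n (G.w - n)) * star (g (blk y n (G.w - n))))) := by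
    intro x y
    have hb : ∀ (u : Reg G.w) (x : Reg W) j, bit (F₁ (overwrite u x)) j =
        if κ ≤ j ∧ j < κ + n then bit x (G.w + (j - κ)) else
        if G.w ≤ j ∧ j < G.w + n then bit u (κ + (j - G.w)) else
        if j < G.w then bit u j else bit x j := by
      intro u x j
      rw [hf₁]
      simp only [bit_overwrite h]
      split_ifs <;> first | rfl | omega
    have hKP : ∀ (u : Reg G.w) (x : Reg W), KeyPad k (κ + n) (F₁ (overwrite u x)) ↔
        (KeyPad k (κ + n) u ∧ blk u κ n = fun _ => false) ∧ R x := by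
      intro u x
      rw [eq_blk_iff]
      simp only [KeyPad, hb, R]
      constructor
      · rintro ⟨h1, h2⟩
        refine ⟨⟨⟨fun j hj => ?_, fun j hj hc => ?_⟩, fun j hj => ?_⟩, fun j hj hc => ?_⟩
        · have := h1 j hj
          rwa [if_neg (by omega), if_neg (by omega), if_pos (by omega)] at this
        · have := h2 j (by omega) hc
          rwa [if_neg (by omega), if_neg (by omega), if_pos (by omega)] at this
        · have := h2 (G.w + j) (by omega) (by omega)
          rwa [if_neg (by omega), if_pos (by omega), Nat.add_sub_cancel_left,
            ← bit_of_lt (fun _ : Fin n => false) hj] at this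
        · have := h2 j hj (by omega)
          rwa [if_neg (by omega), if_neg (by omega), if_neg (by omega)] at this
      · rintro ⟨⟨⟨h1, h2⟩, h3⟩, h4⟩
        refine ⟨fun j hj => ?_, fun j hj hc => ?_⟩
        · rw [if_neg (by omega), if_neg (by omega), if_pos (by omega), h1 j hj]
        · rw [if_neg (by omega)]
          split_ifs with h5 h6
          · rw [h3 _ (by omega), bit_of_lt _ (by omega)]
          · exact h2 j h6 hc
          · exact h4 j hj (by omega)
    have hblk : ∀ (u : Reg G.w) (x : Reg W), blk (F₁ (overwrite u x)) κ n = blk x G.w n := by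
      intro u x
      refine bit_ext fun j hj => ?_
      rw [bit_blk, bit_blk, if_pos hj, if_pos hj, hb, if_pos (by omega), Nat.add_sub_cancel_left]
    rw [evolve_append, evolve_lift, hF₁, evolve_ext (τ := (ind (R x) * ind (R y) *
      ρ (blk x G.w n) (blk y G.w n)) •
        padZero G.input_le (tensor (basisState k) (basisState (fun _ : Fin n => false))))]
    · rw [evolve_smul, Matrix.smul_apply, hg, hblk0, hblk0, hblkn, hblkn, smul_eq_mul]
    · intro u v
      rw [Matrix.of_apply, Matrix.submatrix_apply, padZero_tensor_basisState, Matrix.smul_apply,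
        padZero_tensor_basisState, basisState_apply, ind_congr (hKP u x), ind_congr (hKP v y),
        ind_and, ind_and, ind_and, ind_and, smul_eq_mul, hblk, hblk]
      ring
  have hb : ∀ (u : Reg G.w) (x : Reg W) j, bit (F₂ (overwrite u x)) j =
      if j < n then bit x (G.w + j) else
      if G.w ≤ j ∧ j < G.w + n then bit u (j - G.w) else
      if j < G.w then bit u j else bit x j := by
    intro u x j
    rw [hf₂]
    simp only [bit_overwrite h]
    split_ifs <;> first | rfl | omega | simp
  have e1 : ∀ (u : Reg G.w) (x : Reg W), blk (F₂ (overwrite u x)) G.w n = blk u 0 n := by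
    intro u x
    refine bit_ext fun j hj => ?_
    rw [bit_blk, bit_blk, if_pos hj, if_pos hj, hb, if_neg (by omega), if_pos (by omega),
      Nat.add_sub_cancel_left, zero_add]
  have e2 : ∀ (u : Reg G.w) (x : Reg W), blk (F₂ (overwrite u x)) 0 n = blk x G.w n := by
    intro u x
    refine bit_ext fun j hj => ?_
    rw [bit_blk, bit_blk, if_pos hj, if_pos hj, hb, if_pos (by omega), zero_add]
  have e3 : ∀ (u : Reg G.w) (x : Reg W),
      blk (F₂ (overwrite u x)) n (G.w - n) = blk u n (G.w - n) := by
    intro u x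
    refine bit_ext fun j hj => ?_
    rw [bit_blk, bit_blk, if_pos hj, if_pos hj, hb, if_neg (by omega), if_neg (by omega),
      if_pos (by omega)]
  have e4 : ∀ (u : Reg G.w) (x : Reg W), R (F₂ (overwrite u x)) ↔ R x := by
    intro u x
    refine forall_congr' fun j => forall_congr' fun hj => forall_congr' fun hj' => ?_
    rw [hb, if_neg (by omega), if_neg (by omega), if_neg (by omega)]
  rw [uncomputeBlock, evolve_append, evolve_append, evolve_lift, hF₂,
    evolve_ext (τ := (ind (R x) * ind (R y) * ω (blk x G.w n) (blk y G.w n)) •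
      evolve Gate.op G.gates (padZero G.input_le (tensor (basisState k)
        ((U : Op n)ᴴ * ρ * (U : Op n)))))]
  · rw [evolve_smul, evolve_inv, Matrix.smul_apply, padZero_tensor_basisState, smul_eq_mul,
      hblkκ, hblkκ]
  · intro u v
    have hρ : (U : Op n) * ((U : Op n)ᴴ * ρ * (U : Op n)) * (U : Op n)ᴴ = ρ := by
      calc _ = ((U : Op n) * (U : Op n)ᴴ) * ρ * ((U : Op n) * (U : Op n)ᴴ) := by
            simp only [Matrix.mul_assoc]
        _ = ρ := by rw [hUU', Matrix.one_mul, Matrix.mul_one]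
    rw [Matrix.of_apply, Matrix.submatrix_apply, h2, Matrix.smul_apply, hg, hρ, e1, e1, e2, e2,
      e3, e3, ind_congr (e4 u x), ind_congr (e4 v y), smul_eq_mul]
    ring

theorem sum_accept {W : ℕ} (hW : 1 ≤ W) (σ : Op W) :
    ∑ e : Reg (W - 1), σ (glue W accept e) (glue W accept e) =
      ∑ x, ind (bit x 0 = true) * σ x x := by
  rw [sum_splitReg (show 1 + (W - 1) = W by omega), sum_reg_one]
  have h : ∀ (a : Reg 1) (e : Reg (W - 1)), bit (glue W a e) 0 = a 0 := fun a e => by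
    rw [bit_glue, if_pos (by omega), if_pos (by omega), bit_of_lt _ (by omega)]
    rfl
  simp only [h]
  simp only [ind_pos, ind_neg, Bool.false_eq_true, not_false_eq_true, zero_mul,
    Finset.sum_const_zero, zero_add, one_mul]
  rfl

/-- Undo the unitary that `G` implements and test whether the first `n - m` state wires are zero. -/
def verCircuit (κ n m : ℕ) (G : Circuit Gate (κ + n) n) : Circuit Gate (κ + n) 1 where
  w := G.w + n + 1 + (n - m) + 1
  input_le := by have := G.input_le; omega
  output_le := by omega
  gates := uncomputeBlock G (G.w + n + 1 + (n - m) + 1) (by omega) ++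
    checkBlock (G.w + n + 1 + (n - m) + 1) κ (G.w + n + 1) (n - m)

/-- After uncomputation the state wires carry `Uᴴ * ρ * U` and the parked `U|0⟩⟨0|Uᴴ` is in a tensor
factor of trace one, so only the test of the first `n - m` state wires matters. -/
theorem verCircuit_outcomeProb {κ n m : ℕ} (hm : m ≤ n) (G : Circuit Gate (κ + n) n) (U : Uni n)
    (k : Reg κ) (hG : ∀ ψ : Reg n → ℂ, star ψ ⬝ᵥ ψ = 1 →
      G.run (tensor (basisState k) (pureState ψ)) = pureState ((U : Op n) *ᵥ ψ)) (ρ : Op n) :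
    outcomeProb ((verCircuit κ n m G).run (tensor (basisState k) ρ)) accept =
      vprdmVerify U m ρ := by
  have hw := G.input_le
  have hUU : (U : Op n)ᴴ * (U : Op n) = 1 := Matrix.mem_unitaryGroup_iff'.mp U.2
  rw [outcomeProb, verCircuit, Circuit.run_mk_apply, sum_accept (by omega), vprdmVerify_eq hm]
  congr 1
  set W := G.w + n + 1 + (n - m) + 1 with hW
  obtain ⟨F, hF, hF'⟩ := checkBlock_permutes (W := W) (a := κ)
    (b := G.w + n + 1) (c := n - m) (by omega) (by omega) (by omega)
  set ρ' := (U : Op n)ᴴ * ρ * (U : Op n) with hρ'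
  set ω := (U : Op n) * basisState (fun _ : Fin n => false) * (U : Op n)ᴴ with hω
  have htr : ∑ c, ω c c = 1 := by
    change ω.trace = 1
    rw [hω, Matrix.trace_mul_comm, ← Matrix.mul_assoc, hUU, Matrix.one_mul, ← Matrix.mul_one
      (basisState _), trace_basisState_mul, Matrix.one_apply_eq]
  let φ : Reg n × Reg n → Reg W := fun p => glue W (glue G.w k p.1) p.2
  have hφ : ∀ p j, bit (φ p) j = if j < G.w then (if j < κ then bit k j else bit p.1 (j - κ))
      else bit p.2 (j - G.w) := by
    intro p j
    simp only [φ, bit_glue]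
    split_ifs <;> first | rfl | omega | rw [bit_of_le _ (by omega)]
  have hφκ : ∀ p, blk (φ p) κ n = p.1 := fun p => bit_ext fun j hj => by
    rw [bit_blk, if_pos hj, hφ, if_pos (by omega), if_neg (by omega), Nat.add_sub_cancel_left]
  have hφw : ∀ p, blk (φ p) G.w n = p.2 := fun p => bit_ext fun j hj => by
    rw [bit_blk, if_pos hj, hφ, if_neg (by omega), Nat.add_sub_cancel_left]
  have hφinj : Function.Injective φ := fun p q hpq =>
    Prod.ext (by rw [← hφκ p, hpq, hφκ]) (by rw [← hφw p, hpq, hφw])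
  have hφS : ∀ x : Reg W, (KeyPad k (κ + n) (blk x 0 G.w) ∧
      ∀ j < W, G.w + n ≤ j → bit x j = false) ↔ ∃ p, φ p = x := by
    intro x
    constructor
    · rintro ⟨⟨h1, h2⟩, h3⟩
      refine ⟨(blk x κ n, blk x G.w n), bit_ext fun j hj => ?_⟩
      rw [hφ]
      split_ifs with h4 h5
      · rw [← h1 j h5, bit_blk, if_pos h4, zero_add]
      · have := h2 j h4
        rw [bit_blk, if_pos h4, zero_add] at this
        rw [bit_blk]
        split_ifs with h6
        · congr 1; omega
        · rw [this (by omega)]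
      · rw [bit_blk]
        split_ifs with h6
        · congr 1; omega
        · rw [h3 j hj (by omega)]
    · rintro ⟨p, rfl⟩
      refine ⟨⟨fun j hj => ?_, fun j hj hc => ?_⟩, fun j hj hc => ?_⟩
      · rw [bit_blk, if_pos (by omega), zero_add, hφ, if_pos (by omega), if_pos hj]
      · rw [bit_blk, if_pos hj, zero_add, hφ, if_pos hj, if_neg (by omega), bit_of_le _ (by omega)]
      · rw [hφ, if_neg (by omega), bit_of_le _ (by omega)]
  -- Reindexing by the permutation of the check turns the accept bit into a condition on the
  -- register before the check.
  rw [← F.symm.sum_comp]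
  have step : ∀ x : Reg W, ind (bit (F.symm x) 0 = true) * evolve Gate.op
      (uncomputeBlock G W (by omega) ++ checkBlock W κ (G.w + n + 1) (n - m))
      (padZero (by omega) (tensor (basisState k) ρ)) (F.symm x) (F.symm x) =
      ind (KeyPad k (κ + n) (blk x 0 G.w) ∧ ∀ j < W, G.w + n ≤ j → bit x j = false) *
        (ind (∀ i < n - m, bit (blk x κ n) i = false) *
          (ρ' (blk x κ n) (blk x κ n) * ω (blk x G.w n) (blk x G.w n))) := by
    intro x
    rw [evolve_append, hF, Matrix.submatrix_apply, Equiv.apply_symm_apply,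
      uncomputeBlock_evolve G (by omega) (by omega) (by omega) U k hG, ind_and]
    by_cases hR : ∀ j < W, G.w + n ≤ j → bit x j = false
    · rw [ind_congr (hF' x fun j hj hj' => hR j hj (by omega)), ind_pos hR]
      have : (∀ i < n - m, bit x (κ + i) = false) ↔
          ∀ i < n - m, bit (blk x κ n) i = false := by
        refine forall_congr' fun i => forall_congr' fun hi => ?_
        rw [bit_blk, if_pos (by omega)]
      rw [ind_congr this]
      by_cases hK : KeyPad k (κ + n) (blk x 0 G.w)
      · rw [ind_pos hK]; ring
      · rw [ind_neg hK]; ring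
    · rw [ind_neg hR]; ring
  rw [Finset.sum_congr rfl fun x _ => step x, sum_ind_mul φ hφinj hφS, Fintype.sum_prod_type]
  simp only [hφκ, hφw]
  have hsum : ∀ b : Reg n, ∑ c, ind (∀ i < n - m, bit b i = false) * (ρ' b b * ω c c) =
      ind (∀ i < n - m, bit b i = false) * ρ' b b := by
    intro b
    rw [← Finset.mul_sum, ← Finset.mul_sum, htr, mul_one]
  rw [Finset.sum_congr rfl fun b _ => hsum b]
  refine sum_ind_mul (fun ε : Reg m => tail n ε) (tail_injective hm) (fun x => ?_)
    (fun x => ρ' x x)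
  rw [← eq_tail_iff hm]
  constructor
  · exact fun H i hi => by rw [← bit_fin x i]; exact H i hi
  · exact fun H i hi => by rw [bit_of_lt _ (by omega)]; exact H _ hi

/-! ### Running an adversary and verifying its output -/

/-- The adversary `A` gets the first `N` wires, its output is measured, and the verifier `V` checks
it against the remaining `n` wires. -/
def attackCircuit {N n κ : ℕ} (I : ℕ) (hI : I = N + n) (A : Circuit Gate N κ)
    (V : Circuit Gate (κ + n) 1) : Circuit Gate I 1 where
  w := κ + (A.w + V.w) + (A.w + V.w) + κ
  input_le := by have := A.input_le; have := V.input_le; omega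
  output_le := by have := V.output_le; omega
  gates := swapBlock _ N (κ + (A.w + V.w)) n ++ A.gates.map (Gate.lift (by omega)) ++
    cnotBlock _ 0 (κ + (A.w + V.w) + (A.w + V.w)) κ ++
    swapBlock _ κ (κ + (A.w + V.w)) (A.w + V.w) ++ V.gates.map (Gate.lift (by omega))

/-- Deferred measurement: the adversary's answer is copied to `κ` wires at the far end, and
discarding these makes the answer classical. The `n` wires meant for the verifier are parked at `B`
while `A` runs. The second exchange clears everything behind the answer and brings the parked wires
to position `κ`, as the verifier expects. -/
theorem attackCircuit_run {N n κ I : ℕ} (hI : I = N + n) (A : Circuit Gate N κ)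
    (V : Circuit Gate (κ + n) 1) (σ : Op I) (α : Op N) (β : Op n)
    (hσ : ∀ x y, σ x y = α (blk x 0 N) (blk y 0 N) * β (blk x N n) (blk y N n)) :
    (attackCircuit I hI A V).run σ accept accept =
      ∑ k, A.run α k k * V.run (tensor (basisState k) β) accept accept := by
  have hA := A.input_le
  have hA' := A.output_le
  have hV := V.input_le
  have hV' := V.output_le
  rw [attackCircuit, Circuit.run_mk_apply, sum_accept (by omega)]
  set r := A.w + V.w with hr
  set B := κ + r with hB
  set D := B + r with hD
  set W := D + κ with hW
  obtain ⟨F₁, hF₁, hf₁, -⟩ := swapBlock_actsAs (w := W) (a := N) (b := B) (c := n)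
    (by omega) (by omega)
  obtain ⟨F₃, hF₃, hf₃, -⟩ := cnotBlock_actsAs (w := W) (a := 0) (b := D) (c := κ)
    (by omega) (by omega) (by omega)
  obtain ⟨F₄, hF₄, hf₄, -⟩ := swapBlock_actsAs (w := W) (a := κ) (b := B) (c := r)
    (by omega) (by omega)
  have hAW : A.w ≤ W := by omega
  have hVW : V.w ≤ W := by omega
  have hIW : I ≤ W := by omega
  let R : Reg W → Prop := fun x => ∀ j < W, A.w ≤ j → ¬(B ≤ j ∧ j < B + n) → bit x j = false
  -- after the adversary has run
  have h2 : ∀ x y : Reg W, evolve Gate.op (swapBlock W N B n ++ A.gates.map (Gate.lift hAW))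
      (padZero hIW σ) x y = (ind (R x) * ind (R y) * β (blk x B n) (blk y B n)) *
        evolve Gate.op A.gates (padZero A.input_le α) (blk x 0 A.w) (blk y 0 A.w) := by
    intro x y
    have hb : ∀ (u : Reg A.w) (x : Reg W) j, bit (F₁ (overwrite u x)) j =
        if N ≤ j ∧ j < N + n then bit x (B + (j - N)) else
        if B ≤ j ∧ j < B + n then bit (overwrite u x) (N + (j - B)) else
        bit (overwrite u x) j := by
      intro u x j
      rw [hf₁]
      simp only [bit_overwrite hAW]
      split_ifs <;> first | rfl | omega
    have hz : ∀ (u : Reg A.w) (x : Reg W),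
        (∀ j < W, I ≤ j → bit (F₁ (overwrite u x)) j = false) ↔
        (∀ j < A.w, N ≤ j → bit u j = false) ∧ R x := by
      intro u x
      simp only [hb]
      constructor
      · intro H
        have H' : ∀ j < W, N ≤ j → ¬(B ≤ j ∧ j < B + n) → bit (overwrite u x) j = false := by
          intro j hj hN hjB
          by_cases hjI : I ≤ j
          · have := H j hj hjI
            rwa [if_neg (by omega), if_neg hjB] at this
          · have := H (B + (j - N)) (by omega) (by omega)
            rwa [if_neg (by omega), if_pos (by omega), show N + (B + (j - N) - B) = j by omega]
              at this
        refine ⟨fun j hj hN => ?_, fun j hj hjA hjB => ?_⟩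
        · have := H' j (by omega) hN (by omega)
          rwa [bit_overwrite hAW, if_pos hj] at this
        · have := H' j hj (by omega) hjB
          rwa [bit_overwrite hAW, if_neg (by omega)] at this
      · rintro ⟨h1, h2⟩ j hj hjI
        have H' : ∀ j < W, N ≤ j → ¬(B ≤ j ∧ j < B + n) → bit (overwrite u x) j = false := by
          intro j hj hN hjB
          rw [bit_overwrite hAW]
          split_ifs with h3
          · exact h1 j h3 hN
          · exact h2 j hj (by omega) hjB
        rw [if_neg (by omega)]
        split_ifs with h3
        · exact H' _ (by omega) (by omega) (by omega)
        · exact H' _ hj (by omega) h3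
    have e1 : ∀ (u : Reg A.w) (x : Reg W), blk (blk (F₁ (overwrite u x)) 0 I) 0 N = blk u 0 N := by
      intro u x
      rw [blk_blk _ (by omega)]
      refine bit_ext fun j hj => ?_
      rw [bit_blk, bit_blk, if_pos hj, if_pos hj, hb, if_neg (by omega), if_neg (by omega),
        bit_overwrite hAW, if_pos (by omega)]
    have e2 : ∀ (u : Reg A.w) (x : Reg W), blk (blk (F₁ (overwrite u x)) 0 I) N n = blk x B n := by
      intro u x
      rw [blk_blk _ (by omega)]
      refine bit_ext fun j hj => ?_
      rw [bit_blk, bit_blk, if_pos hj, if_pos hj, hb, if_pos (by omega)]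
      congr 1
      omega
    rw [evolve_append, evolve_lift, hF₁, evolve_ext (τ := (ind (R x) * ind (R y) *
      β (blk x B n) (blk y B n)) • padZero A.input_le α)]
    · rw [evolve_smul, Matrix.smul_apply, smul_eq_mul]
    · intro u v
      rw [Matrix.of_apply, Matrix.submatrix_apply, padZero_eq, hσ, Matrix.smul_apply, padZero_eq,
        ind_congr (hz u x), ind_congr (hz v y), ind_and, ind_and, smul_eq_mul, e1, e1, e2, e2]
      ring
  -- the verifier sees a classical key
  let R' : Reg W → Prop := fun z => (∀ j < B, V.w ≤ j → bit z j = false) ∧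
    ∀ j < D, B + (A.w - κ) ≤ j → bit z j = false
  let αA := evolve Gate.op A.gates (padZero A.input_le α)
  have key : ∀ z : Reg W, evolve Gate.op (swapBlock W N B n ++ A.gates.map (Gate.lift hAW) ++
      cnotBlock W 0 D κ ++ swapBlock W κ B r ++ V.gates.map (Gate.lift hVW)) (padZero hIW σ) z z =
      ind (R' z) * αA (glue A.w (blk z D κ) (blk z B (A.w - κ)))
        (glue A.w (blk z D κ) (blk z B (A.w - κ))) *
        evolve Gate.op V.gates (padZero V.input_le (tensor (basisState (blk z D κ)) β))
          (blk z 0 V.w) (blk z 0 V.w) := by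
    intro z
    have hb : ∀ (u : Reg V.w) j, bit (F₃ (F₄ (overwrite u z))) j =
        if κ ≤ j ∧ j < B then bit z (B + (j - κ)) else
        if B ≤ j ∧ j < D then bit (overwrite u z) (κ + (j - B)) else
        if D ≤ j ∧ j < W then xor (bit z j) (bit u (j - D)) else bit (overwrite u z) j := by
      intro u j
      rw [hf₃]
      simp only [hf₄, bit_overwrite hVW]
      split_ifs <;> first | rfl | omega | skip
      congr 2
      omega
    -- The record wires from `D` on start in zero, so the key wires must agree with the record. Row
    -- and column share the record, which removes coherence between different keys.
    have hR : ∀ u : Reg V.w, R (F₃ (F₄ (overwrite u z))) ↔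
        KeyPad (blk z D κ) (κ + n) u ∧ R' z := by
      intro u
      simp only [R, KeyPad, R', hb]
      constructor
      · intro H
        refine ⟨⟨fun j hj => ?_, fun j hj hc => ?_⟩, fun j hj hc => ?_, fun j hj hc => ?_⟩
        · have := H (D + j) (by omega) (by omega) (by omega)
          rw [if_neg (by omega), if_neg (by omega), if_pos (by omega),
            Nat.add_sub_cancel_left] at this
          rw [bit_blk, if_pos hj]
          revert this
          cases bit z (D + j) <;> cases bit u j <;> simp
        · have := H (B + (j - κ)) (by omega) (by omega) (by omega)
          rwa [if_neg (by omega), if_pos (by omega), show κ + (B + (j - κ) - B) = j by omega,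
            bit_overwrite hVW, if_pos hj] at this
        · have := H (B + (j - κ)) (by omega) (by omega) (by omega)
          rwa [if_neg (by omega), if_pos (by omega), show κ + (B + (j - κ) - B) = j by omega,
            bit_overwrite hVW, if_neg (by omega)] at this
        · have := H (κ + (j - B)) (by omega) (by omega) (by omega)
          rwa [if_pos (by omega), show B + (κ + (j - B) - κ) = j by omega] at this
      · rintro ⟨⟨h1, h2⟩, h3, h4⟩ j hj hjA hjB
        split_ifs with h5 h6 h7
        · exact h4 _ (by omega) (by omega)
        · rw [bit_overwrite hVW]
          split_ifs with h8
          · exact h2 _ h8 (by omega)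
          · exact h3 _ (by omega) (by omega)
        · rw [h1 _ (by omega), bit_blk, if_pos (by omega), show D + (j - D) = j by omega,
            Bool.xor_self]
        · omega
    have hRi : ∀ u : Reg V.w, ind (R (F₃ (F₄ (overwrite u z)))) =
        ind (KeyPad (blk z D κ) (κ + n) u) * ind (R' z) :=
      fun u => (ind_congr (hR u)).trans (ind_and _ _)
    have e1 : ∀ u : Reg V.w, blk (F₃ (F₄ (overwrite u z))) B n = blk u κ n := by
      intro u
      refine bit_ext fun j hj => ?_
      rw [bit_blk, bit_blk, if_pos hj, if_pos hj, hb, if_neg (by omega), if_pos (by omega),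
        Nat.add_sub_cancel_left, bit_overwrite hVW, if_pos (by omega)]
    have e2 : ∀ u : Reg V.w, KeyPad (blk z D κ) (κ + n) u →
        blk (F₃ (F₄ (overwrite u z))) 0 A.w = glue A.w (blk z D κ) (blk z B (A.w - κ)) := by
      rintro u ⟨h1, -⟩
      refine bit_ext fun j hj => ?_
      rw [bit_blk, if_pos hj, zero_add, hb, bit_glue, if_pos hj]
      split_ifs with h3 h4 h5 h6 h7 h8 <;> first | omega | skip
      · rw [bit_blk, if_pos (by omega)]
      · rw [bit_overwrite hVW, if_pos (by omega), h1 j ‹_›]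
    rw [evolve_append, evolve_lift, evolve_append, hF₄, evolve_append, hF₃,
      evolve_ext (τ := (ind (R' z) * αA (glue A.w (blk z D κ) (blk z B (A.w - κ)))
        (glue A.w (blk z D κ) (blk z B (A.w - κ)))) •
        padZero V.input_le (tensor (basisState (blk z D κ)) β))]
    · rw [evolve_smul, Matrix.smul_apply, smul_eq_mul]
    · intro u v
      rw [Matrix.of_apply, Matrix.submatrix_apply, Matrix.submatrix_apply, h2, hRi u, hRi v,
        e1, e1, Matrix.smul_apply, padZero_tensor_basisState, smul_eq_mul]
      by_cases hu : KeyPad (blk z D κ) (κ + n) u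
      · by_cases hv : KeyPad (blk z D κ) (κ + n) v
        · rw [e2 u hu, e2 v hv]
          by_cases hz : R' z
          · rw [ind_pos hz]; ring
          · rw [ind_neg hz]; ring
        · rw [ind_neg hv]; ring
      · rw [ind_neg hu]; ring
  let φ : Reg κ × Reg (A.w - κ) × Reg V.w → Reg W := fun p =>
    glue W (glue D (glue B p.2.2 (fun i : Fin 0 => i.elim0)) p.2.1) p.1
  have hφ : ∀ p j, bit (φ p) j = if j < V.w then bit p.2.2 j else if j < B then false else
      if j < D then bit p.2.1 (j - B) else bit p.1 (j - D) := by
    intro p j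
    simp only [φ, bit_glue]
    split_ifs <;> first | rfl | omega | skip
    · rw [bit_of_le _ (by omega)]

  have hφ1 : ∀ p, blk (φ p) D κ = p.1 := fun p => bit_ext fun j hj => by
    rw [bit_blk, if_pos hj, hφ, if_neg (by omega), if_neg (by omega), if_neg (by omega),
      Nat.add_sub_cancel_left]
  have hφ2 : ∀ p, blk (φ p) B (A.w - κ) = p.2.1 := fun p => bit_ext fun j hj => by
    rw [bit_blk, if_pos hj, hφ, if_neg (by omega), if_neg (by omega), if_pos (by omega),
      Nat.add_sub_cancel_left]
  have hφ3 : ∀ p, blk (φ p) 0 V.w = p.2.2 := fun p => bit_ext fun j hj => by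
    rw [bit_blk, if_pos hj, hφ, if_pos (by omega), zero_add]
  have hφinj : Function.Injective φ := fun p q hpq => Prod.ext (by rw [← hφ1 p, hpq, hφ1])
    (Prod.ext (by rw [← hφ2 p, hpq, hφ2]) (by rw [← hφ3 p, hpq, hφ3]))
  have hφS : ∀ z : Reg W, R' z ↔ ∃ p, φ p = z := by
    intro z
    constructor
    · rintro ⟨h1, h2⟩
      refine ⟨(blk z D κ, blk z B (A.w - κ), blk z 0 V.w), bit_ext fun j hj => ?_⟩
      rw [hφ]
      split_ifs with h3 h4 h5
      · rw [bit_blk, if_pos h3, zero_add]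
      · rw [h1 j h4 (by omega)]
      · rw [bit_blk]
        split_ifs with h6
        · congr 1; omega
        · rw [h2 j h5 (by omega)]
      · rw [bit_blk, if_pos (by omega)]
        congr 1; omega
    · rintro ⟨p, rfl⟩
      refine ⟨fun j hj hc => ?_, fun j hj hc => ?_⟩
      · rw [hφ, if_neg (by omega), if_pos hj]
      · rw [hφ, if_neg (by omega), if_neg (by omega), if_pos hj, bit_of_le _ (by omega)]
  have step : ∀ z : Reg W, ind (bit z 0 = true) * evolve Gate.op (swapBlock W N B n ++
      A.gates.map (Gate.lift hAW) ++ cnotBlock W 0 D κ ++ swapBlock W κ B r ++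
      V.gates.map (Gate.lift hVW)) (padZero hIW σ) z z =
      ind (R' z) * (ind (bit (blk z 0 V.w) 0 = true) *
        (αA (glue A.w (blk z D κ) (blk z B (A.w - κ)))
        (glue A.w (blk z D κ) (blk z B (A.w - κ))) *
        evolve Gate.op V.gates (padZero V.input_le (tensor (basisState (blk z D κ)) β))
          (blk z 0 V.w) (blk z 0 V.w))) := by
    intro z
    rw [key, bit_blk, if_pos (by omega), zero_add]
    ring
  rw [Finset.sum_congr rfl fun z _ => step z, sum_ind_mul φ hφinj hφS, Fintype.sum_prod_type]
  simp only [hφ1, hφ2, hφ3]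
  refine Finset.sum_congr rfl fun k _ => ?_
  have hArun : A.run α k k = ∑ γ : Reg (A.w - κ), αA (glue A.w k γ) (glue A.w k γ) :=
    Circuit.run_mk_apply A.input_le A.output_le A.gates α k k
  have hVrun : V.run (tensor (basisState k) β) accept accept = ∑ y : Reg V.w, ind (bit y 0 = true) *
      evolve Gate.op V.gates (padZero V.input_le (tensor (basisState k) β)) y y :=
    (Circuit.run_mk_apply V.input_le V.output_le V.gates _ accept accept).trans
      (sum_accept V.output_le _)
  rw [hArun, hVrun, Finset.sum_mul_sum, Fintype.sum_prod_type]
  refine Finset.sum_congr rfl fun γ _ => Finset.sum_congr rfl fun y _ => ?_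
  ring

/-! ### Copies of the state from queries to the unitary -/

theorem ind_forall {ι : Type*} [Fintype ι] (P : ι → Prop) : ind (∀ i, P i) = ∏ i, ind (P i) := by
  by_cases h : ∀ i, P i
  · rw [ind_pos h, Finset.prod_eq_one fun i _ => ind_pos (h i)]
  · rw [ind_neg h]
    obtain ⟨i, hi⟩ := not_forall.mp h
    rw [Finset.prod_eq_zero (Finset.mem_univ i) (ind_neg hi)]

theorem mul_add_lt {t c n i : ℕ} (hc : c < t) (hi : i < n) : c * n + i < t * n := by
  have := Nat.mul_le_mul_right n (Nat.succ_le_of_lt hc)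
  rw [Nat.succ_mul] at this
  omega

theorem blk_eq_finProd {t n : ℕ} (x : Reg (t * n)) (j : Fin t) :
    (fun i : Fin n => x (finProdFinEquiv (j, i))) = blk x (j * n) n := by
  funext i
  rw [blk, ← bit_fin x]
  congr 1
  simp only [finProdFinEquiv_apply_val]
  ring

/-- The `j`-th blocks of a register. -/
def blocksEquiv (t m : ℕ) : Reg (t * m) ≃ (Fin t → Reg m) :=
  (Equiv.arrowCongr finProdFinEquiv.symm (Equiv.refl Bool)).trans (Equiv.curry _ _ _)

theorem blocksEquiv_apply {t m : ℕ} (ε : Reg (t * m)) (j : Fin t) :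
    blocksEquiv t m ε j = blk ε (j * m) m := (blk_eq_finProd ε j).symm ▸ rfl

/-- The tensor product of the columns `e 0, e 1, …` of an operator. -/
noncomputable def columnState {n t : ℕ} (V : Op n) (e : Fin t → Reg n) : Reg (t * n) → ℂ :=
  fun x => ∏ j : Fin t, V (blk x (j * n) n) (e j)

theorem mul_basisState_mul_apply {n : ℕ} (V : Op n) (k a b : Reg n) :
    (V * basisState k * Vᴴ) a b = V a k * star (V b k) := by
  rw [Matrix.mul_apply]
  have : ∀ c, (V * basisState k) a c * Vᴴ c b = ind (c = k) * (V a k * star (V b c)) := by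
    intro c
    rw [Matrix.mul_apply, Finset.sum_mul]
    rw [Finset.sum_congr rfl fun d _ => show V a d * basisState k d c * Vᴴ c b =
      ind (d = k) * (ind (c = k) * (V a d * star (V b c))) by
        rw [basisState_apply, Matrix.conjTranspose_apply]; ring]
    rw [sum_ind_eq]
  rw [Finset.sum_congr rfl fun c _ => this c, sum_ind_eq]

/-- Distributing the product of `t` averages over `Reg m` gives one average over tuples. The Haar
estimates are then carried out one tuple of columns at a time. -/
theorem tensorPow_vprdm {n m : ℕ} (hm : m ≤ n) (V : Uni n) (t : ℕ) :
    tensorPow (vprdm V m) t = ((2 : ℂ) ^ (t * m))⁻¹ •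
      ∑ e : Fin t → Reg m, pureState (columnState (V : Op n) fun j => tail n (e j)) := by
  ext x y
  rw [tensorPow, Matrix.of_apply, Matrix.smul_apply, Matrix.sum_apply, smul_eq_mul, vprdm_eq hm]
  simp only [Matrix.smul_apply, Matrix.sum_apply, smul_eq_mul, mul_basisState_mul_apply,
    blk_eq_finProd]
  rw [Finset.prod_mul_distrib, Finset.prod_const, Finset.card_univ, Fintype.card_fin, inv_pow,
    ← pow_mul, mul_comm m t, Finset.prod_univ_sum, Fintype.piFinset_univ]
  congr 1
  refine Finset.sum_congr rfl fun e _ => ?_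
  rw [pureState, Matrix.vecMulVec_apply, Pi.star_apply, columnState, columnState, star_prod,
    ← Finset.prod_mul_distrib]

/-- Copy the bits of the wires from `s` on to the last `m` wires of each of `t` blocks of `n`
wires. -/
def copyBlock (W n m s t : ℕ) : List (Gate W) :=
  (List.range t).flatMap fun c => cnotBlock W (s + c * m) (c * n + (n - m)) m

theorem copyBlock_actsAs {W n m s t : ℕ} (hm : m ≤ n) (hs : t * n ≤ s) (hW : s + t * m ≤ W) :
    ∃ f f', ActsAs (copyBlock W n m s t) f f' ∧ ∀ β : ℕ → Bool,
      (∀ c < t, ∀ i < m, f β (c * n + (n - m) + i) =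
        xor (β (c * n + (n - m) + i)) (β (s + c * m + i))) ∧
      (∀ c < t, ∀ i < n - m, f β (c * n + i) = β (c * n + i)) ∧
      ∀ j, t * n ≤ j → f β j = β j := by
  induction t with
  | zero => exact ⟨_, _, ActsAs.nil, fun β => by simp⟩
  | succ t ih =>
    rw [Nat.succ_mul] at hs hW
    obtain ⟨f, f', hf, H⟩ := ih (by omega) (by omega)
    have hc : copyBlock W n m s (t + 1) = copyBlock W n m s t ++
        cnotBlock W (s + t * m) (t * n + (n - m)) m := by
      simp [copyBlock, List.range_succ, List.flatMap_append]
    refine ⟨_, _, hc ▸ hf.append (cnotBlock_actsAs (by omega) (by omega) (by omega)), fun β => ?_⟩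
    obtain ⟨h1, h2, h3⟩ := H fun j => if t * n + (n - m) ≤ j ∧ j < t * n + (n - m) + m then
        xor (β j) (β (s + t * m + (j - (t * n + (n - m))))) else β j
    refine ⟨fun c hc i hi => ?_, fun c hc i hi => ?_, fun j hj => ?_⟩
    · simp only [Function.comp_apply]
      rcases Nat.lt_succ_iff_lt_or_eq.mp hc with h | h
      · rw [h1 c h i hi]
        have := mul_add_lt h (show n - m + i < n by omega)
        rw [if_neg (by omega), if_neg (by omega)]
      · subst h
        rw [h3 _ (by omega), if_pos (by omega), Nat.add_sub_cancel_left]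
    · simp only [Function.comp_apply]
      rcases Nat.lt_succ_iff_lt_or_eq.mp hc with h | h
      · rw [h2 c h i hi]
        have := mul_add_lt h (show i < n by omega)
        rw [if_neg (by omega)]
      · subst h
        rw [h3 _ (by omega), if_neg (by omega)]
    · simp only [Function.comp_apply]
      rw [Nat.succ_mul] at hj
      rw [h3 _ (by omega), if_neg (by omega)]

/-- A query on the `n` wires from `s` on. -/
def queryL (n W s : ℕ) : List (OracleGate n W) :=
  if h : s + n ≤ W then
    [OracleGate.query ⟨fun i => ⟨s + i, by omega⟩, fun i j hij => by simpa [Fin.ext_iff] using hij⟩]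
  else []

theorem evolve_pureState {w : ℕ} {α : Type} (op : α → Op w) (l : List α) (A : Reg w → ℂ) :
    evolve op l (pureState A) = pureState (totalOp op l *ᵥ A) := conj_pureState _ _

/-- The register `x` with its bits from `s` on replaced by `u`. -/
def replaceBlk {n w : ℕ} (s : ℕ) (u : Reg n) (x : Reg w) : Reg w := fun j =>
  if s ≤ (j : ℕ) ∧ (j : ℕ) < s + n then bit u (j - s) else x j

theorem bit_replaceBlk {n w s : ℕ} (h : s + n ≤ w) (u : Reg n) (x : Reg w) (j : ℕ) :
    bit (replaceBlk s u x) j = if s ≤ j ∧ j < s + n then bit u (j - s) else bit x j := by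
  by_cases hj : j < w
  · rw [bit_of_lt _ hj, bit_of_lt x hj, replaceBlk]
  · rw [bit_of_le _ (by omega), if_neg (by omega), bit_of_le _ (by omega)]

theorem totalOp_queryL_mulVec {n w s : ℕ} (h : s + n ≤ w) (V : Op n) (A : Reg w → ℂ) (x : Reg w) :
    (totalOp (OracleGate.op V) (queryL n w s) *ᵥ A) x =
      ∑ u, V (blk x s n) u * A (replaceBlk s u x) := by
  rw [queryL, dif_pos h, totalOp_singleton, OracleGate.op, Matrix.mulVec, dotProduct, sum_onWires]
  refine Finset.sum_congr rfl fun u _ => ?_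
  refine congrArg₂ (· * ·) (congrArg (fun z => V z u) ?_) (congrArg A ?_)
  · funext i
    rw [blk, bit_of_lt _ (by omega)]
    rfl
  · rw [← extend_self_of_off _ (y := replaceBlk s u x)]
    · congr 1
      funext i
      change u i = if s ≤ s + (i : ℕ) ∧ s + (i : ℕ) < s + n then bit u (s + i - s) else _
      rw [if_pos (by omega), Nat.add_sub_cancel_left, bit_fin]
    · intro j hj
      rw [replaceBlk, if_neg]
      rintro ⟨h1, h2⟩
      exact hj ⟨⟨j - s, by omega⟩, Fin.ext (show s + ((j : ℕ) - s) = j by omega)⟩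

/-- Queries on `t` consecutive blocks of `n` wires. -/
def queryBlock (n W t : ℕ) : List (OracleGate n W) :=
  (List.range t).flatMap fun c => queryL n W (c * n)

/-- Each query turns the indicator that its block holds `e j x` into the corresponding column of
`V`. The invariance hypotheses say that `Z` and `e` depend only on wires outside the queried blocks,
so they pass through the queries. Counting `t` separately from `T` allows induction with the
remaining blocks still untouched. -/
theorem queryBlock_mulVec {n W t T : ℕ} (hT : t ≤ T) (hW : T * n ≤ W) (V : Op n)
    (Z : Reg W → ℂ) (hZ : ∀ x c u, c < T → Z (replaceBlk (n := n) (c * n) u x) = Z x)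
    (e : Fin T → Reg W → Reg n)
    (he : ∀ j x c u, c < T → e j (replaceBlk (n := n) (c * n) u x) = e j x) (x : Reg W) :
    (totalOp (OracleGate.op V) (queryBlock n W t) *ᵥ
      fun x => Z x * ∏ j : Fin T, ind (blk x (j * n) n = e j x)) x =
      Z x * ∏ j : Fin T, if (j : ℕ) < t then V (blk x (j * n) n) (e j x) else
        ind (blk x (j * n) n = e j x) := by
  induction t generalizing x with
  | zero => simp [queryBlock, totalOp_nil]
  | succ t ih =>
    have hc : queryBlock n W (t + 1) = queryBlock n W t ++ queryL n W (t * n) := by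
      simp [queryBlock, List.range_succ, List.flatMap_append]
    have hbound : ∀ j : ℕ, j < T → j * n + n ≤ W := fun j hj => by
      have := Nat.mul_le_mul_right n (Nat.succ_le_of_lt hj)
      rw [Nat.succ_mul] at this
      omega
    rw [hc, totalOp_append, ← Matrix.mulVec_mulVec, totalOp_queryL_mulVec (hbound t (by omega))]
    let τ : Fin T := ⟨t, by omega⟩
    have hblk : ∀ (u : Reg n) (j : Fin T), blk (replaceBlk (t * n) u x) (j * n) n =
        if j = τ then u else blk x (j * n) n := by
      intro u j
      refine bit_ext fun i hi => ?_
      rw [bit_blk, if_pos hi, bit_replaceBlk (hbound t (by omega))]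
      by_cases hj : j = τ
      · subst hj
        rw [if_pos (by simp only [τ]; omega), if_pos rfl]
        simp [τ]
      · rw [if_neg, if_neg hj, bit_blk, if_pos hi]
        rcases Nat.lt_or_gt_of_ne (fun h => hj (Fin.ext h) : (j : ℕ) ≠ t) with h | h
        · have := mul_add_lt h hi
          omega
        · have := Nat.mul_le_mul_right n (Nat.succ_le_of_lt h)
          rw [Nat.succ_mul] at this
          omega
    have step : ∀ u : Reg n, V (blk x (t * n) n) u * (totalOp (OracleGate.op V) (queryBlock n W t) *ᵥ
        fun x => Z x * ∏ j : Fin T, ind (blk x (j * n) n = e j x)) (replaceBlk (t * n) u x) =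
        ind (u = e τ x) * (V (blk x (t * n) n) u * (Z x * ∏ j ∈ Finset.univ.erase τ,
          if (j : ℕ) < t then V (blk x (j * n) n) (e j x) else ind (blk x (j * n) n = e j x))) := by
      intro u
      rw [ih (by omega), hZ x t u (by omega), ← Finset.mul_prod_erase _ _ (Finset.mem_univ τ),
        hblk, if_pos rfl, he τ x t u (by omega), if_neg (by simp [τ])]
      rw [Finset.prod_congr rfl fun j hj => by
        rw [hblk, if_neg (Finset.ne_of_mem_erase hj), he j x t u (by omega)]]
      ring
    rw [Finset.sum_congr rfl fun u _ => step u, sum_ind_eq,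
      ← Finset.mul_prod_erase Finset.univ _ (Finset.mem_univ τ), if_pos (by simp [τ])]
    rw [Finset.prod_congr (s₁ := Finset.univ.erase τ) rfl fun j hj => by
      have hne : (j : ℕ) ≠ t := fun h => Finset.ne_of_mem_erase hj (Fin.ext h)
      rw [if_congr (show (j : ℕ) < t ↔ (j : ℕ) < t + 1 by omega) rfl rfl]]
    ring

/-- Prepare `t` copies of the state with queries to the unitary, and run `D` on them. -/
def oracleCircuit {n t o : ℕ} (m : ℕ) (D : Circuit Gate (t * n) o) : Circuit (OracleGate n) 0 o where
  w := D.w + t * m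
  input_le := Nat.zero_le _
  output_le := by have := D.output_le; omega
  gates := (hBlock (D.w + t * m) D.w (t * m) ++ copyBlock (D.w + t * m) n m D.w t).map
      OracleGate.basic ++ queryBlock n (D.w + t * m) t ++
    (D.gates.map (Gate.lift (Nat.le_add_right D.w (t * m)))).map OracleGate.basic

theorem evolve_basic {n w : ℕ} (V : Op n) (l : List (Gate w)) (σ : Op w) :
    evolve (OracleGate.op V) (l.map OracleGate.basic) σ = evolve Gate.op l σ := by
  rw [evolve, evolve, totalOp_map]
  rfl

theorem Circuit.run_smul {i o : ℕ} (C : Circuit Gate i o) (c : ℂ) (ρ : Op i) :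
    C.run (c • ρ) = c • C.run ρ := by
  ext a b
  obtain ⟨w, hi, ho, l⟩ := C
  rw [Circuit.run_mk_apply, Matrix.smul_apply, Circuit.run_mk_apply, smul_eq_mul, Finset.mul_sum]
  refine Finset.sum_congr rfl fun e _ => ?_
  rw [evolve_ext (τ := c • padZero hi ρ), evolve_smul, Matrix.smul_apply, smul_eq_mul]
  intro x y
  rw [padZero_eq, Matrix.smul_apply, Matrix.smul_apply, padZero_eq, smul_eq_mul, smul_eq_mul]
  ring

theorem evolve_sum {w : ℕ} {α ι : Type} [Fintype ι] (op : α → Op w) (l : List α) (σ : ι → Op w) :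
    evolve op l (∑ i, σ i) = ∑ i, evolve op l (σ i) := by
  simp only [evolve, Matrix.mul_sum, Matrix.sum_mul]

theorem Circuit.run_sum {i o : ℕ} {ι : Type} [Fintype ι] (C : Circuit Gate i o) (ρ : ι → Op i) :
    C.run (∑ j, ρ j) = ∑ j, C.run (ρ j) := by
  ext a b
  obtain ⟨w, hi, ho, l⟩ := C
  rw [Circuit.run_mk_apply, Matrix.sum_apply]
  simp only [Circuit.run_mk_apply]
  rw [Finset.sum_comm]
  refine Finset.sum_congr rfl fun e _ => ?_
  rw [evolve_ext (τ := ∑ j, padZero hi (ρ j)), evolve_sum, Matrix.sum_apply]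
  intro x y
  rw [padZero_eq, Matrix.sum_apply, Matrix.sum_apply, Finset.mul_sum]
  exact Finset.sum_congr rfl fun j _ => (padZero_eq hi (ρ j) x y).symm

/-- The `t * m` uniform bits behind the wires of `D` are discarded at the end, so they average over
all tuples of columns, matching `tensorPow_vprdm`. -/
theorem oracleCircuit_runWith {n m t o : ℕ} (hm : m ≤ n) (D : Circuit Gate (t * n) o) (V : Uni n) :
    (oracleCircuit m D).runWith (V : Op n) 1 = D.run (tensorPow (vprdm V m) t) := by
  have hD := D.input_le
  have hD' := D.output_le
  rw [tensorPow_vprdm hm, Circuit.run_smul, Circuit.run_sum]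
  ext a b
  change keepFirst (o := o) (w := D.w + t * m) (by omega) (evolve (OracleGate.op (V : Op n))
    ((hBlock (D.w + t * m) D.w (t * m) ++ copyBlock (D.w + t * m) n m D.w t).map OracleGate.basic ++ queryBlock n (D.w + t * m) t ++
    (D.gates.map (Gate.lift (Nat.le_add_right D.w (t * m)))).map OracleGate.basic)
    (padZero (Nat.zero_le (D.w + t * m)) 1)) a b = _
  set W := D.w + t * m with hW
  have hDW : D.w ≤ W := Nat.le_add_right D.w (t * m)
  obtain ⟨f, f', ⟨F, hF, hf, -⟩, H⟩ := copyBlock_actsAs (W := W) hm hD le_rfl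
  rw [keepFirst_apply]
  let Z : Reg W → ℂ := fun x => ind (∀ j < D.w, t * n ≤ j → bit x j = false)
  let e : Fin t → Reg W → Reg n := fun j x => tail n (blk x (D.w + j * m) m)
  have hbound : ∀ j : ℕ, j < t → D.w + j * m + m ≤ W := fun j hj => by
    have := Nat.mul_le_mul_right m (Nat.succ_le_of_lt hj)
    rw [Nat.succ_mul] at this
    omega
  have hboundn : ∀ j : ℕ, j < t → j * n + n ≤ t * n := fun j hj => by
    have := Nat.mul_le_mul_right n (Nat.succ_le_of_lt hj)
    rwa [Nat.succ_mul] at this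
  -- Support of the prepared state: every block is zeros followed by its share of the uniform bits,
  -- and the ancillas of `D` are clean.
  have hzero : ∀ x : Reg W, (∀ j < W, 0 ≤ j → bit (clr D.w (t * m) (F x)) j = false) ↔
      (∀ j < D.w, t * n ≤ j → bit x j = false) ∧ ∀ j : Fin t, blk x (j * n) n = e j x := by
    intro x
    obtain ⟨h1, h2, h3⟩ := H (bit x)
    have hblk : ∀ j : Fin t, blk x (j * n) n = e j x ↔
        (∀ i < n - m, bit x (j * n + i) = false) ∧
        ∀ i < m, bit x (j * n + (n - m) + i) = bit x (D.w + j * m + i) := by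
      intro j
      rw [eq_blk_iff]
      simp only [e, bit_tail hm]
      constructor
      · intro G
        refine ⟨fun i hi => ?_, fun i hi => ?_⟩
        · rw [G i (by omega), if_pos hi]
        · have := G (n - m + i) (by omega)
          rwa [if_neg (by omega), Nat.add_sub_cancel_left, bit_blk, if_pos hi, ← add_assoc] at this
      · rintro ⟨G1, G2⟩ i hi
        split_ifs with h4
        · exact G1 i h4
        · rw [bit_blk, if_pos (by omega), ← G2 _ (by omega)]
          congr 1
          omega
    simp only [hblk, bit_clr, hf]
    constructor
    · intro G
      refine ⟨fun j hj hn => ?_, fun j => ⟨fun i hi => ?_, fun i hi => ?_⟩⟩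
      · have := G j (by omega) (by omega)
        rwa [if_neg (by omega), h3 j hn] at this
      · have hj := hboundn j j.2
        have := G (j * n + i) (by omega) (by omega)
        rwa [if_neg (by omega), h2 j j.2 i hi] at this
      · have hj := hboundn j j.2
        have := G (j * n + (n - m) + i) (by omega) (by omega)
        rw [if_neg (by omega), h1 j j.2 i hi] at this
        simpa using this
    · rintro ⟨G1, G2⟩ j hj -
      split_ifs with h4
      · rfl
      · by_cases hjn : t * n ≤ j
        · rw [h3 j hjn]
          exact G1 j (by omega) hjn
        · have hn : 0 < n := by
            rcases Nat.eq_zero_or_pos n with h | h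
            · subst h; omega
            · exact h
          have hdiv : j / n < t := (Nat.div_lt_iff_lt_mul hn).2 (by omega)
          have hmod := Nat.mod_lt j hn
          have hj' : j / n * n + j % n = j := Nat.div_add_mod' j n
          obtain ⟨g1, g2⟩ := G2 ⟨j / n, hdiv⟩
          by_cases h5 : j % n < n - m
          · rw [← hj', h2 _ hdiv _ h5]
            exact g1 _ h5
          · rw [← hj', show j / n * n + j % n = j / n * n + (n - m) + (j % n - (n - m)) by omega,
              h1 _ hdiv _ (by omega), g2 _ (by omega)]
            simp
  have h2 : evolve (OracleGate.op (V : Op n)) ((hBlock W D.w (t * m) ++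
      copyBlock W n m D.w t).map OracleGate.basic) (padZero (Nat.zero_le W) 1) =
      ((2 : ℂ) ^ (t * m))⁻¹ • pureState
        (fun x => Z x * ∏ j : Fin t, ind (blk x (j * n) n = e j x)) := by
    rw [evolve_basic, evolve_append, hF]
    ext x y
    rw [Matrix.submatrix_apply, evolve_hBlock le_rfl, padZero_eq, Matrix.one_apply,
      if_pos (Subsingleton.elim _ _), ind_congr (hzero x), ind_congr (hzero y), ind_and, ind_and,
      ind_forall (fun j : Fin t => blk x (j * n) n = e j x),
      ind_forall (fun j : Fin t => blk y (j * n) n = e j y), Matrix.smul_apply, pureState, Matrix.vecMulVec_apply, Pi.star_apply,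
      smul_eq_mul, star_mul', star_prod]
    · simp only [Z, star_ind]
      ring
    · intro x y j h1 h2 hxy
      rw [padZero_eq]
      rcases hxy with h | h
      · rw [ind_neg fun G => by simp [G j (by omega) (by omega)] at h]
        ring
      · rw [ind_neg (p := ∀ j < W, 0 ≤ j → bit y j = false)
          fun G => by simp [G j (by omega) (by omega)] at h]
        ring
  have h3 : evolve (OracleGate.op (V : Op n)) ((hBlock W D.w (t * m) ++
      copyBlock W n m D.w t).map OracleGate.basic ++ queryBlock n W t) (padZero (Nat.zero_le W) 1) =
      ((2 : ℂ) ^ (t * m))⁻¹ • pureState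
        (fun x => Z x * ∏ j : Fin t, (V : Op n) (blk x (j * n) n) (e j x)) := by
    rw [evolve_append, h2, evolve_smul, evolve_pureState]
    congr 2
    funext x
    have hrep : ∀ (x : Reg W) c (u : Reg n) j, c < t → t * n ≤ j →
        bit (replaceBlk (c * n) u x) j = bit x j := by
      intro x c u j hc hj
      have := hboundn c hc
      rw [bit_replaceBlk (by omega), if_neg (by omega)]
    rw [queryBlock_mulVec le_rfl (by omega) (V : Op n) Z _ e]
    · simp
    · intro j x c u hc
      simp only [e]
      congr 1
      refine bit_ext fun i hi => ?_
      rw [bit_blk, bit_blk, if_pos hi, if_pos hi, hrep _ _ _ _ hc (by omega)]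
    · intro x c u hc
      refine ind_congr (forall_congr' fun j => forall_congr' fun hj => forall_congr' fun hn => ?_)
      rw [hrep _ _ _ _ hc hn]
  have key : ∀ ε : Reg (W - o), evolve (OracleGate.op (V : Op n)) ((hBlock W D.w (t * m) ++
      copyBlock W n m D.w t).map OracleGate.basic ++ queryBlock n W t ++
      (D.gates.map (Gate.lift hDW)).map OracleGate.basic) (padZero (Nat.zero_le W) 1)
        (glue W a ε) (glue W b ε) = ((2 : ℂ) ^ (t * m))⁻¹ *
      evolve Gate.op D.gates (padZero D.input_le (pureState (columnState (V : Op n)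
        fun j => tail n (blocksEquiv t m (blk ε (D.w - o) (t * m)) j))))
        (glue D.w a (blk ε 0 (D.w - o))) (glue D.w b (blk ε 0 (D.w - o))) := by
    intro ε
    have hpre : ∀ a : Reg o, blk (glue W a ε) 0 D.w = glue D.w a (blk ε 0 (D.w - o)) := by
      intro a
      refine bit_ext fun j hj => ?_
      rw [bit_blk, if_pos hj, bit_glue, bit_glue, zero_add, if_pos (by omega), if_pos hj]
      split_ifs with h4
      · rfl
      · rw [bit_blk, if_pos (by omega), zero_add]
    have hA : ∀ (a : Reg o) (u : Reg D.w), (Z (overwrite u (glue W a ε)) * ∏ j : Fin t,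
        (V : Op n) (blk (overwrite u (glue W a ε)) (j * n) n) (e j (overwrite u (glue W a ε)))) =
        ind (∀ j < D.w, t * n ≤ j → bit u j = false) * columnState (V : Op n)
        (fun j => tail n (blocksEquiv t m (blk ε (D.w - o) (t * m)) j)) (blk u 0 (t * n)) := by
      intro a u
      have hover := bit_overwrite hDW u (glue W a ε)
      congr 1
      · refine ind_congr (forall_congr' fun j => forall_congr' fun hj => forall_congr' fun hn => ?_)
        rw [hover, if_pos hj]
      · rw [columnState]
        refine Finset.prod_congr rfl fun j _ => ?_
        have hj := hboundn j j.2
        have hj' := hbound j j.2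
        refine congrArg₂ (V : Op n) ?_ ?_
        · rw [blk_blk _ (by omega)]
          refine bit_ext fun i hi => ?_
          rw [bit_blk, bit_blk, if_pos hi, if_pos hi, hover, if_pos (by omega), zero_add]
        · simp only [e]
          congr 1
          rw [blocksEquiv_apply, blk_blk _ (by omega)]
          refine bit_ext fun i hi => ?_
          rw [bit_blk, bit_blk, if_pos hi, if_pos hi, hover, if_neg (by omega), bit_glue,
            if_pos (by omega), if_neg (by omega)]
          congr 1
          omega
    rw [evolve_append, h3, evolve_basic, evolve_lift, hpre, hpre, evolve_ext (τ :=
      ((2 : ℂ) ^ (t * m))⁻¹ • padZero D.input_le (pureState (columnState (V : Op n)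
        fun j => tail n (blocksEquiv t m (blk ε (D.w - o) (t * m)) j))))]
    · rw [evolve_smul, Matrix.smul_apply, smul_eq_mul]
    · intro u v
      rw [Matrix.of_apply, Matrix.smul_apply, pureState, Matrix.vecMulVec_apply, Pi.star_apply, hA,
        hA, Matrix.smul_apply, padZero_eq, pureState, Matrix.vecMulVec_apply, Pi.star_apply,
        smul_eq_mul, smul_eq_mul, star_mul', star_ind]
      ring
  rw [Finset.sum_congr rfl fun ε _ => key ε, ← Finset.mul_sum]
  rw [sum_blk (show (D.w - o) + t * m = W - o by omega) (fun r ε => evolve Gate.op D.gates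
    (padZero D.input_le (pureState (columnState (V : Op n) fun j => tail n (blocksEquiv t m ε j))))
    (glue D.w a r) (glue D.w b r)), Finset.sum_comm,
    Matrix.smul_apply, Matrix.sum_apply, smul_eq_mul,
    ← (blocksEquiv t m).sum_comp]
  congr 1
  refine Finset.sum_congr rfl fun ε _ => ?_
  exact (Circuit.run_mk_apply D.input_le D.output_le D.gates _ a b).symm

/-! ### Haar measure -/

instance (n : ℕ) : Measure.IsHaarMeasure (haar n) := Measure.isHaarMeasure_haarMeasure _

instance (n : ℕ) : IsProbabilityMeasure (haar n) := ⟨Measure.haarMeasure_self⟩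

/-- A right translate of Haar measure is again a left-invariant probability measure, and there is
only one. -/
instance (n : ℕ) : Measure.IsMulRightInvariant (haar n) := by
  refine ⟨fun g => ?_⟩
  have : IsProbabilityMeasure (Measure.map (fun x => x * g) (haar n)) :=
    Measure.isProbabilityMeasure_map (by fun_prop)
  exact Measure.isHaarMeasure_eq_of_isProbabilityMeasure _ _

theorem integral_haar_mul_right {n : ℕ} (f : Uni n → ℝ) (W : Uni n) :
    ∫ V, f (V * W) ∂(haar n) = ∫ V, f V ∂(haar n) := integral_mul_right_eq_self f W

theorem integrable_haar {n : ℕ} {f : Uni n → ℝ} (hf : Continuous f) : Integrable f (haar n) :=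
  hf.integrable_of_hasCompactSupport (HasCompactSupport.of_compactSpace f)

/-! ### Outcome probabilities as sums of squares -/

/-- The amplitude of the basis state `x` of all wires for the input `y`. -/
noncomputable def Circuit.row {i o : ℕ} (C : Circuit Gate i o) (x : Reg C.w) (y : Reg i) : ℂ :=
  totalOp Gate.op C.gates x (glue C.w y fun _ : Fin 0 => false)

theorem pad_eq_iff {i w : ℕ} (x : Reg w) :
    (∀ j < w, i ≤ j → bit x j = false) ↔ ∃ y : Reg i, glue w y (fun _ : Fin 0 => false) = x := by
  constructor
  · intro H
    refine ⟨blk x 0 i, bit_ext fun j hj => ?_⟩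
    rw [bit_glue, if_pos hj]
    split_ifs with h1
    · rw [bit_blk, if_pos h1, zero_add]
    · rw [bit_of_le _ (Nat.zero_le _), H j hj (by omega)]
  · rintro ⟨y, rfl⟩ j hj hi
    rw [bit_glue, if_pos hj, if_neg (by omega), bit_of_le _ (Nat.zero_le _)]

theorem blk_glue_pad {i w : ℕ} (h : i ≤ w) (y : Reg i) :
    blk (glue w y fun _ : Fin 0 => false) 0 i = y := by
  refine bit_ext fun j hj => ?_
  rw [bit_blk, if_pos hj, bit_glue, zero_add, if_pos (by omega), if_pos hj]

theorem glue_pad_injective {i w : ℕ} (h : i ≤ w) :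
    Function.Injective fun y : Reg i => glue w y fun _ : Fin 0 => false := fun y y' hy => by
  rw [← blk_glue_pad h y, ← blk_glue_pad h y']
  exact congrArg (fun x => blk x 0 i) hy

theorem padZero_pureState {i w : ℕ} (h : i ≤ w) (Φ : Reg i → ℂ) :
    padZero h (pureState Φ) =
      pureState fun x => ind (∀ j < w, i ≤ j → bit x j = false) * Φ (blk x 0 i) := by
  ext x y
  rw [padZero_eq, pureState, pureState, Matrix.vecMulVec_apply, Matrix.vecMulVec_apply,
    Pi.star_apply, Pi.star_apply, star_mul', star_ind]
  ring

theorem pureState_re {a : ℕ} (ψ : Reg a → ℂ) (x : Reg a) : (pureState ψ x x).re = ‖ψ x‖ ^ 2 := by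
  rw [pureState, Matrix.vecMulVec_apply, Pi.star_apply, Complex.star_def, Complex.mul_conj,
    Complex.ofReal_re, Complex.normSq_eq_norm_sq]

/-- A discarded value `r` contributes the squared amplitude of one basis state of all wires, which
is linear in the input. With columns as input, these amplitudes become polynomials in phases later.
-/
theorem outcomeProb_run_pureState {i o : ℕ} (C : Circuit Gate i o) (Φ : Reg i → ℂ) (z : Reg o) :
    outcomeProb (C.run (pureState Φ)) z =
      ∑ r : Reg (C.w - o), ‖∑ y, C.row (glue C.w z r) y * Φ y‖ ^ 2 := by
  have hi := C.input_le
  rw [outcomeProb, Circuit.run, keepFirst_apply, Complex.re_sum]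
  refine Finset.sum_congr rfl fun r _ => ?_
  rw [padZero_pureState, conj_pureState, pureState_re]
  congr 2
  have h := sum_ind_mul _ (glue_pad_injective hi) pad_eq_iff
    (fun x => totalOp Gate.op C.gates (glue C.w z r) x * Φ (blk x 0 i))
  simp only [blk_glue_pad hi] at h
  refine Eq.trans ?_ h
  exact Finset.sum_congr rfl fun x _ => mul_left_comm _ _ _

theorem sum_norm_sq_unitary {ι : Type*} [Fintype ι] [DecidableEq ι] {V : Matrix ι ι ℂ}
    (hV : V ∈ Matrix.unitaryGroup ι ℂ) (j : ι) : ∑ i, ‖V i j‖ ^ 2 = 1 := by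
  have h := congrFun (congrFun (Matrix.mem_unitaryGroup_iff'.mp hV) j) j
  rw [Matrix.mul_apply, Matrix.one_apply_eq] at h
  have h' := congrArg Complex.re h
  rw [Complex.re_sum, Complex.one_re] at h'
  rw [← h']
  refine Finset.sum_congr rfl fun i _ => ?_
  rw [Matrix.star_apply, Complex.star_def, mul_comm, Complex.mul_conj, Complex.ofReal_re,
    Complex.normSq_eq_norm_sq]

theorem sum_norm_sq_mulVec {ι : Type*} [Fintype ι] [DecidableEq ι] {V : Matrix ι ι ℂ}
    (hV : V ∈ Matrix.unitaryGroup ι ℂ) (Φ : ι → ℂ) : ∑ i, ‖(V *ᵥ Φ) i‖ ^ 2 = ∑ i, ‖Φ i‖ ^ 2 := by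
  have key : ∀ Ψ : ι → ℂ, ((∑ i, ‖Ψ i‖ ^ 2 : ℝ) : ℂ) = star Ψ ⬝ᵥ Ψ := by
    intro Ψ
    rw [dotProduct, Complex.ofReal_sum]
    refine Finset.sum_congr rfl fun i _ => ?_
    rw [Pi.star_apply, Complex.star_def, mul_comm, Complex.mul_conj, Complex.normSq_eq_norm_sq]
  apply Complex.ofReal_injective
  rw [key, key, Matrix.star_mulVec, Matrix.dotProduct_mulVec, Matrix.vecMul_vecMul,
    ← Matrix.star_eq_conjTranspose, Matrix.mem_unitaryGroup_iff'.mp hV, Matrix.vecMul_one]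

theorem sum_outcomeProb_run_pureState {i o : ℕ} (C : Circuit Gate i o) (Φ : Reg i → ℂ) :
    ∑ z, outcomeProb (C.run (pureState Φ)) z = ∑ y, ‖Φ y‖ ^ 2 := by
  have hi := C.input_le
  have ho := C.output_le
  have h1 : ∀ z, outcomeProb (C.run (pureState Φ)) z = ∑ r : Reg (C.w - o),
      ‖(totalOp Gate.op C.gates *ᵥ fun x => ind (∀ j < C.w, i ≤ j → bit x j = false) *
        Φ (blk x 0 i)) (glue C.w z r)‖ ^ 2 := by
    intro z
    rw [outcomeProb, Circuit.run, keepFirst_apply, Complex.re_sum]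
    refine Finset.sum_congr rfl fun r _ => ?_
    rw [padZero_pureState, conj_pureState, pureState_re]
  rw [Finset.sum_congr rfl fun z _ => h1 z, ← sum_splitReg (show o + (C.w - o) = C.w by omega)
    fun x => ‖(totalOp Gate.op C.gates *ᵥ fun x => ind (∀ j < C.w, i ≤ j → bit x j = false) *
        Φ (blk x 0 i)) x‖ ^ 2,
    sum_norm_sq_mulVec (totalOp_unitary _ Gate.op_unitary _)]
  apply Complex.ofReal_injective
  rw [Complex.ofReal_sum, Complex.ofReal_sum, ← Finset.sum_congr rfl fun y _ => show
    ((‖Φ (blk (glue C.w y fun _ : Fin 0 => false) 0 i)‖ ^ 2 : ℝ) : ℂ) = ((‖Φ y‖ ^ 2 : ℝ) : ℂ) by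
      rw [blk_glue_pad hi]]
  rw [← sum_ind_mul _ (glue_pad_injective hi) pad_eq_iff
    (fun x => ((‖Φ (blk x 0 i)‖ ^ 2 : ℝ) : ℂ))]
  refine Finset.sum_congr rfl fun x _ => ?_
  by_cases h : ∀ j < C.w, i ≤ j → bit x j = false
  · rw [ind_pos h, one_mul, one_mul]
  · rw [ind_neg h]; simp

theorem outcomeProb_run_pureState_nonneg {i o : ℕ} (C : Circuit Gate i o) (Φ : Reg i → ℂ)
    (z : Reg o) : 0 ≤ outcomeProb (C.run (pureState Φ)) z := by
  rw [outcomeProb_run_pureState]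
  positivity

theorem sum_norm_sq_columnState {n t : ℕ} (V : Uni n) (e : Fin t → Reg n) :
    ∑ x, ‖columnState (V : Op n) e x‖ ^ 2 = 1 := by
  rw [Finset.sum_congr rfl fun x _ => show ‖columnState (V : Op n) e x‖ ^ 2 =
    ∏ j, ‖(V : Op n) (blocksEquiv t n x j) (e j)‖ ^ 2 by
      simp only [columnState, norm_prod, Finset.prod_pow, blocksEquiv_apply]]
  rw [(blocksEquiv t n).sum_comp fun y => ∏ j, ‖(V : Op n) (y j) (e j)‖ ^ 2,
    ← Fintype.piFinset_univ,
    ← Finset.prod_univ_sum (fun _ => Finset.univ) fun j y => ‖(V : Op n) y (e j)‖ ^ 2]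
  exact Finset.prod_eq_one fun j _ => sum_norm_sq_unitary V.2 (e j)

theorem continuous_columnState {n t : ℕ} (e : Fin t → Reg n) (x : Reg (t * n)) :
    Continuous fun V : Uni n => columnState (V : Op n) e x :=
  continuous_finsetProd _ fun _ _ => continuous_subtype_val.matrix_elem _ _

/-- The probability of the outcome `z` on the columns `e 0, e 1, …` of a unitary. -/
noncomputable def columnProb {n t o : ℕ} (D : Circuit Gate (t * n) o) (z : Reg o)
    (e : Fin t → Reg n) (V : Uni n) : ℝ :=
  outcomeProb (D.run (pureState (columnState (V : Op n) e))) z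

theorem continuous_columnProb {n t o : ℕ} (D : Circuit Gate (t * n) o) (z : Reg o)
    (e : Fin t → Reg n) : Continuous (columnProb D z e) := by
  unfold columnProb
  simp only [outcomeProb_run_pureState]
  exact continuous_finsetSum _ fun r _ => (continuous_norm.comp (continuous_finsetSum _ fun y _ =>
    continuous_const.mul (continuous_columnState e y))).pow 2

theorem columnProb_nonneg {n t o : ℕ} (D : Circuit Gate (t * n) o) (z : Reg o)
    (e : Fin t → Reg n) (V : Uni n) : 0 ≤ columnProb D z e V :=
  outcomeProb_run_pureState_nonneg _ _ _

theorem sum_columnProb {n t o : ℕ} (D : Circuit Gate (t * n) o)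
    (e : Fin t → Reg n) (V : Uni n) : ∑ z, columnProb D z e V = 1 :=
  (sum_outcomeProb_run_pureState _ _).trans (sum_norm_sq_columnState V e)

theorem columnProb_le_one {n t o : ℕ} (D : Circuit Gate (t * n) o) (z : Reg o)
    (e : Fin t → Reg n) (V : Uni n) : columnProb D z e V ≤ 1 := by
  rw [← sum_columnProb D e V]
  exact Finset.single_le_sum (fun z _ => columnProb_nonneg D z e V) (Finset.mem_univ z)

theorem outcomeProb_tensorPow {n m t o : ℕ} (hm : m ≤ n) (D : Circuit Gate (t * n) o) (z : Reg o)
    (V : Uni n) : outcomeProb (D.run (tensorPow (vprdm V m) t)) z =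
      ((2 : ℝ) ^ (t * m))⁻¹ * ∑ e : Fin t → Reg m, columnProb D z (fun j => tail n (e j)) V := by
  rw [tensorPow_vprdm hm, Circuit.run_smul, Circuit.run_sum, outcomeProb, Matrix.smul_apply,
    Matrix.sum_apply, smul_eq_mul, show ((2 : ℂ) ^ (t * m))⁻¹ = (((2 : ℝ) ^ (t * m))⁻¹ : ℝ) by
      push_cast; rfl, Complex.re_ofReal_mul, Complex.re_sum]
  rfl

theorem integral_outcomeProb_tensorPow {n m t o : ℕ} (hm : m ≤ n) (D : Circuit Gate (t * n) o)
    (z : Reg o) : ∫ V, outcomeProb (D.run (tensorPow (vprdm V m) t)) z ∂(haar n) =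
      ((2 : ℝ) ^ (t * m))⁻¹ *
        ∑ e : Fin t → Reg m, ∫ V, columnProb D z (fun j => tail n (e j)) V ∂(haar n) := by
  simp only [outcomeProb_tensorPow hm]
  rw [integral_const_mul, integral_finsetSum _ fun e _ =>
    integrable_haar (continuous_columnProb D z _)]

/-! ### Invariance under basis permutations and the birthday bound -/

/-- A permutation of the basis states. -/
def permUni {n : ℕ} (σ : Equiv.Perm (Reg n)) : Uni n :=
  ⟨(1 : Op n).submatrix id σ, by
    rw [Matrix.mem_unitaryGroup_iff, Matrix.star_eq_conjTranspose, Matrix.conjTranspose_submatrix,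
      Matrix.conjTranspose_one, Matrix.submatrix_mul_equiv, one_mul, Matrix.submatrix_id_id]⟩

theorem mul_permUni_apply {n : ℕ} (V : Op n) (σ : Equiv.Perm (Reg n)) (a b : Reg n) :
    (V * (permUni σ : Op n)) a b = V a (σ b) := by
  rw [permUni, Matrix.mul_apply, Finset.sum_eq_single (σ b)]
  · simp [Matrix.one_apply]
  · intro c _ hc
    simp [hc]
  · simp

/-- Right multiplication by a permutation matrix permutes the columns and preserves Haar measure. -/
theorem integral_columnProb_perm {n t o : ℕ} (D : Circuit Gate (t * n) o) (z : Reg o)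
    (e : Fin t → Reg n) (σ : Equiv.Perm (Reg n)) :
    ∫ V, columnProb D z (fun j => σ (e j)) V ∂(haar n) = ∫ V, columnProb D z e V ∂(haar n) := by
  rw [← integral_haar_mul_right (fun V => columnProb D z e V) (permUni σ)]
  refine integral_congr_ae (Eventually.of_forall fun V => ?_)
  have : columnState (V : Op n) (fun j => σ (e j)) =
      columnState ((V * permUni σ : Uni n) : Op n) e := by
    funext x
    simp only [columnState, Submonoid.coe_mul, mul_permUni_apply]
  simp only [columnProb, this]

/-- The bijection between the ranges of two injective tuples extends to a permutation of the whole
basis. -/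
theorem integral_columnProb_injective {n t o : ℕ} (D : Circuit Gate (t * n) o) (z : Reg o)
    {e e' : Fin t → Reg n} (he : Function.Injective e) (he' : Function.Injective e') :
    ∫ V, columnProb D z e V ∂(haar n) = ∫ V, columnProb D z e' V ∂(haar n) := by
  classical
  let τ : {x // x ∈ Set.range e} ≃ {x // x ∈ Set.range e'} :=
    (Equiv.ofInjective e he).symm.trans (Equiv.ofInjective e' he')
  rw [← integral_columnProb_perm D z e τ.extendSubtype]
  have : (fun j => τ.extendSubtype (e j)) = e' := by
    funext j
    rw [Equiv.extendSubtype_apply_of_mem _ _ ⟨j, rfl⟩]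
    simp [τ]
  rw [this]

/-- Birthday bound: the falling factorial is at least `(M - t) ^ t`, to which Bernoulli's inequality
applies. For `t > M` the left side is not positive. -/
theorem one_sub_le_card_embedding {t M : ℕ} (hM : 0 < M) :
    (1 - (t : ℝ) ^ 2 / M) * (M : ℝ) ^ t ≤ M.descFactorial t := by
  have hM' : (0 : ℝ) < M := by exact_mod_cast hM
  rcases Nat.lt_or_ge M t with h | h
  · have : (1 : ℝ) - (t : ℝ) ^ 2 / M ≤ 0 := by
      rw [sub_nonpos, one_le_div hM']
      have : (M : ℝ) < t := by exact_mod_cast h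
      have h1 : (1 : ℝ) ≤ M := by exact_mod_cast hM
      nlinarith
    exact (mul_nonpos_of_nonpos_of_nonneg this (by positivity)).trans (by positivity)
  · have h1 : (((M + 1 - t : ℕ) : ℝ)) ^ t ≤ M.descFactorial t := by
      exact_mod_cast Nat.pow_sub_le_descFactorial M t
    refine le_trans ?_ h1
    have h2 : ((M : ℝ) - t) ^ t ≤ ((M + 1 - t : ℕ) : ℝ) ^ t := by
      have h3 : (t : ℝ) ≤ M := by exact_mod_cast h
      refine pow_le_pow_left₀ (by linarith) ?_ _
      rw [Nat.cast_sub (by omega)]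
      push_cast
      linarith
    refine le_trans ?_ h2
    rw [show (M : ℝ) - t = (1 + -((t : ℝ) / M)) * M by field_simp; ring, mul_pow]
    refine mul_le_mul_of_nonneg_right ?_ (by positivity)
    refine le_trans (le_of_eq ?_) (one_add_mul_le_pow (a := -((t : ℝ) / M)) ?_ t)
    · ring
    · have : (t : ℝ) / M ≤ 1 := (div_le_one hM').2 (by exact_mod_cast h)
      linarith

/-- The average of a function that takes the same value `c` at all injective tuples. -/
theorem abs_avg_sub_le {t : ℕ} {β : Type*} [Fintype β] [Nonempty β] (G : (Fin t → β) → ℝ)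
    (hG : ∀ e, 0 ≤ G e ∧ G e ≤ 1) (c : ℝ) (hc : 0 ≤ c ∧ c ≤ 1)
    (h : ∀ e, Function.Injective e → G e = c) :
    |((Fintype.card β : ℝ) ^ t)⁻¹ * ∑ e, G e - c| ≤ (t : ℝ) ^ 2 / Fintype.card β := by
  classical
  have hM : 0 < Fintype.card β := Fintype.card_pos
  set M := Fintype.card β with hMdef
  have hM' : (0 : ℝ) < M := by exact_mod_cast hM
  have hpos : (0 : ℝ) < (M : ℝ) ^ t := by positivity
  have hcard : (Fintype.card (Fin t → β) : ℝ) = (M : ℝ) ^ t := by simp [hMdef]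
  have h1 : ((M : ℝ) ^ t)⁻¹ * ∑ e, G e - c = ((M : ℝ) ^ t)⁻¹ * ∑ e, (G e - c) := by
    rw [Finset.sum_sub_distrib, Finset.sum_const, Finset.card_univ, nsmul_eq_mul, hcard, mul_sub,
      ← mul_assoc, inv_mul_cancel₀ hpos.ne', one_mul]
  rw [h1, abs_mul, abs_of_pos (inv_pos.2 hpos)]
  -- Only the tuples with a collision contribute, each at most one.
  have h2 : |∑ e, (G e - c)| ≤ ∑ e : Fin t → β, if Function.Injective e then (0 : ℝ) else 1 := by
    refine (Finset.abs_sum_le_sum_abs _ _).trans (Finset.sum_le_sum fun e _ => ?_)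
    split_ifs with he
    · rw [h e he, sub_self, abs_zero]
    · rw [abs_le]
      obtain ⟨g1, g2⟩ := hG e
      constructor <;> linarith [hc.1, hc.2]
  have h3 : ∑ e : Fin t → β, (if Function.Injective e then (0 : ℝ) else 1) =
      (M : ℝ) ^ t - M.descFactorial t := by
    have h4 : ∑ e : Fin t → β, (if Function.Injective e then (1 : ℝ) else 0) =
        M.descFactorial t := by
      rw [← Finset.sum_filter, Finset.sum_const, nsmul_eq_mul, mul_one, ← Fintype.card_subtype,
        Fintype.card_congr (Equiv.subtypeInjectiveEquivEmbedding (Fin t) β),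
        Fintype.card_embedding_eq, Fintype.card_fin]
    rw [← h4, ← hcard, ← nsmul_one, ← Finset.card_univ, ← Finset.sum_const,
      ← Finset.sum_sub_distrib]
    refine Finset.sum_congr rfl fun e _ => ?_
    split_ifs <;> simp
  rw [inv_mul_le_iff₀ hpos]
  have := one_sub_le_card_embedding (t := t) hM
  rw [h3] at h2
  linarith

theorem card_reg (n : ℕ) : (Fintype.card (Reg n) : ℝ) = 2 ^ n := by simp

/-- Conjugation fixes the maximally mixed state, so it is the case `m = n` for every `V`, and one
estimate over column tuples covers both states to be compared. -/
theorem maxMixed_eq_vprdm {n : ℕ} (V : Uni n) : maxMixed n = vprdm V n := by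
  have : taggedMixed n n = ((2 : ℂ) ^ n)⁻¹ • (1 : Op n) := by
    rw [taggedMixed, Matrix.smul_one_eq_diagonal]
    congr 1
    funext x
    simp
  rw [vprdm, this, Matrix.mul_smul, mul_one, Matrix.smul_mul, ← Matrix.star_eq_conjTranspose,
    Matrix.mem_unitaryGroup_iff.mp V.2, maxMixed]

theorem abs_integral_tensorPow_sub_le {n m t o : ℕ} (hm : m ≤ n) (D : Circuit Gate (t * n) o)
    (z : Reg o) (c : ℝ) (hc : 0 ≤ c ∧ c ≤ 1) (h : ∀ e : Fin t → Reg n, Function.Injective e →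
      ∫ V, columnProb D z e V ∂(haar n) = c) :
    |∫ V, outcomeProb (D.run (tensorPow (vprdm V m) t)) z ∂(haar n) - c| ≤ (t : ℝ) ^ 2 / 2 ^ m := by
  rw [integral_outcomeProb_tensorPow hm, mul_comm t m, pow_mul, ← card_reg m]
  refine abs_avg_sub_le _ (fun e => ⟨?_, ?_⟩) c hc fun e he => h _ ((tail_injective hm).comp he)
  · exact integral_nonneg fun V => columnProb_nonneg D z _ V
  · refine (integral_mono (integrable_haar (continuous_columnProb D z _))
      (integrable_const 1) fun V => columnProb_le_one D z _ V).trans ?_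
    simp

theorem abs_integral_tensorPow_sub_maxMixed_le {n m t o : ℕ} (hm : m ≤ n)
    (D : Circuit Gate (t * n) o) (z : Reg o) :
    |∫ V, outcomeProb (D.run (tensorPow (vprdm V m) t)) z ∂(haar n) -
      outcomeProb (D.run (tensorPow (maxMixed n) t)) z| ≤ 2 * ((t : ℝ) ^ 2 / 2 ^ m) := by
  have hmax : outcomeProb (D.run (tensorPow (maxMixed n) t)) z =
      ∫ V, outcomeProb (D.run (tensorPow (vprdm V n) t)) z ∂(haar n) := by
    simp only [← maxMixed_eq_vprdm, integral_const, smul_eq_mul]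
    simp
  obtain ⟨c, hc, h⟩ : ∃ c : ℝ, (0 ≤ c ∧ c ≤ 1) ∧ ∀ e : Fin t → Reg n, Function.Injective e →
      ∫ V, columnProb D z e V ∂(haar n) = c := by
    by_cases hex : ∃ e : Fin t → Reg n, Function.Injective e
    · obtain ⟨e, he⟩ := hex
      refine ⟨∫ V, columnProb D z e V ∂(haar n), ⟨?_, ?_⟩, fun e' he' =>
        integral_columnProb_injective D z he' he⟩
      · exact integral_nonneg fun V => columnProb_nonneg D z _ V
      · refine (integral_mono (integrable_haar (continuous_columnProb D z _))
          (integrable_const 1) fun V => columnProb_le_one D z _ V).trans ?_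
        simp
    -- With more copies than basis states there are no injective tuples, and any constant in the
    -- unit interval will do.
    · exact ⟨0, ⟨le_rfl, zero_le_one⟩, fun e he => (hex ⟨e, he⟩).elim⟩
  have h1 := abs_integral_tensorPow_sub_le hm D z c hc h
  have h2 := abs_integral_tensorPow_sub_le le_rfl D z c hc h
  have h3 : (t : ℝ) ^ 2 / 2 ^ n ≤ (t : ℝ) ^ 2 / 2 ^ m :=
    div_le_div_of_nonneg_left (by positivity) (by positivity)
      (pow_le_pow_right₀ one_le_two hm)
  rw [hmax]
  rw [abs_le] at *
  constructor <;> linarith [h1.1, h1.2, h2.1, h2.2]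

/-! ### Parseval's identity for polynomials on tuples of roots of unity -/

section Parseval

variable {ι : Type*}

/-- The sum of the squares of the coefficients. -/
noncomputable def coeffNormSq (p : MvPolynomial ι ℂ) : ℝ := ∑ μ ∈ p.support, ‖p.coeff μ‖ ^ 2

theorem star_eq_inv_of_primitiveRoot {L : ℕ} (hL : L ≠ 0) {ζ : ℂ} (hζ : IsPrimitiveRoot ζ L) :
    star ζ = ζ⁻¹ := by
  rw [Complex.star_def, Complex.inv_def, Complex.normSq_eq_norm_sq, hζ.norm'_eq_one hL]
  simp

theorem sum_pow_mul_star_pow {L : ℕ} {ζ : ℂ} (hζ : IsPrimitiveRoot ζ L) {μ ν : ℕ} (hμ : μ < L)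
    (hν : ν < L) :
    ∑ k : Fin L, (ζ ^ (k : ℕ)) ^ μ * star ((ζ ^ (k : ℕ)) ^ ν) = if μ = ν then (L : ℂ) else 0 := by
  have hL : L ≠ 0 := by omega
  have hζ0 : ζ ≠ 0 := hζ.ne_zero hL
  have h1 : ∀ k : Fin L, (ζ ^ (k : ℕ)) ^ μ * star ((ζ ^ (k : ℕ)) ^ ν) =
      (ζ ^ μ * (ζ ^ ν)⁻¹) ^ (k : ℕ) := by
    intro k
    rw [star_pow, star_pow, star_eq_inv_of_primitiveRoot hL hζ, mul_pow, inv_pow, inv_pow, inv_pow,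
      ← pow_mul, ← pow_mul, ← pow_mul, ← pow_mul, mul_comm μ, mul_comm ν]
  rw [Finset.sum_congr rfl fun k _ => h1 k,
    Fin.sum_univ_eq_sum_range fun k => (ζ ^ μ * (ζ ^ ν)⁻¹) ^ k]
  split_ifs with h
  · subst h
    rw [mul_inv_cancel₀ (pow_ne_zero _ hζ0)]
    simp
  · have hω : ζ ^ μ * (ζ ^ ν)⁻¹ ≠ 1 := fun hω =>
      h (hζ.pow_inj hμ hν ((mul_inv_eq_one₀ (pow_ne_zero _ hζ0)).mp hω))
    rw [geom_sum_eq hω, mul_pow, inv_pow, ← pow_mul, ← pow_mul, mul_comm μ, mul_comm ν, pow_mul,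
      pow_mul, hζ.pow_eq_one]
    simp

theorem ofReal_norm_sq (z : ℂ) : (‖z‖ : ℂ) ^ 2 = z * star z := by
  rw [← Complex.ofReal_pow, Complex.star_def, Complex.mul_conj, Complex.normSq_eq_norm_sq]

/-- Monomials with exponents below `L` are orthogonal on the grid of `L`-th roots of unity, so a
finite sum replaces integration over the torus. -/
theorem sum_norm_sq_eval [Fintype ι] [DecidableEq ι] {L : ℕ} {ζ : ℂ} (hζ : IsPrimitiveRoot ζ L) (p : MvPolynomial ι ℂ)
    (hp : ∀ μ ∈ p.support, ∀ a, μ a < L) :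
    ∑ k : ι → Fin L, ‖MvPolynomial.eval (fun a => ζ ^ (k a : ℕ)) p‖ ^ 2 =
      (L : ℝ) ^ Fintype.card ι * coeffNormSq p := by
  have hprod : ∀ μ ∈ p.support, ∀ ν ∈ p.support, ∑ k : ι → Fin L,
      ∏ a, ((ζ ^ (k a : ℕ)) ^ μ a * star ((ζ ^ (k a : ℕ)) ^ ν a)) =
      if μ = ν then (L : ℂ) ^ Fintype.card ι else 0 := by
    intro μ hμ ν hν
    have h1 := Finset.prod_univ_sum (fun _ : ι => (Finset.univ : Finset (Fin L)))
      fun a k => (ζ ^ (k : ℕ)) ^ μ a * star ((ζ ^ (k : ℕ)) ^ ν a)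
    rw [Fintype.piFinset_univ] at h1
    rw [← h1, Finset.prod_congr rfl fun a _ => sum_pow_mul_star_pow hζ (hp μ hμ a) (hp ν hν a)]
    split_ifs with h
    · subst h
      simp
    · obtain ⟨a, ha⟩ := not_forall.mp fun H => h (Finsupp.ext H)
      exact Finset.prod_eq_zero (Finset.mem_univ a) (if_neg ha)
  apply Complex.ofReal_injective
  rw [coeffNormSq]
  simp only [Complex.ofReal_sum, Complex.ofReal_mul, Complex.ofReal_pow, ofReal_norm_sq,
    Complex.ofReal_natCast]
  have hexp : ∀ k : ι → Fin L, MvPolynomial.eval (fun a => ζ ^ (k a : ℕ)) p *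
      star (MvPolynomial.eval (fun a => ζ ^ (k a : ℕ)) p) =
      ∑ μ ∈ p.support, ∑ ν ∈ p.support, p.coeff μ * star (p.coeff ν) *
        ∏ a, ((ζ ^ (k a : ℕ)) ^ μ a * star ((ζ ^ (k a : ℕ)) ^ ν a)) := by
    intro k
    rw [MvPolynomial.eval_eq', star_sum, Finset.sum_mul_sum]
    refine Finset.sum_congr rfl fun μ _ => Finset.sum_congr rfl fun ν _ => ?_
    rw [star_mul', star_prod, Finset.prod_mul_distrib]
    ring
  rw [Finset.sum_congr rfl fun k _ => hexp k, Finset.sum_comm, Finset.mul_sum]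
  refine Finset.sum_congr rfl fun μ hμ => ?_
  rw [Finset.sum_comm, Finset.sum_congr rfl fun ν hν => by rw [← Finset.mul_sum, hprod μ hμ ν hν]]
  simp only [mul_ite, mul_zero]
  rw [Finset.sum_ite_eq, if_pos hμ]
  ring

/-- Multiplication by a variable only shifts the coefficients. -/
theorem coeffNormSq_mul_X (p : MvPolynomial ι ℂ) (a : ι) (s : Finset (ι →₀ ℕ)) :
    ∑ μ ∈ s, ‖(p * MvPolynomial.X a).coeff μ‖ ^ 2 ≤ coeffNormSq p := by
  classical
  have h1 : ∑ μ ∈ s, ‖(p * MvPolynomial.X a).coeff μ‖ ^ 2 ≤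
      ∑ μ ∈ (p * MvPolynomial.X a).support, ‖(p * MvPolynomial.X a).coeff μ‖ ^ 2 := by
    refine (Finset.sum_le_sum_of_subset_of_nonneg Finset.subset_union_left
      fun _ _ _ => by positivity).trans (le_of_eq (Finset.sum_subset Finset.subset_union_right
        fun μ _ hμ => ?_).symm)
    rw [MvPolynomial.notMem_support_iff.mp hμ]
    simp
  refine h1.trans (le_of_eq ?_)
  rw [MvPolynomial.support_mul_X, Finset.sum_map, coeffNormSq]
  refine Finset.sum_congr rfl fun μ _ => ?_
  rw [addRightEmbedding_apply, MvPolynomial.coeff_mul_X]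

theorem norm_sum_sq_le [Fintype ι] (s : Finset ι) (f : ι → ℂ) {c : ℝ} (hc : (s.card : ℝ) ≤ c) :
    ‖∑ a ∈ s, f a‖ ^ 2 ≤ c * ∑ a, ‖f a‖ ^ 2 := by
  have h1 : ‖∑ a ∈ s, f a‖ ^ 2 ≤ (∑ a ∈ s, ‖f a‖) ^ 2 :=
    pow_le_pow_left₀ (norm_nonneg _) (norm_sum_le _ _) 2
  have h2 : (∑ a ∈ s, ‖f a‖) ^ 2 ≤ s.card * ∑ a ∈ s, ‖f a‖ ^ 2 := sq_sum_le_card_mul_sum_sq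
  have h3 : ∑ a ∈ s, ‖f a‖ ^ 2 ≤ ∑ a, ‖f a‖ ^ 2 :=
    Finset.sum_le_sum_of_subset_of_nonneg (Finset.subset_univ s) fun a _ _ => sq_nonneg ‖f a‖
  exact h1.trans (h2.trans (mul_le_mul hc h3 (Finset.sum_nonneg fun a _ => sq_nonneg _)
    (le_trans (Nat.cast_nonneg _) hc)))

/-- A coefficient at `μ` of the product receives contributions only from the variables that occur in
`μ`, at most `d + 1` of them by degree. Cauchy–Schwarz therefore costs `d + 1` and not the total
number of variables, which is exponential in the application. -/
theorem coeffNormSq_mul_linear_le [Fintype ι] (p : MvPolynomial ι ℂ) (d : ℕ) (hp : p.totalDegree ≤ d)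
    (q : ι → ℂ) :
    coeffNormSq (p * ∑ a, MvPolynomial.C (q a) * MvPolynomial.X a) ≤
      (d + 1) * coeffNormSq p * ∑ a, ‖q a‖ ^ 2 := by
  classical
  obtain ⟨r, hr⟩ : ∃ r, r = p * ∑ a, MvPolynomial.C (q a) * MvPolynomial.X a := ⟨_, rfl⟩
  rw [← hr]
  obtain ⟨c, hc⟩ : ∃ c : ι → (ι →₀ ℕ) → ℂ, ∀ a μ, c a μ = (p * MvPolynomial.X a).coeff μ :=
    ⟨_, fun _ _ => rfl⟩
  have hcX : ∀ a, ∑ μ ∈ r.support, ‖c a μ‖ ^ 2 ≤ coeffNormSq p := by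
    intro a
    simp only [hc]
    exact coeffNormSq_mul_X p a _
  have hcoeff : ∀ μ, r.coeff μ = ∑ a ∈ μ.support, q a * c a μ := by
    intro μ
    simp only [hc]
    rw [hr, Finset.mul_sum, MvPolynomial.coeff_sum]
    rw [← Finset.sum_subset (Finset.subset_univ μ.support)]
    · refine Finset.sum_congr rfl fun a _ => ?_
      rw [mul_left_comm, MvPolynomial.coeff_C_mul]
    · intro a _ ha
      rw [mul_left_comm, MvPolynomial.coeff_C_mul, MvPolynomial.coeff_mul_X', if_neg ha, mul_zero]
  have hdeg : ∀ μ ∈ r.support, (μ.support.card : ℝ) ≤ d + 1 := by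
    intro μ hμ
    have h1 : (μ.sum fun _ e => e) ≤ r.totalDegree := MvPolynomial.le_totalDegree hμ
    have h2 : r.totalDegree ≤ d + 1 := by
      rw [hr]
      refine (MvPolynomial.totalDegree_mul _ _).trans (add_le_add hp ?_)
      refine MvPolynomial.totalDegree_finsetSum_le fun a _ => ?_
      refine (MvPolynomial.totalDegree_mul _ _).trans ?_
      rw [MvPolynomial.totalDegree_C, MvPolynomial.totalDegree_X]
    have h3 : μ.support.card ≤ μ.sum fun _ e => e := by
      rw [Finsupp.sum, Finset.card_eq_sum_ones]
      exact Finset.sum_le_sum fun a ha => Nat.one_le_iff_ne_zero.2 (Finsupp.mem_support_iff.mp ha)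
    exact_mod_cast h3.trans (h1.trans h2)
  have hbound : ∀ μ ∈ r.support, ‖r.coeff μ‖ ^ 2 ≤
      (d + 1) * ∑ a, ‖q a‖ ^ 2 * ‖c a μ‖ ^ 2 := by
    intro μ hμ
    rw [hcoeff μ]
    simpa only [norm_mul, mul_pow] using
      norm_sum_sq_le μ.support (fun a => q a * c a μ) (hdeg μ hμ)
  calc coeffNormSq r ≤ ∑ μ ∈ r.support, (d + 1 : ℝ) *
        ∑ a, ‖q a‖ ^ 2 * ‖c a μ‖ ^ 2 := Finset.sum_le_sum hbound
    _ = (d + 1) * ∑ a, ‖q a‖ ^ 2 * ∑ μ ∈ r.support, ‖c a μ‖ ^ 2 := by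
        rw [← Finset.mul_sum, Finset.sum_comm]
        simp only [Finset.mul_sum]
    _ ≤ (d + 1) * ∑ a, ‖q a‖ ^ 2 * coeffNormSq p := by
        gcongr with a _
        exact hcX _
    _ = _ := by rw [← Finset.sum_mul]; ring

end Parseval

/-! ### Copies of a Haar random state do not help to prepare another copy -/

/-- Hadamard gates on all qubits. -/
noncomputable def hadamardUni (n : ℕ) : Uni n :=
  ⟨Matrix.of fun a b => ∏ i, GateKind.matH (fun _ => a i) (fun _ => b i), by
    rw [Matrix.mem_unitaryGroup_iff]
    ext a c
    have hH := Matrix.mem_unitaryGroup_iff.mp (GateKind.mat_unitary GateKind.H)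
    have h1 : ∀ s u : Bool, ∑ v : Bool, GateKind.matH (fun _ => s) (fun _ => v) *
        star (GateKind.matH (fun _ => u) (fun _ => v)) = if s = u then 1 else 0 := by
      intro s u
      have := congrFun (congrFun hH (fun _ => s)) (fun _ => u)
      rw [Matrix.mul_apply, sum_reg_one, Matrix.star_apply, Matrix.star_apply,
        Matrix.one_apply, if_congr (reg_one_eq _ _) rfl rfl] at this
      rw [Fintype.sum_bool, add_comm]
      exact this
    rw [Matrix.mul_apply]
    simp only [Matrix.star_apply, Matrix.of_apply, star_prod, ← Finset.prod_mul_distrib]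
    have h2 := Finset.prod_univ_sum (fun _ : Fin n => (Finset.univ : Finset Bool)) fun i v =>
      GateKind.matH (fun _ => a i) (fun _ => v) * star (GateKind.matH (fun _ => c i) (fun _ => v))
    rw [Fintype.piFinset_univ] at h2
    rw [← h2, Finset.prod_congr rfl fun i _ => h1 (a i) (c i), Matrix.one_apply]
    split_ifs with h
    · subst h
      simp
    · obtain ⟨i, hi⟩ := not_forall.mp fun H => h (funext H)
      exact Finset.prod_eq_zero (Finset.mem_univ i) (if_neg hi)⟩

/-- Flatness is the only property of this unitary, besides unitarity, that the argument needs: it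
spreads any column evenly over all the phases. -/
theorem norm_sq_hadamardUni {n : ℕ} (a b : Reg n) :
    ‖(hadamardUni n : Op n) a b‖ ^ 2 = ((2 : ℝ) ^ n)⁻¹ := by
  have h1 : ∀ i, ‖GateKind.matH (fun _ => a i) (fun _ => b i)‖ ^ 2 = 2⁻¹ := by
    intro i
    rw [GateKind.matH, Matrix.of_apply, norm_mul, mul_pow]
    have h2 : ‖((Real.sqrt 2 : ℝ) : ℂ)⁻¹‖ ^ 2 = 2⁻¹ := by
      rw [norm_inv, Complex.norm_real, inv_pow, Real.norm_eq_abs, sq_abs, Real.sq_sqrt zero_le_two]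
    rw [h2]
    split_ifs <;> simp
  change ‖∏ i, GateKind.matH (fun _ => a i) (fun _ => b i)‖ ^ 2 = _
  rw [norm_prod, ← Finset.prod_pow,
    Finset.prod_congr rfl fun i _ => h1 i]
  simp

/-- A diagonal unitary. -/
noncomputable def diagUni {n : ℕ} (z : Reg n → ℂ) (hz : ∀ a, z a * star (z a) = 1) : Uni n :=
  ⟨Matrix.diagonal z, by
    rw [Matrix.mem_unitaryGroup_iff, Matrix.star_eq_conjTranspose, Matrix.diagonal_conjTranspose,
      Matrix.diagonal_mul_diagonal, ← Matrix.diagonal_one]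
    congr 1
    funext a
    exact hz a⟩

theorem mul_diagUni_mul_apply {n : ℕ} (V W : Op n) (z : Reg n → ℂ) (x y : Reg n) :
    (V * (Matrix.diagonal z * W)) x y = ∑ a, V x a * W a y * z a := by
  rw [Matrix.mul_apply]
  refine Finset.sum_congr rfl fun a _ => ?_
  rw [Matrix.diagonal_mul]
  ring

theorem sum_norm_sq_vecMul {n : ℕ} (V : Uni n) (l : Reg n → ℂ) :
    ∑ b, ‖∑ a, l a * (V : Op n) a b‖ ^ 2 = ∑ a, ‖l a‖ ^ 2 := by
  have hV : (V : Op n)ᵀ ∈ Matrix.unitaryGroup (Reg n) ℂ := by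
    rw [Matrix.mem_unitaryGroup_iff]
    change (V : Op n)ᵀ * ((V : Op n)ᴴ)ᵀ = 1
    rw [← Matrix.transpose_mul, ← Matrix.star_eq_conjTranspose, Matrix.mem_unitaryGroup_iff'.mp V.2, Matrix.transpose_one]
  refine Eq.trans (Finset.sum_congr rfl fun b _ => ?_) (sum_norm_sq_mulVec hV l)
  rw [Matrix.mulVec_transpose, Matrix.vecMul, dotProduct]

/-- The polynomial in the phases `z` that gives an amplitude on the columns of `V * diag z * W`. -/
noncomputable def amplitudePoly {n t : ℕ} (V W : Op n) (c : Reg (t * n) → ℂ) (e : Fin t → Reg n) :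
    MvPolynomial (Reg n) ℂ :=
  ∑ y, MvPolynomial.C (c y) * ∏ j : Fin t,
    ∑ a, MvPolynomial.C (V (blk y (j * n) n) a * W a (e j)) * MvPolynomial.X a

theorem totalDegree_linear_le {ι : Type*} [Fintype ι] (q : ι → ℂ) :
    (∑ a, MvPolynomial.C (q a) * MvPolynomial.X a : MvPolynomial ι ℂ).totalDegree ≤ 1 := by
  refine MvPolynomial.totalDegree_finsetSum_le fun a _ => ?_
  refine (MvPolynomial.totalDegree_mul _ _).trans ?_
  rw [MvPolynomial.totalDegree_C, MvPolynomial.totalDegree_X]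

theorem amplitudePoly_totalDegree {n t : ℕ} (V W : Op n) (c : Reg (t * n) → ℂ)
    (e : Fin t → Reg n) : (amplitudePoly V W c e).totalDegree ≤ t := by
  refine MvPolynomial.totalDegree_finsetSum_le fun y _ => ?_
  refine (MvPolynomial.totalDegree_mul _ _).trans ?_
  rw [MvPolynomial.totalDegree_C, zero_add]
  refine (MvPolynomial.totalDegree_finsetProd _ _).trans ?_
  refine (Finset.sum_le_sum fun j _ => totalDegree_linear_le _).trans ?_
  simp

theorem eval_amplitudePoly {n t : ℕ} (V W : Op n) (c : Reg (t * n) → ℂ) (e : Fin t → Reg n)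
    (z : Reg n → ℂ) : MvPolynomial.eval z (amplitudePoly V W c e) =
      ∑ y, c y * columnState (V * (Matrix.diagonal z * W)) e y := by
  simp only [amplitudePoly, map_sum, map_mul, map_prod, MvPolynomial.eval_C, MvPolynomial.eval_X,
    columnState, mul_diagUni_mul_apply]

theorem support_lt_of_totalDegree {ι : Type*} (p : MvPolynomial ι ℂ) {L : ℕ}
    (hp : p.totalDegree < L) : ∀ μ ∈ p.support, ∀ a, μ a < L := by
  intro μ hμ a
  refine lt_of_le_of_lt ?_ hp
  refine le_trans ?_ (MvPolynomial.le_totalDegree hμ)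
  by_cases ha : a ∈ μ.support
  · exact Finset.single_le_sum (f := fun a => μ a) (fun _ _ => Nat.zero_le _) ha
  · rw [Finsupp.notMem_support_iff.mp ha]
    exact Nat.zero_le _

/-- The columns of `V * diag z * W` are linear in `z`, so the first amplitude is a polynomial of
degree at most `t` and the second a linear form of squared norm `2 ^ (-n)`, by flatness of `W`.
Their product has degree at most `t + 1`, below the order `t + 2` of the root, so Parseval applies
to both sides. -/
theorem sum_phases_le {n t : ℕ} (V : Uni n) (W : Op n) (c : Reg (t * n) → ℂ) (e : Fin t → Reg n)
    (l : Reg n → ℂ) (x : Reg n) (hW : ∀ a b, ‖W a b‖ ^ 2 = ((2 : ℝ) ^ n)⁻¹)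
    (hl : ∑ a, ‖l a‖ ^ 2 = 1) {ζ : ℂ} (hζ : IsPrimitiveRoot ζ (t + 2)) :
    ∑ k : Reg n → Fin (t + 2),
      (‖∑ y, c y * columnState ((V : Op n) * (Matrix.diagonal (fun a => ζ ^ (k a : ℕ)) * W)) e y‖ ^ 2 *
      ‖∑ a, l a * ((V : Op n) * (Matrix.diagonal (fun a => ζ ^ (k a : ℕ)) * W)) a x‖ ^ 2) ≤
    (t + 1) * ((2 : ℝ) ^ n)⁻¹ * ∑ k : Reg n → Fin (t + 2),
      ‖∑ y, c y * columnState ((V : Op n) * (Matrix.diagonal (fun a => ζ ^ (k a : ℕ)) * W)) e y‖ ^ 2 := by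
  set P := amplitudePoly (V : Op n) W c e with hP
  let q : Reg n → ℂ := fun b => (∑ a, l a * (V : Op n) a b) * W b x
  have hPd := amplitudePoly_totalDegree (V : Op n) W c e
  have hq : ∀ z : Reg n → ℂ, MvPolynomial.eval z
      (∑ a, MvPolynomial.C (q a) * MvPolynomial.X a) =
      ∑ a, l a * ((V : Op n) * (Matrix.diagonal z * W)) a x := by
    intro z
    simp only [map_sum, map_mul, MvPolynomial.eval_C, MvPolynomial.eval_X, mul_diagUni_mul_apply,
      Finset.mul_sum, q, Finset.sum_mul]
    rw [Finset.sum_comm]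
    exact Finset.sum_congr rfl fun a _ => Finset.sum_congr rfl fun b _ => by ring
  simp only [← eval_amplitudePoly, ← hq, ← mul_pow, ← norm_mul, ← map_mul]
  rw [sum_norm_sq_eval hζ, sum_norm_sq_eval hζ]
  · have h1 := coeffNormSq_mul_linear_le P t hPd q
    have h2 : ∑ a, ‖q a‖ ^ 2 = ((2 : ℝ) ^ n)⁻¹ := by
      simp only [q, norm_mul, mul_pow, hW]
      rw [← Finset.sum_mul, sum_norm_sq_vecMul, hl, one_mul]
    rw [h2] at h1
    refine (mul_le_mul_of_nonneg_left h1 (by positivity)).trans (le_of_eq ?_)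
    ring
  · exact support_lt_of_totalDegree _ (by omega)
  · refine support_lt_of_totalDegree _ (lt_of_le_of_lt (MvPolynomial.totalDegree_mul _ _) ?_)
    have := totalDegree_linear_le q
    omega

theorem continuous_amplitude {n t : ℕ} (c : Reg (t * n) → ℂ) (e : Fin t → Reg n) :
    Continuous fun V : Uni n => ‖∑ y, c y * columnState (V : Op n) e y‖ ^ 2 :=
  (continuous_norm.comp (continuous_finsetSum _ fun y _ =>
    continuous_const.mul (continuous_columnState e y))).pow 2

theorem continuous_overlap {n : ℕ} (l : Reg n → ℂ) (x : Reg n) :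
    Continuous fun V : Uni n => ‖∑ a, l a * (V : Op n) a x‖ ^ 2 :=
  (continuous_norm.comp (continuous_finsetSum _ fun _ _ =>
    continuous_const.mul (continuous_subtype_val.matrix_elem _ _))).pow 2

/-- Right invariance allows averaging over all phases inside the Haar integral, and the resulting
inequality holds pointwise in `V`. No distinctness of the columns `e j` and `x` is needed. -/
theorem integral_amplitude_mul_overlap_le {n t : ℕ} (c : Reg (t * n) → ℂ) (e : Fin t → Reg n)
    (l : Reg n → ℂ) (x : Reg n) (hl : ∑ a, ‖l a‖ ^ 2 = 1) :
    ∫ V : Uni n, ‖∑ y, c y * columnState (V : Op n) e y‖ ^ 2 * ‖∑ a, l a * (V : Op n) a x‖ ^ 2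
      ∂(haar n) ≤ (t + 1) * ((2 : ℝ) ^ n)⁻¹ *
        ∫ V : Uni n, ‖∑ y, c y * columnState (V : Op n) e y‖ ^ 2 ∂(haar n) := by
  obtain ⟨ζ, hζ⟩ : ∃ ζ : ℂ, IsPrimitiveRoot ζ (t + 2) := ⟨_, Complex.isPrimitiveRoot_exp _ (by omega)⟩
  have hz : ∀ (k : Reg n → Fin (t + 2)) a, ζ ^ (k a : ℕ) * star (ζ ^ (k a : ℕ)) = 1 := by
    intro k a
    rw [star_pow, star_eq_inv_of_primitiveRoot (by omega) hζ, inv_pow,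
      mul_inv_cancel₀ (pow_ne_zero _ (hζ.ne_zero (by omega)))]
  have hf := continuous_amplitude c e
  have hg := continuous_overlap l x
  let Y : (Reg n → Fin (t + 2)) → Uni n := fun k => diagUni _ (hz k) * hadamardUni n
  have key : ∀ f : Uni n → ℝ, Continuous f → (Fintype.card (Reg n → Fin (t + 2)) : ℝ) *
      ∫ V, f V ∂(haar n) = ∫ V, ∑ k, f (V * Y k) ∂(haar n) := by
    intro f hf
    rw [integral_finsetSum _ fun k _ => integrable_haar
      (show Continuous fun V => f (V * Y k) from hf.comp (continuous_id.mul continuous_const)),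
      Finset.sum_congr rfl fun k _ => integral_haar_mul_right f (Y k), Finset.sum_const,
      Finset.card_univ, nsmul_eq_mul]
  have hpos : (0 : ℝ) < Fintype.card (Reg n → Fin (t + 2)) := by exact_mod_cast Fintype.card_pos
  refine le_of_mul_le_mul_left ?_ hpos
  have hfg := key (fun V : Uni n => ‖∑ y, c y * columnState (V : Op n) e y‖ ^ 2 *
    ‖∑ a, l a * (V : Op n) a x‖ ^ 2) (hf.mul hg)
  rw [hfg, mul_left_comm, key _ hf, ← integral_const_mul]
  refine integral_mono (integrable_haar ?_) (integrable_haar ?_) fun V => ?_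
  · exact continuous_finsetSum _ fun k _ =>
      (hf.mul hg).comp (continuous_id.mul continuous_const)
  · exact continuous_const.mul (continuous_finsetSum _ fun k _ =>
      hf.comp (continuous_id.mul continuous_const))
  · exact sum_phases_le V _ c e l x norm_sq_hadamardUni hl hζ

theorem vprdmVerify_vprdm {n m : ℕ} (hm : m ≤ n) (U V : Uni n) :
    vprdmVerify U m (vprdm V m) = ((2 : ℝ) ^ m)⁻¹ * ∑ x : Reg m, ∑ y : Reg m,
      ‖∑ a, star ((U : Op n) a (tail n y)) * (V : Op n) a (tail n x)‖ ^ 2 := by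
  have h1 : ∀ y : Reg m, ((U : Op n)ᴴ * vprdm V m * (U : Op n)) (tail n y) (tail n y) =
      (((2 : ℝ) ^ m)⁻¹ : ℝ) * ∑ x : Reg m,
        ((‖∑ a, star ((U : Op n) a (tail n y)) * (V : Op n) a (tail n x)‖ ^ 2 : ℝ) : ℂ) := by
    intro y
    rw [vprdm_eq hm, Matrix.mul_smul, Matrix.smul_mul, Matrix.smul_apply, Matrix.mul_sum,
      Matrix.sum_mul, Matrix.sum_apply, smul_eq_mul]
    congr 1
    · push_cast; rfl
    refine Finset.sum_congr rfl fun x _ => ?_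
    rw [show (U : Op n)ᴴ * ((V : Op n) * basisState (tail n x) * (V : Op n)ᴴ) * (U : Op n) =
      ((U : Op n)ᴴ * (V : Op n)) * basisState (tail n x) * ((U : Op n)ᴴ * (V : Op n))ᴴ by
        simp only [Matrix.conjTranspose_mul, Matrix.conjTranspose_conjTranspose, Matrix.mul_assoc],
      mul_basisState_mul_apply, Complex.ofReal_pow, ofReal_norm_sq, Matrix.mul_apply]
    rfl
  rw [vprdmVerify_eq hm, Finset.sum_congr rfl fun y _ => h1 y, ← Finset.mul_sum,
    Complex.re_ofReal_mul, Complex.re_sum, Finset.sum_comm]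
  congr 1
  refine Finset.sum_congr rfl fun y _ => ?_
  rw [← Complex.ofReal_sum, Complex.ofReal_re]

theorem continuous_vprdmVerify {n m : ℕ} (hm : m ≤ n) (U : Uni n) :
    Continuous fun V : Uni n => vprdmVerify U m (vprdm V m) := by
  simp only [vprdmVerify_vprdm hm]
  exact continuous_const.mul (continuous_finsetSum _ fun x _ => continuous_finsetSum _ fun y _ =>
    continuous_overlap _ _)

theorem sum_norm_sq_star_unitary {n : ℕ} (U : Uni n) (y : Reg n) :
    ∑ a, ‖star ((U : Op n) a y)‖ ^ 2 = 1 := by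
  simp only [norm_star]
  exact sum_norm_sq_unitary U.2 y

/-- The acceptance probability is `2 ^ (-m)` times a sum over `2 ^ m * 2 ^ m` pairs of columns of
the fixed `U` and of `V`, which leaves the factor `2 ^ m`. The outcome probability remains as a
weight, so that the bound can be summed over keys. -/
theorem integral_columnProb_mul_verify_le {n m t κ : ℕ} (hm : m ≤ n) (A : Circuit Gate (t * n) κ)
    (k : Reg κ) (e : Fin t → Reg n) (U : Uni n) :
    ∫ V, columnProb A k e V * vprdmVerify U m (vprdm V m) ∂(haar n) ≤
      (t + 1) * 2 ^ m * ((2 : ℝ) ^ n)⁻¹ * ∫ V, columnProb A k e V ∂(haar n) := by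
  simp only [vprdmVerify_vprdm hm, columnProb, outcomeProb_run_pureState]
  have h1 : ∀ V : Uni n, (∑ r : Reg (A.w - κ), ‖∑ y, A.row (glue A.w k r) y * columnState (V : Op n) e y‖ ^ 2) *
      (((2 : ℝ) ^ m)⁻¹ * ∑ x : Reg m, ∑ y : Reg m,
        ‖∑ a, star ((U : Op n) a (tail n y)) * (V : Op n) a (tail n x)‖ ^ 2) =
      ((2 : ℝ) ^ m)⁻¹ * ∑ r : Reg (A.w - κ), ∑ x : Reg m, ∑ y : Reg m,
        ‖∑ y, A.row (glue A.w k r) y * columnState (V : Op n) e y‖ ^ 2 *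
          ‖∑ a, star ((U : Op n) a (tail n y)) * (V : Op n) a (tail n x)‖ ^ 2 := by
    intro V
    rw [mul_left_comm, Finset.sum_mul]
    simp only [Finset.mul_sum]
  have hc : ∀ (r : Reg (A.w - κ)) (x y : Reg m), Continuous fun V : Uni n =>
      ‖∑ y, A.row (glue A.w k r) y * columnState (V : Op n) e y‖ ^ 2 *
        ‖∑ a, star ((U : Op n) a (tail n y)) * (V : Op n) a (tail n x)‖ ^ 2 := fun r x y =>
    (continuous_amplitude _ e).mul (continuous_overlap _ _)
  simp only [h1]
  rw [integral_const_mul, integral_finsetSum _ fun r _ => integrable_haar (continuous_finsetSum _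
      fun x _ => continuous_finsetSum _ fun y _ => hc r x y),
    integral_finsetSum _ fun r _ => integrable_haar (continuous_amplitude _ e), Finset.mul_sum,
    Finset.mul_sum]
  refine Finset.sum_le_sum fun r _ => ?_
  rw [integral_finsetSum _ fun x _ => integrable_haar (continuous_finsetSum _ fun y _ =>
        hc r x y)]
  set J := ∫ V : Uni n, ‖∑ y, A.row (glue A.w k r) y * columnState (V : Op n) e y‖ ^ 2 ∂(haar n)
  have h2 : ∀ x : Reg m, ∫ V : Uni n, ∑ y : Reg m,
        ‖∑ y, A.row (glue A.w k r) y * columnState (V : Op n) e y‖ ^ 2 *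
          ‖∑ a, star ((U : Op n) a (tail n y)) * (V : Op n) a (tail n x)‖ ^ 2 ∂(haar n) ≤
      2 ^ m * ((t + 1) * ((2 : ℝ) ^ n)⁻¹ * J) := by
    intro x
    rw [integral_finsetSum _ fun y _ => integrable_haar (hc r x y)]
    refine (Finset.sum_le_sum fun y _ => integral_amplitude_mul_overlap_le _ e _ (tail n x)
      (sum_norm_sq_star_unitary U (tail n y))).trans (le_of_eq ?_)
    rw [Finset.sum_const, Finset.card_univ, nsmul_eq_mul, card_reg]
  refine (mul_le_mul_of_nonneg_left (Finset.sum_le_sum fun x _ => h2 x) (by positivity)).trans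
    (le_of_eq ?_)
  rw [Finset.sum_const, Finset.card_univ, nsmul_eq_mul, card_reg]
  field_simp

/-- A Haar random state cannot be guessed from `t` copies. -/
theorem integral_guess_le {n m t κ : ℕ} (hm : m ≤ n) (A : Circuit Gate (t * n) κ)
    (U : Reg κ → Uni n) :
    ∫ V, ∑ k, outcomeProb (A.run (tensorPow (vprdm V m) t)) k * vprdmVerify (U k) m (vprdm V m)
      ∂(haar n) ≤ (t + 1) * 2 ^ m * ((2 : ℝ) ^ n)⁻¹ := by
  have hc : ∀ k (e : Fin t → Reg n), Continuous fun V => columnProb A k e V *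
      vprdmVerify (U k) m (vprdm V m) := fun k e =>
    (continuous_columnProb A k e).mul (continuous_vprdmVerify hm (U k))
  have h1 : ∀ V : Uni n, ∑ k, outcomeProb (A.run (tensorPow (vprdm V m) t)) k *
      vprdmVerify (U k) m (vprdm V m) = ((2 : ℝ) ^ (t * m))⁻¹ * ∑ e : Fin t → Reg m, ∑ k,
        columnProb A k (fun j => tail n (e j)) V * vprdmVerify (U k) m (vprdm V m) := by
    intro V
    simp only [outcomeProb_tensorPow hm]
    rw [Finset.sum_comm, Finset.mul_sum]
    refine Finset.sum_congr rfl fun k _ => ?_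
    rw [mul_assoc, Finset.sum_mul]
  simp only [h1]
  rw [integral_const_mul, integral_finsetSum _ fun e _ => integrable_haar (continuous_finsetSum _
    fun k _ => hc k _)]
  have h2 : ∀ e : Fin t → Reg m, ∫ V : Uni n, ∑ k, columnProb A k (fun j => tail n (e j)) V *
      vprdmVerify (U k) m (vprdm V m) ∂(haar n) ≤ (t + 1) * 2 ^ m * ((2 : ℝ) ^ n)⁻¹ := by
    intro e
    rw [integral_finsetSum _ fun k _ => integrable_haar (hc k _)]
    refine (Finset.sum_le_sum fun k _ => integral_columnProb_mul_verify_le hm A k _ (U k)).trans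
      (le_of_eq ?_)
    -- The weights of the keys add up to one, so no union bound over the `2 ^ κ` keys is paid.
    rw [← Finset.mul_sum, ← integral_finsetSum _ fun k _ => integrable_haar
      (continuous_columnProb A k _)]
    simp only [sum_columnProb, integral_const, smul_eq_mul]
    simp
  refine (mul_le_mul_of_nonneg_left (Finset.sum_le_sum fun e _ => h2 e) (by positivity)).trans
    (le_of_eq ?_)
  rw [Finset.sum_const, Finset.card_univ, nsmul_eq_mul, Fintype.card_fun, Fintype.card_fin,
    Nat.cast_pow, card_reg, ← pow_mul, mul_comm m t, ← mul_assoc, inv_mul_cancel₀ (by positivity),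
    one_mul]

/-! ### The circuits are generated in polynomial time -/

/-- The description of a gate that is named by `c` and acts on the wires `ws`. -/
def gateD (c : ℕ) (ws : List ℕ) : Data :=
  Data.node (Data.ofNat c) (Data.ofList (ws.map Data.ofNat))

/-- Once the side conditions hold, the width `w` disappears from the description and only wire
numbers remain. A block of gates is then described by loops over unary counters. -/
theorem data_xL {w t : ℕ} (h : t < w) : (xL w t).map Gate.data = [gateD 0 [t]] := by
  rw [xL, dif_pos h]; rfl

theorem data_hL {w t : ℕ} (h : t < w) : (hL w t).map Gate.data = [gateD 1 [t]] := by
  rw [hL, dif_pos h]; rfl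

theorem data_cnotL {w c t : ℕ} (hc : c < w) (ht : t < w) (h : c ≠ t) :
    (cnotL w c t).map Gate.data = [gateD 4 [c, t]] := by
  rw [cnotL, dif_pos ⟨hc, ht, h⟩]; rfl

theorem data_ccnotL {w c d t : ℕ} (hc : c < w) (hd : d < w) (ht : t < w) (h : c ≠ d)
    (h' : c ≠ t) (h'' : d ≠ t) : (ccnotL w c d t).map Gate.data = [gateD 5 [c, d, t]] := by
  rw [ccnotL, dif_pos ⟨hc, hd, ht, h, h', h''⟩]; rfl

/-- The description of three controlled bit flips that exchange two wires. -/
def swapD (a b : ℕ) : List Data := [gateD 4 [a, b], gateD 4 [b, a], gateD 4 [a, b]]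

theorem data_swapL {w a b : ℕ} (ha : a < w) (hb : b < w) (h : a ≠ b) :
    (swapL w a b).map Gate.data = swapD a b := by
  rw [swapL, List.map_append, List.map_append, data_cnotL ha hb h, data_cnotL hb ha h.symm]
  rfl

theorem data_flatMap {α : Type} (data : α → Data) (c : ℕ) (f : ℕ → List α)
    (g : ℕ → List Data) (h : ∀ i < c, (f i).map data = g i) :
    ((List.range c).flatMap f).map data = (List.range c).flatMap g := by
  rw [List.map_flatMap]
  exact List.flatMap_congr fun i hi => h i (List.mem_range.mp hi)

theorem data_hBlock {w a c : ℕ} (h : a + c ≤ w) :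
    (hBlock w a c).map Gate.data = (List.range c).flatMap fun i => [gateD 1 [a + i]] :=
  data_flatMap _ _ _ _ fun i hi => data_hL (by omega)

theorem data_cnotBlock {w a b c : ℕ} (ha : a + c ≤ w) (hb : b + c ≤ w)
    (hab : a + c ≤ b ∨ b + c ≤ a) :
    (cnotBlock w a b c).map Gate.data = (List.range c).flatMap fun i => [gateD 4 [a + i, b + i]] :=
  data_flatMap _ _ _ _ fun i hi => data_cnotL (by omega) (by omega) (by omega)

theorem data_swapBlock {w a b c : ℕ} (hb : b + c ≤ w) (hab : a + c ≤ b) :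
    (swapBlock w a b c).map Gate.data = (List.range c).flatMap fun i => swapD (a + i) (b + i) :=
  data_flatMap _ _ _ _ fun i hi => data_swapL (by omega) (by omega) (by omega)

theorem data_chainBlock {W a b c : ℕ} (hab : a + c ≤ b) (hb : b + c < W) :
    (chainBlock W a b c).map Gate.data =
      (List.range c).flatMap fun i => [gateD 0 [a + i], gateD 5 [a + i, b + i, b + i + 1]] :=
  data_flatMap _ _ _ _ fun i hi => by
    rw [List.map_append, data_xL (by omega), data_ccnotL (by omega) (by omega) (by omega) (by omega)
      (by omega) (by omega)]
    rfl

theorem data_copyBlock {W n m s t : ℕ} (hm : m ≤ n) (hs : t * n ≤ s) (hW : s + t * m ≤ W) :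
    (copyBlock W n m s t).map Gate.data = (List.range t).flatMap fun c =>
      (List.range m).flatMap fun i => [gateD 4 [s + c * m + i, c * n + (n - m) + i]] :=
  data_flatMap _ _ _ _ fun c hc => by
    have h1 := Nat.mul_le_mul_right n (Nat.succ_le_of_lt hc)
    have h2 := Nat.mul_le_mul_right m (Nat.succ_le_of_lt hc)
    rw [Nat.succ_mul] at h1 h2
    exact data_cnotBlock (by omega) (by omega) (by omega)

theorem data_queryL {n W s : ℕ} (h : s + n ≤ W) :
    (queryL n W s).map OracleGate.data = [gateD 6 ((List.range n).map fun i => s + i)] := by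
  rw [queryL, dif_pos h]
  simp only [List.map_cons, List.map_nil, OracleGate.data, gateD, wiresData, List.map_map]
  congr 3
  refine List.ext_getElem (by simp) fun i h1 h2 => ?_
  simp
  rfl

theorem data_queryBlock {n W t : ℕ} (h : t * n ≤ W) :
    (queryBlock n W t).map OracleGate.data = (List.range t).flatMap fun c =>
      [gateD 6 ((List.range n).map fun i => c * n + i)] :=
  data_flatMap _ _ _ _ fun c hc => by
    have h1 := Nat.mul_le_mul_right n (Nat.succ_le_of_lt hc)
    rw [Nat.succ_mul] at h1
    exact data_queryL (by omega)

/-- The description of the inverse gate. -/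
def invD (d : Data) : Data :=
  Data.node (d.left.cond (d.left.right.cond (d.left.right.right.cond
    (d.left.right.right.right.cond d.left (Data.ofNat 2)) (Data.ofNat 3)) d.left) d.left) d.right

/-- Only the phase gate and its inverse, with codes `2` and `3`, are exchanged; the nested tests in
`invD` read the unary code digit by digit. -/
theorem data_inv {w : ℕ} (g : Gate w) : g.inv.data = invD g.data := by
  obtain ⟨k, q⟩ := g
  cases k <;> rfl

theorem size_invD_le (d : Data) : (invD d).size ≤ d.size + 8 := by
  have key : ∀ c : Data, ∀ x : Data, (x = c ∨ x = Data.ofNat 2 ∨ x = Data.ofNat 3) →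
      x.size ≤ c.size + 6 := by
    rintro c x (rfl | rfl | rfl)
    · omega
    · simp [Data.size_ofNat]
    · have := c.size_pos
      simp [Data.size_ofNat]
      omega
  have h1 := key d.left (d.left.cond (d.left.right.cond (d.left.right.right.cond
    (d.left.right.right.right.cond d.left (Data.ofNat 2)) (Data.ofNat 3)) d.left) d.left) (by
      generalize d.left = c
      cases c with
      | leaf => exact Or.inl rfl
      | node a b =>
        cases b with
        | leaf => exact Or.inl rfl
        | node a b =>
          cases b with
          | leaf => exact Or.inr (Or.inr rfl)
          | node a b => cases b with
            | leaf => exact Or.inr (Or.inl rfl)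
            | node a b => exact Or.inl rfl)
  rw [invD, Data.size]
  cases d with
  | leaf => simp only [Data.left, Data.right, Data.size] at *; omega
  | node a b => simp only [Data.left, Data.right, Data.size] at *; omega

namespace PolyTime

variable {α : Type*} {enc : α → Data}

theorem invD_polyTime : PolyTime _root_.id invD :=
  pair (cond id.left (cond id.left.right (cond id.left.right.right
    (cond id.left.right.right.right id.left (const _)) (const _)) id.left) id.left) id.right

theorem revInv {l : α → List Data} (hl : PolyTime enc fun a => Data.ofList (l a)) :
    PolyTime enc fun a => Data.ofList ((l a).reverse.map invD) := by
  have key : ∀ (l k : List Data), l.foldl (fun acc d => (fun x : Data => Data.node (invD x.left) x.right)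
      (Data.node d acc)) (Data.ofList k) = Data.ofList (l.reverse.map invD ++ k) := by
    intro l
    induction l with
    | nil => intro k; rfl
    | cons d l ih =>
      intro k
      rw [List.foldl_cons]
      refine (ih (invD d :: k)).trans ?_
      simp
  -- An entry of size `s` adds `s + 1` to the list and at most `s + 9` after inversion, hence the
  -- factor `9`.
  have hsz : ∀ l : List Data, (Data.ofList (l.reverse.map invD)).size ≤ 9 * (Data.ofList l).size := by
    intro l
    induction l with
    | nil => simp [Data.ofList, Data.size]
    | cons d l ih =>
      have h1 := Data.size_ofList_append (l.reverse.map invD) [invD d]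
      have h2 := size_invD_le d
      rw [List.reverse_cons, List.map_append, List.map_cons, List.map_nil]
      simp only [Data.ofList, Data.size] at *
      omega
  have := foldl (step := fun x => Data.node (invD x.left) x.right) hl leaf
    (pair (comp (encβ := _root_.id) invD_polyTime id.left) id.right)
    ⟨_, (PolyBounded.const 9).mul hl.size, fun a i => ?_⟩
  · exact this.congr fun a => by rw [show Data.leaf = Data.ofList [] from rfl, key, List.append_nil]
  · rw [show Data.leaf = Data.ofList [] from rfl, key, List.append_nil]
    refine (hsz _).trans (Nat.mul_le_mul_left 9 ?_)
    have h3 := Data.size_ofList_append ((l a).take i) ((l a).drop i)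
    have h4 := (Data.ofList ((l a).drop i)).size_pos
    rw [List.take_append_drop] at h3
    omega

theorem gate₁ (c : ℕ) {s : α → ℕ} (hs : PolyTime enc fun a => Data.ofNat (s a)) :
    PolyTime enc fun a => gateD c [s a] := (const _).pair (cons hs nil)

theorem gate₂ (c : ℕ) {s t : α → ℕ} (hs : PolyTime enc fun a => Data.ofNat (s a))
    (ht : PolyTime enc fun a => Data.ofNat (t a)) :
    PolyTime enc fun a => gateD c [s a, t a] := (const _).pair (cons hs (cons ht nil))

theorem gate₃ (c : ℕ) {s t u : α → ℕ} (hs : PolyTime enc fun a => Data.ofNat (s a))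
    (ht : PolyTime enc fun a => Data.ofNat (t a)) (hu : PolyTime enc fun a => Data.ofNat (u a)) :
    PolyTime enc fun a => gateD c [s a, t a, u a] :=
  (const _).pair (cons hs (cons ht (cons hu nil)))

theorem swapD {s t : α → ℕ} (hs : PolyTime enc fun a => Data.ofNat (s a))
    (ht : PolyTime enc fun a => Data.ofNat (t a)) :
    PolyTime enc fun a => Data.ofList (swapD (s a) (t a)) :=
  cons (gate₂ 4 hs ht) (cons (gate₂ 4 ht hs) (cons (gate₂ 4 hs ht) nil))

theorem hBlock {a c w : α → ℕ} (ha : PolyTime enc fun x => Data.ofNat (a x))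
    (hc : PolyTime enc fun x => Data.ofNat (c x)) (h : ∀ x, a x + c x ≤ w x) :
    PolyTime enc fun x => Data.ofList ((hBlock (w x) (a x) (c x)).map Gate.data) := by
  simp only [data_hBlock (h _)]
  exact flatMap hc (cons (gate₁ 1 (ha.weaken.add idx)) nil)

theorem cnotBlock {a b c w : α → ℕ} (ha : PolyTime enc fun x => Data.ofNat (a x))
    (hb : PolyTime enc fun x => Data.ofNat (b x)) (hc : PolyTime enc fun x => Data.ofNat (c x))
    (haw : ∀ x, a x + c x ≤ w x) (hbw : ∀ x, b x + c x ≤ w x)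
    (hab : ∀ x, a x + c x ≤ b x ∨ b x + c x ≤ a x) :
    PolyTime enc fun x => Data.ofList ((cnotBlock (w x) (a x) (b x) (c x)).map Gate.data) := by
  simp only [data_cnotBlock (haw _) (hbw _) (hab _)]
  exact flatMap hc (cons (gate₂ 4 (ha.weaken.add idx) (hb.weaken.add idx)) nil)

theorem swapBlock {a b c w : α → ℕ} (ha : PolyTime enc fun x => Data.ofNat (a x))
    (hb : PolyTime enc fun x => Data.ofNat (b x)) (hc : PolyTime enc fun x => Data.ofNat (c x))
    (hbw : ∀ x, b x + c x ≤ w x) (hab : ∀ x, a x + c x ≤ b x) :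
    PolyTime enc fun x => Data.ofList ((swapBlock (w x) (a x) (b x) (c x)).map Gate.data) := by
  simp only [data_swapBlock (hbw _) (hab _)]
  exact flatMap hc (swapD (ha.weaken.add idx) (hb.weaken.add idx))

theorem chainBlock {a b c w : α → ℕ} (ha : PolyTime enc fun x => Data.ofNat (a x))
    (hb : PolyTime enc fun x => Data.ofNat (b x)) (hc : PolyTime enc fun x => Data.ofNat (c x))
    (hbw : ∀ x, b x + c x < w x) (hab : ∀ x, a x + c x ≤ b x) :
    PolyTime enc fun x => Data.ofList ((chainBlock (w x) (a x) (b x) (c x)).map Gate.data) := by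
  simp only [data_chainBlock (hab _) (hbw _)]
  exact flatMap hc (cons (gate₁ 0 (ha.weaken.add idx)) (cons (gate₃ 5 (ha.weaken.add idx)
    (hb.weaken.add idx) (ofNat_succ (hb.weaken.add idx))) nil))

theorem checkBlock {a b c w : α → ℕ} (ha : PolyTime enc fun x => Data.ofNat (a x))
    (hb : PolyTime enc fun x => Data.ofNat (b x)) (hc : PolyTime enc fun x => Data.ofNat (c x))
    (hbw : ∀ x, b x + c x < w x) (hab : ∀ x, a x + c x ≤ b x) (hb0 : ∀ x, 0 < b x) :
    PolyTime enc fun x => Data.ofList ((checkBlock (w x) (a x) (b x) (c x)).map Gate.data) := by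
  have h1 : ∀ x, (VPRDM.checkBlock (w x) (a x) (b x) (c x)).map Gate.data = [gateD 0 [b x]] ++
      (VPRDM.chainBlock (w x) (a x) (b x) (c x)).map Gate.data ++ VPRDM.swapD 0 (b x + c x) := by
    intro x
    have := hbw x
    have := hb0 x
    rw [VPRDM.checkBlock, List.map_append, List.map_append, data_xL (by omega),
      data_swapL (by omega) (by omega) (by omega)]
  simp only [h1]
  exact ((cons (gate₁ 0 hb) nil).append (chainBlock ha hb hc hbw hab)).append
    (swapD (ofNat_const 0) (hb.add hc))

theorem copyBlock {W n m s t : α → ℕ} (hn : PolyTime enc fun x => Data.ofNat (n x))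
    (hm : PolyTime enc fun x => Data.ofNat (m x)) (hs : PolyTime enc fun x => Data.ofNat (s x))
    (ht : PolyTime enc fun x => Data.ofNat (t x)) (hmn : ∀ x, m x ≤ n x)
    (hsn : ∀ x, t x * n x ≤ s x) (hW : ∀ x, s x + t x * m x ≤ W x) :
    PolyTime enc fun x =>
      Data.ofList ((copyBlock (W x) (n x) (m x) (s x) (t x)).map Gate.data) := by
  simp only [data_copyBlock (hmn _) (hsn _) (hW _)]
  refine flatMap ht (flatMap hm.weaken (cons (gate₂ 4 ?_ ?_) nil))
  · exact (hs.weaken.weaken.add (idx.weaken.mul hm.weaken.weaken)).add idx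
  · exact ((idx.weaken.mul hn.weaken.weaken).add
      (hn.weaken.weaken.sub hm.weaken.weaken)).add idx

theorem queryBlock {W n t : α → ℕ} (hn : PolyTime enc fun x => Data.ofNat (n x))
    (ht : PolyTime enc fun x => Data.ofNat (t x)) (hW : ∀ x, t x * n x ≤ W x) :
    PolyTime enc fun x =>
      Data.ofList ((queryBlock (n x) (W x) (t x)).map OracleGate.data) := by
  simp only [data_queryBlock (hW _), gateD, List.map_map, Function.comp_def]
  refine flatMap ht (cons ((const _).pair (map (L := fun (p : α × ℕ) i => Data.ofNat (p.2 * n p.1 + i))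
    hn.weaken ?_)) nil)
  exact (idx.weaken.mul hn.weaken.weaken).add idx

end PolyTime

theorem unaryPolyTime_iff {f : ℕ → ℕ} :
    UnaryPolyTime f ↔ PolyTime Data.ofNat fun n => Data.ofNat (f n) := polyTimeGenerated_iff

theorem isQPT_iff {i o : ℕ → ℕ} {C : ∀ n, Circuit Gate (i n) (o n)} :
    IsQPT C ↔ PolyTime Data.ofNat (fun n => Data.ofNat (C n).w) ∧
      PolyTime Data.ofNat fun n => Data.ofList ((C n).gates.map Gate.data) :=
  polyTimeGenerated_iff.trans ⟨fun h => ⟨h.left, h.right⟩, fun h => h.1.pair h.2⟩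

theorem isOracleQPT_iff {i o : ℕ → ℕ} {C : ∀ n, Circuit (OracleGate n) (i n) (o n)} :
    IsOracleQPT C ↔ PolyTime Data.ofNat (fun n => Data.ofNat (C n).w) ∧
      PolyTime Data.ofNat fun n => Data.ofList ((C n).gates.map OracleGate.data) :=
  polyTimeGenerated_iff.trans ⟨fun h => ⟨h.left, h.right⟩, fun h => h.1.pair h.2⟩

section QPT

variable {κ m t : ℕ → ℕ}

theorem isQPT_keyGenCircuit (hκ : UnaryPolyTime κ) : IsQPT fun n => keyGenCircuit (κ n) := by
  rw [unaryPolyTime_iff] at hκ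
  exact isQPT_iff.2 ⟨hκ, PolyTime.hBlock (PolyTime.ofNat_const 0) hκ fun n =>
    (Nat.zero_add _).le⟩

theorem isQPT_stateGenCircuit (hκ : UnaryPolyTime κ) (hm : UnaryPolyTime m) (hmn : ∀ n, m n ≤ n)
    {G : ∀ n, Circuit Gate (κ n + n) n} (hG : IsQPT G) :
    IsQPT fun n => stateGenCircuit (κ n) n (m n) (G n) := by
  rw [unaryPolyTime_iff] at hκ hm
  obtain ⟨hw, hg⟩ := isQPT_iff.1 hG
  have hn : PolyTime Data.ofNat fun n => Data.ofNat n := PolyTime.id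
  have hi := fun n => (G n).input_le
  refine isQPT_iff.2 ⟨hw.add hm, ?_⟩
  simp only [stateGenCircuit, List.map_append, Gate.data_lift_map]
  refine ((PolyTime.hBlock hw hm fun n => le_rfl).append (PolyTime.cnotBlock hw
    (hκ.add (hn.sub hm)) hm (fun n => le_rfl) (fun n => ?_) fun n => ?_)).append hg
  · have := hi n; have := hmn n; omega
  · have := hi n; have := hmn n; omega

theorem isQPT_verCircuit (hκ : UnaryPolyTime κ) (hm : UnaryPolyTime m)
    {G : ∀ n, Circuit Gate (κ n + n) n} (hG : IsQPT G) :
    IsQPT fun n => verCircuit (κ n) n (m n) (G n) := by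
  rw [unaryPolyTime_iff] at hκ hm
  obtain ⟨hw, hg⟩ := isQPT_iff.1 hG
  have hn : PolyTime Data.ofNat fun n => Data.ofNat n := PolyTime.id
  have hi := fun n => (G n).input_le
  have hb := PolyTime.ofNat_succ (hw.add hn)
  have hginv : PolyTime Data.ofNat fun n =>
      Data.ofList (((G n).gates.reverse.map Gate.inv).map Gate.data) := by
    refine hg.revInv.congr fun n => ?_
    rw [← List.map_reverse, List.map_map, List.map_map]
    congr 2
    funext g
    exact (data_inv g).symm
  refine isQPT_iff.2 ⟨PolyTime.ofNat_succ (hb.add (hn.sub hm)), ?_⟩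
  simp only [verCircuit, uncomputeBlock, List.map_append, Gate.data_lift_map]
  refine ((((PolyTime.swapBlock hκ hw hn (fun n => ?_) fun n => ?_).append hg).append
    (PolyTime.swapBlock (PolyTime.ofNat_const 0) hw hn (fun n => ?_) fun n => ?_)).append
    hginv).append (PolyTime.checkBlock hκ hb (hn.sub hm) (fun n => ?_) (fun n => ?_) fun n => ?_)
  all_goals
    have := hi n
    omega

theorem isQPT_attackCircuit (hκ : UnaryPolyTime κ) {N I : ℕ → ℕ} (hN : UnaryPolyTime N)
    (hI : ∀ n, I n = N n + n) {A : ∀ n, Circuit Gate (N n) (κ n)} (hA : IsQPT A)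
    {V : ∀ n, Circuit Gate (κ n + n) 1} (hV : IsQPT V) :
    IsQPT fun n => attackCircuit (I n) (hI n) (A n) (V n) := by
  rw [unaryPolyTime_iff] at hκ hN
  obtain ⟨hAw, hAg⟩ := isQPT_iff.1 hA
  obtain ⟨hVw, hVg⟩ := isQPT_iff.1 hV
  have hn : PolyTime Data.ofNat fun n => Data.ofNat n := PolyTime.id
  have hi := fun n => (A n).input_le
  have ho := fun n => (A n).output_le
  have hi' := fun n => (V n).input_le
  have hr := hAw.add hVw
  refine isQPT_iff.2 ⟨((hκ.add hr).add hr).add hκ, ?_⟩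
  simp only [attackCircuit, List.map_append, Gate.data_lift_map]
  refine ((((PolyTime.swapBlock hN (hκ.add hr) hn (fun n => ?_) fun n => ?_).append hAg).append
    (PolyTime.cnotBlock (PolyTime.ofNat_const 0) ((hκ.add hr).add hr) hκ (fun n => ?_) (fun n => ?_)
      fun n => ?_)).append (PolyTime.swapBlock hκ (hκ.add hr) hr (fun n => ?_) fun n => ?_)).append
    hVg
  all_goals
    have := hi n
    have := ho n
    have := hi' n
    omega

theorem isOracleQPT_oracleCircuit (hm : UnaryPolyTime m) (hmn : ∀ n, m n ≤ n)
    (ht : UnaryPolyTime t) {D : ∀ n, Circuit Gate (t n * n) 1} (hD : IsQPT D) :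
    IsOracleQPT fun n => oracleCircuit (m n) (D n) := by
  rw [unaryPolyTime_iff] at hm ht
  obtain ⟨hw, hg⟩ := isQPT_iff.1 hD
  have hn : PolyTime Data.ofNat fun n => Data.ofNat n := PolyTime.id
  have hi := fun n => (D n).input_le
  refine isOracleQPT_iff.2 ⟨hw.add (ht.mul hm), ?_⟩
  have hbasic : ∀ {n w : ℕ} (l : List (Gate w)),
      (l.map (OracleGate.basic (n := n))).map OracleGate.data = l.map Gate.data := by
    intro n w l
    rw [List.map_map]
    rfl
  simp only [oracleCircuit, List.map_append, hbasic, Gate.data_lift_map]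
  refine (((PolyTime.hBlock hw (ht.mul hm) fun n => le_rfl).append
    (PolyTime.copyBlock hn hm hw ht hmn hi fun n => le_rfl)).append
    (PolyTime.queryBlock hn ht fun n => (hi n).trans (Nat.le_add_right _ _))).append hg

end QPT

/-! ### Negligible bounds -/

theorem LeNegl.mono {lam : ℕ → ℕ} {f g : ℕ → ℝ} (hg : LeNegl lam g) (h : ∀ n, f n ≤ g n) :
    LeNegl lam f := by
  obtain ⟨μ, hμ, hgμ⟩ := hg
  exact ⟨μ, hμ, fun n => (h n).trans (hgμ n)⟩

theorem LeNegl.add {lam : ℕ → ℕ} {f g : ℕ → ℝ} (hf : LeNegl lam f) (hg : LeNegl lam g) :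
    LeNegl lam fun n => f n + g n := by
  obtain ⟨μ, ⟨hμ, hμc⟩, hfμ⟩ := hf
  obtain ⟨ν, ⟨hν, hνc⟩, hgν⟩ := hg
  refine ⟨fun n => μ n + ν n, ⟨fun n => add_pos (hμ n) (hν n), fun c => ?_⟩,
    fun n => add_le_add (hfμ n) (hgν n)⟩
  obtain ⟨n₀, h₀⟩ := hμc (c + 1)
  obtain ⟨n₁, h₁⟩ := hνc (c + 1)
  refine ⟨max (max n₀ n₁) 1, fun n hn => ?_⟩
  simp only [max_lt_iff] at hn
  have h2 := h₀ n hn.1.1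
  have h3 := h₁ n hn.1.2
  have hn2 : (2 : ℝ) ≤ n := by exact_mod_cast hn.2
  have hpos : (0 : ℝ) < (n : ℝ) ^ c := by positivity
  refine (add_lt_add h2 h3).trans_le ?_
  rw [pow_succ, mul_inv, ← mul_add, ← two_mul]
  refine mul_le_of_le_one_right (by positivity) ?_
  rw [← div_eq_mul_inv, div_le_one (by linarith)]
  exact hn2

/-- The security parameter need not be injective or monotone in `n`, so the negligible function at
`L` is the supremum of `f` over the fibre of `L`, plus a tiny term for positivity. The fibre may be
infinite; the case `c = 0` makes the supremum finite. -/
theorem LeNegl.of_eventually {lam : ℕ → ℕ} {f : ℕ → ℝ}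
    (h : ∀ c : ℕ, ∃ n₀ : ℕ, ∀ n, n₀ ≤ n → f n ≤ (((lam n : ℝ) + 1) ^ c)⁻¹) : LeNegl lam f := by
  have hbd : ∀ L, BddAbove {r | ∃ n, lam n = L ∧ r = max (f n) 0} := by
    intro L
    obtain ⟨n₀, h₀⟩ := h 0
    refine ⟨1 + ∑ n ∈ Finset.range n₀, |f n|, ?_⟩
    rintro _ ⟨n, -, rfl⟩
    have hs : 0 ≤ ∑ n ∈ Finset.range n₀, |f n| := Finset.sum_nonneg fun _ _ => abs_nonneg _
    refine max_le ?_ (by linarith)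
    by_cases hn : n₀ ≤ n
    · have := h₀ n hn
      simp only [pow_zero, inv_one] at this
      linarith
    · have := Finset.single_le_sum (f := fun n => |f n|) (fun _ _ => abs_nonneg _)
        (Finset.mem_range.2 (not_le.1 hn))
      have h1 := le_abs_self (f n)
      linarith
  have h0 : ∀ L, 0 ≤ sSup {r | ∃ n, lam n = L ∧ r = max (f n) 0} := fun L =>
    Real.sSup_nonneg (by rintro _ ⟨n, -, rfl⟩; exact le_max_right _ _)
  refine ⟨fun L => sSup {r | ∃ n, lam n = L ∧ r = max (f n) 0} + (((L : ℝ) + 1) ^ L)⁻¹,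
    ⟨fun L => ?_, fun c => ?_⟩, fun n => ?_⟩
  · have : (0 : ℝ) < (((L : ℝ) + 1) ^ L)⁻¹ := by positivity
    linarith [h0 L]
  · obtain ⟨n₀, h₀⟩ := h (c + 1)
    -- Beyond this sum, no `n < n₀` can have security parameter `L`, so the eventual bound holds on
    -- the whole fibre.
    refine ⟨max (max (c + 1) 2) (∑ n ∈ Finset.range n₀, lam n), fun L hL => ?_⟩
    simp only [max_lt_iff] at hL
    have h1 : sSup {r | ∃ n, lam n = L ∧ r = max (f n) 0} ≤ (((L : ℝ) + 1) ^ (c + 1))⁻¹ := by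
      refine Real.sSup_le ?_ (by positivity)
      rintro _ ⟨n, rfl, rfl⟩
      refine max_le (h₀ n ?_) (by positivity)
      by_contra hn
      have := Finset.single_le_sum (f := lam) (fun _ _ => Nat.zero_le _)
        (Finset.mem_range.2 (not_le.1 hn))
      omega
    have h2 : (((L : ℝ) + 1) ^ L)⁻¹ ≤ (((L : ℝ) + 1) ^ (c + 1))⁻¹ :=
      inv_anti₀ (by positivity) (pow_le_pow_right₀ (by linarith [Nat.cast_nonneg (α := ℝ) L])
        (by omega))
    have hL2 : (2 : ℝ) < L := by exact_mod_cast hL.1.2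
    refine (add_le_add h1 h2).trans_lt ?_
    rw [pow_succ, mul_inv, ← mul_add, ← two_mul, ← div_eq_mul_inv]
    have h3 : (2 : ℝ) / (L + 1) < 1 := (div_lt_one (by linarith)).2 (by linarith)
    have h4 : (((L : ℝ) + 1) ^ c)⁻¹ ≤ ((L : ℝ) ^ c)⁻¹ :=
      inv_anti₀ (by positivity) (pow_le_pow_left₀ (by linarith) (by linarith) c)
    refine lt_of_lt_of_le ?_ h4
    exact mul_lt_of_lt_one_right (by positivity) h3
  · have h1 : max (f n) 0 ≤ sSup {r | ∃ i, lam i = lam n ∧ r = max (f i) 0} :=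
      le_csSup (hbd _) ⟨n, rfl, rfl⟩
    have h2 : (0 : ℝ) < (((lam n : ℝ) + 1) ^ lam n)⁻¹ := by positivity
    have := le_max_left (f n) 0
    linarith

theorem eval_le_pow (q : Polynomial ℕ) : ∃ k, ∀ n, 2 ≤ n → q.eval n ≤ n ^ k := by
  -- The sum `S` of the coefficients is at most `2 ^ S ≤ n ^ S`, so it is absorbed into the
  -- exponent.
  refine ⟨(∑ i ∈ Finset.range (q.natDegree + 1), q.coeff i) + q.natDegree, fun n hn => ?_⟩
  rw [Polynomial.eval_eq_sum_range, pow_add]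
  set S := ∑ i ∈ Finset.range (q.natDegree + 1), q.coeff i with hS
  have h1 : S ≤ n ^ S := (Nat.lt_two_pow_self).le.trans (Nat.pow_le_pow_left hn S)
  refine le_trans ?_ (Nat.mul_le_mul_right _ h1)
  rw [hS, Finset.sum_mul]
  refine Finset.sum_le_sum fun i hi => Nat.mul_le_mul_left _ (Nat.pow_le_pow_right (by omega) ?_)
  have := Finset.mem_range.1 hi
  omega

theorem UnaryPolyTime.le_pow {f : ℕ → ℕ} (hf : UnaryPolyTime f) :
    ∃ k, ∀ n, 2 ≤ n → f n + 1 ≤ n ^ k := by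
  obtain ⟨B, hB⟩ := (unaryPolyTime_iff.1 hf).ofNat_bounded
  obtain ⟨k, hk⟩ := eval_le_pow
    ((B + Polynomial.C 1).comp (Polynomial.C 2 * Polynomial.X + Polynomial.C 1))
  refine ⟨k, fun n hn => le_trans ?_ (hk n hn)⟩
  have := hB n
  rw [Data.size_ofNat] at this
  simpa using this

theorem UnaryPolyTime.add_one {f : ℕ → ℕ} (hf : UnaryPolyTime f) :
    UnaryPolyTime fun n => f n + 1 :=
  unaryPolyTime_iff.2 (PolyTime.ofNat_succ (unaryPolyTime_iff.1 hf))

theorem eventually_pow_le_two_pow {d : ℕ → ℕ}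
    (hd : (fun n : ℕ => Real.log n) =o[atTop] fun n : ℕ => (d n : ℝ)) (K : ℕ) :
    ∀ᶠ n : ℕ in atTop, (n : ℝ) ^ K ≤ 2 ^ d n := by
  have hlog : 0 < Real.log 2 := Real.log_pos one_lt_two
  -- With this constant the little-o bound gives `(K + 1) * log n ≤ d n * log 2`, slightly more than
  -- needed and valid also for `K = 0`.
  have hε : 0 < Real.log 2 / (K + 1) := by positivity
  filter_upwards [hd.def hε, eventually_ge_atTop 1] with n hn hn1
  have hn1' : (1 : ℝ) ≤ n := by exact_mod_cast hn1
  have hl : 0 ≤ Real.log n := Real.log_nonneg hn1'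
  rw [Real.norm_of_nonneg hl, Real.norm_of_nonneg (Nat.cast_nonneg _), div_mul_eq_mul_div,
    le_div_iff₀ (by positivity)] at hn
  rw [← Real.log_le_log_iff (by positivity) (by positivity), Real.log_pow, Real.log_pow]
  nlinarith

/-- `2 ^ d n` eventually beats every power of `n`. Since `lam` is polynomially bounded, powers of
`lam n` are covered as well. -/
theorem leNegl_div_two_pow {lam d : ℕ → ℕ} (hlam : UnaryPolyTime lam)
    (hd : (fun n : ℕ => Real.log n) =o[atTop] fun n : ℕ => (d n : ℝ)) {a : ℕ → ℝ} {k : ℕ}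
    (ha : ∀ n : ℕ, 2 ≤ n → a n ≤ (n : ℝ) ^ k) : LeNegl lam fun n => a n / 2 ^ d n := by
  obtain ⟨l, hl⟩ := hlam.le_pow
  refine LeNegl.of_eventually fun c => ?_
  obtain ⟨n₀, h₀⟩ := eventually_atTop.1 (eventually_pow_le_two_pow hd (k + l * c))
  refine ⟨max n₀ 2, fun n hn => ?_⟩
  have h1 := h₀ n (le_trans (le_max_left _ _) hn)
  have hn2 : 2 ≤ n := le_trans (le_max_right _ _) hn
  have hn0 : (0 : ℝ) < n := by exact_mod_cast (by omega : 0 < n)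
  have h2 : ((lam n : ℝ) + 1) ≤ (n : ℝ) ^ l := by exact_mod_cast hl n hn2
  have h3 : ((lam n : ℝ) + 1) ^ c ≤ (n : ℝ) ^ (l * c) := by
    rw [pow_mul]
    exact pow_le_pow_left₀ (by positivity) h2 c
  rw [div_le_iff₀ (by positivity), inv_mul_eq_div, le_div_iff₀ (by positivity)]
  calc a n * ((lam n : ℝ) + 1) ^ c ≤ (n : ℝ) ^ k * (n : ℝ) ^ (l * c) :=
        mul_le_mul (ha n hn2) h3 (by positivity) (by positivity)
    _ = (n : ℝ) ^ (k + l * c) := (pow_add _ _ _).symm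
    _ ≤ _ := h1

/-! ### The state generator -/

/-- Hermitian outputs have real diagonal entries. This lets the real part of a product of two such
entries split into a product of probabilities in `outcomeProb_attackCircuit`. -/
theorem Circuit.run_isHermitian {i o : ℕ} (C : Circuit Gate i o) {ρ : Op i} (h : ρ.IsHermitian) :
    (C.run ρ).IsHermitian := by
  have hp : (padZero C.input_le ρ).IsHermitian := by
    ext x y
    rw [Matrix.conjTranspose_apply, padZero_eq, padZero_eq, star_mul', star_mul', star_ind, star_ind,
      h.apply]
    ring
  have ht := Matrix.isHermitian_mul_mul_conjTranspose (totalOp Gate.op C.gates) hp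
  ext a b
  rw [Matrix.conjTranspose_apply, Circuit.run, keepFirst_apply, keepFirst_apply, star_sum]
  exact Finset.sum_congr rfl fun e _ => ht.apply _ _

theorem vprdm_isHermitian {n : ℕ} (V : Uni n) (m : ℕ) : (vprdm V m).IsHermitian := by
  refine Matrix.isHermitian_mul_mul_conjTranspose _ (Matrix.isHermitian_diagonal_of_self_adjoint _ ?_)
  funext x
  rw [Pi.star_apply]
  split_ifs <;> simp

theorem tensorPow_isHermitian {n : ℕ} {ρ : Op n} (h : ρ.IsHermitian) (t : ℕ) :
    (tensorPow ρ t).IsHermitian := by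
  ext x y
  rw [Matrix.conjTranspose_apply, tensorPow, Matrix.of_apply, Matrix.of_apply, star_prod]
  exact Finset.prod_congr rfl fun j _ => h.apply _ _

theorem tensorPow_succ_apply {n : ℕ} (ρ : Op n) (t : ℕ) (x y : Reg ((t + 1) * n)) :
    tensorPow ρ (t + 1) x y = tensorPow ρ t (blk x 0 (t * n)) (blk y 0 (t * n)) *
      ρ (blk x (t * n) n) (blk y (t * n) n) := by
  simp only [tensorPow, Matrix.of_apply, blk_eq_finProd]
  rw [Fin.prod_univ_castSucc]
  refine congrArg₂ (· * ·) (Finset.prod_congr rfl fun j _ => ?_) rfl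
  have hj := Nat.mul_le_mul_right n (Nat.succ_le_of_lt j.2)
  rw [Nat.succ_mul] at hj
  rw [blk_blk x hj, blk_blk y hj, zero_add]
  rfl

theorem outcomeProb_attackCircuit {n m t κ : ℕ} (A : Circuit Gate (t * n) κ)
    (S : Circuit Gate (κ + n) 1) (V : Uni n) :
    outcomeProb ((attackCircuit ((t + 1) * n) (Nat.succ_mul t n) A S).run
      (tensorPow (vprdm V m) (t + 1))) accept =
    ∑ k, outcomeProb (A.run (tensorPow (vprdm V m) t)) k *
      outcomeProb (S.run (tensor (basisState k) (vprdm V m))) accept := by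
  rw [outcomeProb, attackCircuit_run (Nat.succ_mul t n) A S _ (tensorPow (vprdm V m) t) (vprdm V m)
    (tensorPow_succ_apply _ t), Complex.re_sum]
  refine Finset.sum_congr rfl fun k _ => ?_
  have h := (A.run_isHermitian (tensorPow_isHermitian (vprdm_isHermitian V m) t)).coe_re_apply_self k
  rw [outcomeProb, outcomeProb, ← Complex.re_ofReal_mul]
  congr 2
  exact h.symm

theorem vprdmVerify_self {n m : ℕ} (hm : m ≤ n) (V : Uni n) :
    vprdmVerify V m (vprdm V m) = 1 := by
  have hVV : (V : Op n)ᴴ * (V : Op n) = 1 := Matrix.mem_unitaryGroup_iff'.mp V.2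
  have h1 : (V : Op n)ᴴ * vprdm V m * (V : Op n) = taggedMixed n m := by
    rw [vprdm, show (V : Op n)ᴴ * ((V : Op n) * taggedMixed n m * (V : Op n)ᴴ) * (V : Op n) =
      ((V : Op n)ᴴ * (V : Op n)) * taggedMixed n m * ((V : Op n)ᴴ * (V : Op n)) by
        simp only [Matrix.mul_assoc], hVV, one_mul, mul_one]
  have h2 : ∀ ε : Reg m, taggedMixed n m (tail n ε) (tail n ε) = (((2 : ℝ) ^ m)⁻¹ : ℝ) := by
    intro ε
    rw [taggedMixed, Matrix.diagonal_apply_eq, if_pos ((eq_tail_iff hm _).2 ⟨ε, rfl⟩)]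
    push_cast
    rfl
  rw [vprdmVerify_eq hm, h1, Finset.sum_congr rfl fun ε _ => h2 ε, ← Complex.ofReal_sum,
    Complex.ofReal_re, Finset.sum_const, Finset.card_univ, nsmul_eq_mul, card_reg,
    mul_inv_cancel₀ (by positivity)]

theorem trace_vprdm_mul_self {n m : ℕ} (hm : m ≤ n) (V : Uni n) :
    (vprdm V m * vprdm V m).trace = ((2 : ℂ) ^ m)⁻¹ := by
  have hVV : (V : Op n)ᴴ * (V : Op n) = 1 := Matrix.mem_unitaryGroup_iff'.mp V.2
  have h1 : vprdm V m * vprdm V m =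
      (V : Op n) * (taggedMixed n m * taggedMixed n m) * (V : Op n)ᴴ := by
    rw [vprdm, show (V : Op n) * taggedMixed n m * (V : Op n)ᴴ *
      ((V : Op n) * taggedMixed n m * (V : Op n)ᴴ) = (V : Op n) * (taggedMixed n m *
        ((V : Op n)ᴴ * (V : Op n)) * taggedMixed n m) * (V : Op n)ᴴ by
        simp only [Matrix.mul_assoc], hVV, mul_one]
  rw [h1, Matrix.trace_mul_cycle, hVV, one_mul, taggedMixed, Matrix.diagonal_mul_diagonal,
    Matrix.trace_diagonal]
  have h2 : ∀ x : Reg n, (if ∀ i : Fin n, i.val < n - m → x i = false then ((2 : ℂ) ^ m)⁻¹ else 0) *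
      (if ∀ i : Fin n, i.val < n - m → x i = false then ((2 : ℂ) ^ m)⁻¹ else 0) =
      ind (∀ i : Fin n, i.val < n - m → x i = false) * (((2 : ℂ) ^ m)⁻¹ * ((2 : ℂ) ^ m)⁻¹) := by
    intro x
    rw [← ite_eq_ind]
    split_ifs <;> simp
  rw [Finset.sum_congr rfl fun x _ => h2 x, sum_ind_mul _ (tail_injective hm) (eq_tail_iff hm),
    Finset.sum_const, Finset.card_univ, nsmul_eq_mul,
    show (Fintype.card (Reg m) : ℂ) = 2 ^ m by simp, ← mul_assoc,
    mul_inv_cancel₀ (by positivity), one_mul]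

/-- Pseudorandom unitaries can be replaced by Haar random unitaries in the states given to a QPT
algorithm. -/
theorem IsPRU.leNegl_tensorPow {lam m t : ℕ → ℕ} (hm : UnaryPolyTime m) (hmn : ∀ n, m n ≤ n)
    {U : ∀ n, Reg (lam n) → Uni n} (hU : IsPRU lam U) (ht : UnaryPolyTime t)
    {D : ∀ n, Circuit Gate (t n * n) 1} (hD : IsQPT D) :
    LeNegl lam fun n =>
      |keyAvg (fun k => outcomeProb ((D n).run (tensorPow (vprdm (U n k) (m n)) (t n))) accept)
        - ∫ V, outcomeProb ((D n).run (tensorPow (vprdm V (m n)) (t n))) accept ∂(haar n)| := by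
  have := hU.pseudorandom _ (isOracleQPT_oracleCircuit hm hmn ht hD)
  simpa only [oracleCircuit_runWith (hmn _)] using this

/-- The Haar mean lies between the two probabilities: pseudorandomness controls one distance, the
collision bound `2 * t ^ 2 / 2 ^ m` the other. -/
theorem indistFromMaxMixed_vprdm {lam m : ℕ → ℕ} (hlam : UnaryPolyTime lam) (hm : UnaryPolyTime m)
    (hmn : ∀ n, m n ≤ n) {U : ∀ n, Reg (lam n) → Uni n} (hU : IsPRU lam U)
    (hlog : (fun n : ℕ => Real.log n) =o[atTop] fun n : ℕ => (m n : ℝ)) :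
    IndistFromMaxMixed lam fun n k => vprdm (U n k) (m n) := by
  intro t ht D hD
  obtain ⟨k, hk⟩ := ht.le_pow
  have h1 : LeNegl lam fun n => 2 * (t n : ℝ) ^ 2 / 2 ^ m n := by
    refine leNegl_div_two_pow hlam hlog (k := 2 * k + 1) fun n hn => ?_
    have h2 : (t n : ℝ) ≤ (n : ℝ) ^ k := by exact_mod_cast (Nat.le_succ _).trans (hk n hn)
    have h3 : (2 : ℝ) ≤ n := by exact_mod_cast hn
    calc 2 * (t n : ℝ) ^ 2 ≤ n * ((n : ℝ) ^ k) ^ 2 := by gcongr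
      _ = (n : ℝ) ^ (2 * k + 1) := by ring
  refine ((hU.leNegl_tensorPow hm hmn ht hD).add h1).mono fun n => ?_
  have h2 := abs_integral_tensorPow_sub_maxMixed_le (hmn n) (D n) accept
  refine (abs_sub_le _ (∫ V, outcomeProb ((D n).run (tensorPow (vprdm V (m n)) (t n))) accept
    ∂(haar n)) _).trans (add_le_add le_rfl (h2.trans (le_of_eq ?_)))
  ring

/-- The state generator that is built from circuits for the unitaries. -/
def vprdmGenerator {lam : ℕ → ℕ} (m : ℕ → ℕ) (G : ∀ n, Circuit Gate (lam n + n) n) :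
    StateGenerator lam where
  keyGen n := keyGenCircuit (lam n)
  stateGen n := stateGenCircuit (lam n) n (m n) (G n)
  ver n := verCircuit (lam n) n (m n) (G n)

/-- The security game is itself a one-bit test on `t + 1` copies, so pseudorandomness moves it to a
Haar random `V`, where winning has probability at most `(t + 1) / 2 ^ (n - m)`. The unitaries of the
guessed keys stay fixed during this replacement because they sit in the verifier's circuit. -/
theorem vprdmGenerator_isOWSG {lam m : ℕ → ℕ} (hlam : UnaryPolyTime lam) (hm : UnaryPolyTime m)
    (hmn : ∀ n, m n ≤ n)
    (hgap : (fun n : ℕ => Real.log n) =o[atTop] fun n : ℕ => (n : ℝ) - (m n : ℝ))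
    {U : ∀ n, Reg (lam n) → Uni n} (hU : IsPRU lam U) {G : ∀ n, Circuit Gate (lam n + n) n}
    (hG : IsQPT G) (hGU : ∀ (n : ℕ) (k : Reg (lam n)) (ψ : Reg n → ℂ), star ψ ⬝ᵥ ψ = 1 →
      (G n).run (tensor (basisState k) (pureState ψ)) = pureState ((U n k : Op n) *ᵥ ψ)) :
    (vprdmGenerator m G).IsOWSG lam := by
  have hkey : ∀ n k, (vprdmGenerator m G).keyProb n k = ((2 : ℝ) ^ lam n)⁻¹ := fun n k =>
    keyGenCircuit_outcomeProb _ _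
  have hst : ∀ n k, (vprdmGenerator m G).state n k = vprdm (U n k) (m n) := fun n k =>
    stateGenCircuit_run (hmn n) (G n) (U n k) k (hGU n k)
  have hver : ∀ n k ρ, outcomeProb ((verCircuit (lam n) n (m n) (G n)).run
      (tensor (basisState k) ρ)) accept = vprdmVerify (U n k) (m n) ρ := fun n k ρ =>
    verCircuit_outcomeProb (hmn n) (G n) (U n k) k (hGU n k) ρ
  have hverP : ∀ n k ρ, (vprdmGenerator m G).verProb n k ρ = vprdmVerify (U n k) (m n) ρ := hver
  have hvq := isQPT_verCircuit hlam hm hG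
  refine ⟨isQPT_keyGenCircuit hlam, isQPT_stateGenCircuit hlam hm hmn hG, hvq, ?_, ?_⟩
  -- Completeness is perfect: the failure probability is exactly zero.
  · refine LeNegl.of_eventually fun c => ⟨0, fun n _ => ?_⟩
    simp only [hkey, hverP, hst, vprdmVerify_self (hmn _), mul_one]
    rw [Finset.sum_const, Finset.card_univ, nsmul_eq_mul, card_reg, mul_inv_cancel₀ (by positivity),
      sub_self]
    positivity
  · intro t ht A hA
    have hN : UnaryPolyTime fun n => t n * n :=
      unaryPolyTime_iff.2 ((unaryPolyTime_iff.1 ht).mul PolyTime.id)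
    have hattack := hU.leNegl_tensorPow hm hmn ht.add_one
      (isQPT_attackCircuit hlam hN (fun n => Nat.succ_mul (t n) n) hA hvq)
    simp only [outcomeProb_attackCircuit, hver] at hattack
    obtain ⟨k, hk⟩ := ht.le_pow
    have hd : (fun n : ℕ => Real.log n) =o[atTop] fun n : ℕ => ((n - m n : ℕ) : ℝ) := by
      simpa only [Nat.cast_sub (hmn _)] using hgap
    have h1 : LeNegl lam fun n => ((t n : ℝ) + 1) / 2 ^ (n - m n) :=
      leNegl_div_two_pow hlam hd (k := k) fun n hn => by exact_mod_cast hk n hn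
    refine (hattack.add h1).mono fun n => ?_
    have h2 := integral_guess_le (hmn n) (A n) (U n)
    have h3 : ((t n : ℝ) + 1) * 2 ^ m n * ((2 : ℝ) ^ n)⁻¹ = ((t n : ℝ) + 1) / 2 ^ (n - m n) := by
      rw [show ((2 : ℝ) ^ n) = 2 ^ m n * 2 ^ (n - m n) by rw [← pow_add, Nat.add_sub_cancel' (hmn n)]]
      field_simp
    rw [h3] at h2
    have h4 : ∑ k, (vprdmGenerator m G).keyProb n k * ∑ k', outcomeProb ((A n).run
        (tensorPow ((vprdmGenerator m G).state n k) (t n))) k' *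
          (vprdmGenerator m G).verProb n k' ((vprdmGenerator m G).state n k) =
        keyAvg fun k => ∑ k', outcomeProb ((A n).run (tensorPow (vprdm (U n k) (m n)) (t n))) k' *
          vprdmVerify (U n k') (m n) (vprdm (U n k) (m n)) := by
      simp only [hkey, hverP, hst]
      rw [keyAvg, ← Finset.mul_sum, inv_mul_eq_div]
    rw [h4]
    have h5 := le_abs_self (keyAvg (fun k => ∑ k', outcomeProb ((A n).run
      (tensorPow (vprdm (U n k) (m n)) (t n))) k' *
        vprdmVerify (U n k') (m n) (vprdm (U n k) (m n))) -
      ∫ V, ∑ k', outcomeProb ((A n).run (tensorPow (vprdm V (m n)) (t n))) k' *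
        vprdmVerify (U n k') (m n) (vprdm V (m n)) ∂(haar n))
    linarith

end VPRDM

theorem mainTheorem9 (lam m : ℕ → ℕ)
    (hlam : VPRDM.UnaryPolyTime lam) (hm : VPRDM.UnaryPolyTime m)
    (hmn : ∀ n, m n ≤ n)
    (hgap : (fun n : ℕ => Real.log n) =o[atTop] fun n : ℕ => (n : ℝ) - (m n : ℝ))
    (U : ∀ n, VPRDM.Reg (lam n) → VPRDM.Uni n) (hU : VPRDM.IsPRU lam U) :
    (∃ S : VPRDM.StateGenerator lam,
      (∀ n k, S.keyProb n k = ((2 : ℝ) ^ lam n)⁻¹) ∧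
      (∀ n k, S.state n k = VPRDM.vprdm (U n k) (m n)) ∧
      (∀ (n : ℕ) (k : VPRDM.Reg (lam n)) (ρ : VPRDM.Op n), ρ.PosSemidef → ρ.trace = 1 →
        S.verProb n k ρ = VPRDM.vprdmVerify (U n k) (m n) ρ) ∧
      S.IsOWSG lam) ∧
    (∀ n k, (VPRDM.vprdm (U n k) (m n) * VPRDM.vprdm (U n k) (m n)).trace =
      ((2 : ℂ) ^ m n)⁻¹) ∧
    ((fun n : ℕ => Real.log n) =o[atTop] (fun n : ℕ => (m n : ℝ)) →
      VPRDM.IndistFromMaxMixed lam fun n k => VPRDM.vprdm (U n k) (m n)) := by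
  obtain ⟨G, hG, hGU⟩ := hU.efficient
  exact ⟨⟨VPRDM.vprdmGenerator m G, fun n k => VPRDM.keyGenCircuit_outcomeProb _ _,
    fun n k => VPRDM.stateGenCircuit_run (hmn n) (G n) (U n k) k (hGU n k),
    fun n k ρ _ _ => VPRDM.verCircuit_outcomeProb (hmn n) (G n) (U n k) k (hGU n k) ρ,
    VPRDM.vprdmGenerator_isOWSG hlam hm hmn hgap hU hG hGU⟩,
    fun n k => VPRDM.trace_vprdm_mul_self (hmn n) (U n k),
    VPRDM.indistFromMaxMixed_vprdm hlam hm hmn hU⟩
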